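/- All alphabets are finite and all logarithms, entropies and exponentials are to base $e$. Let $(S_1,S_2)$ be a pair of sources with joint pmf $\mathbb W_{S_1S_2}$ on $\mathcal S_1\times\mathcal S_2$, and let $\mathbb W_{Y_1Y_2|X_1X_2}$ be a memoryless two-user interference channel (IC) with input alphabets $\mathcal X_1,\mathcal X_2$ and output alphabets $\mathcal Y_1,\mathcal Y_2$. The sources are *transmissible* over the IC if for every $\varepsilon>0$ and all sufficiently large $n$ there are encoders $e_j:\mathcal S_j^n\to\mathcal X_j^n$ and decoders $d_j:\mathcal Y_j^n\to\mathcal S_j^n$, $j=1,2$, such that, when $(S_1^n,S_2^n)$ is i.i.d. $\sim\mathbb W_{S_1S_2}$, $X_j^n=e_j(S_j^n)$, and $(Y_1^n,Y_2^n)$ is the output of $n$ uses of the IC, $P\big(d_1(Y_1^n)\ne S_1^n\text{ or }d_2(Y_2^n)\neq S_2^n\big)\le\varepsilon$. **Theorem.** The sources are transmissible over the IC if there exist (i) a finite set $\mathcal K$ and maps $f_j:\mathcal S_j\to\mathcal K$, with $K_j=f_j(S_j)$, $j=1,2$; (ii) an integer $l\ge1$ and $\delta>0$; (iii) finite sets $\mathcal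 U,\mathcal V_1,\mathcal V_2$ and a pmf $p_Up_{V_1}p_{V_2}p_{X_1|UV_1}p_{X_2|UV_2}$ on $\mathcal U\times\mathcal V_1\times\mathcal V_2\times\mathcal X_1\times\mathcal X_2$, where $p_U$ is the type (empirical distribution) of some sequence in $\mathcal U^l$; let $(U,V_1,V_2,X_1,X_2,Y_1,Y_2)\sim p_Up_{V_1}p_{V_2}p_{X_1|UV_1}p_{X_2|UV_2}\mathbb W_{Y_1Y_2|X_1X_2}$; (iv) $A,B\ge0$ and $\rho\in(0,A)$, such that $\phi\in[0,\tfrac12)$, $A+B\ge(1+\delta)H(K_1)$ and, for $j=1,2$, $$B+H(S_j|K_1)+\mathcal L^S_l(\phi,|\mathcal S_j|)<I(V_j;Y_j)-\mathcal L^C_j(\phi,|\mathcal U|).$$ Here $\phi=g_{\rho,l}+\xi^{[l]}(K_1,K_2)+\tau_{l,\delta}(K_1)$, where $$g_{\rho,l}=\sum_{j=1}^2\exp\{-l(E_r(A+\rho,p_U,p_{Y_j|U})-\rho)\},$$ $$E_r(R,p,W)=\min_{V}\{D(V\|W|p)+\max(I(p;V)-R,0)\}$$ (minimum over all channels $V$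 with the same input and output alphabets as $W$), $\xi^{[l]}(K_1,K_2)=P(K_1^l\ne K_2^l)$ for $l$ i.i.d. copies of $(K_1,K_2)$, and $\tau_{l,\delta}(K_1)=2|\mathcal K|\exp\{-2\delta^2p_{K_1}(a^*)^2l\}$ with $p_{K_1}(a^*)$ the least positive value of the pmf of $K_1$. With $h_b$ the binary entropy function, $$\mathcal L^S_l(\phi,n)=\tfrac1l h_b(\phi)+\phi\log n,\qquad \mathcal L^C_j(\phi,n)=h_b(\phi)+\phi\log n+|\mathcal Y_j|\,n\,\phi\log\tfrac1\phi .$$ -/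

import Mathlib

noncomputable section

namespace SourceIC

/-! Finite probability. A pmf on a finite type `Ω` is a function `p : Ω → ℝ` with
`p ∈ stdSimplex ℝ Ω`; a random variable is a function on `Ω`. All logarithms are natural. -/

section FiniteProbability

variable {Ω α β : Type*} [Fintype Ω] [Fintype α] [Fintype β]

/-- Probability of the event `E` under the pmf `p`. -/
def prob (p : Ω → ℝ) (E : Set Ω) : ℝ := ∑ ω, E.indicator p ω

/-- The pmf of the random variable `X` under `p`. -/
def law (p : Ω → ℝ) (X : Ω → α) : α → ℝ := fun a => prob p {ω | X ω = a}

/-- Shannon entropy `H(X)` in nats. -/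
def entropy (p : Ω → ℝ) (X : Ω → α) : ℝ := ∑ a, Real.negMulLog (law p X a)

/-- Conditional entropy `H(X | Z) = H(X, Z) - H(Z)`. -/
def condEntropy (p : Ω → ℝ) (X : Ω → α) (Z : Ω → β) : ℝ :=
  entropy p (fun ω => (X ω, Z ω)) - entropy p Z

/-- Mutual information `I(X; Z) = H(X) + H(Z) - H(X, Z)`. -/
def mutualInfo (p : Ω → ℝ) (X : Ω → α) (Z : Ω → β) : ℝ :=
  entropy p X + entropy p Z - entropy p (fun ω => (X ω, Z ω))

/-- The conditional pmf `p_{Z | X}(z | x)` (only meaningful where `P(X = x) > 0`). -/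
def condLaw (p : Ω → ℝ) (Z : Ω → β) (X : Ω → α) : α → β → ℝ :=
  fun x z => law p (fun ω => (X ω, Z ω)) (x, z) / law p X x

/-- The product pmf of `n` independent copies. -/
def iid (p : Ω → ℝ) (n : ℕ) : (Fin n → Ω) → ℝ := fun s => ∏ i, p (s i)

/-- The least positive value of the pmf `p`. -/
def minPosProb (p : α → ℝ) : ℝ := sInf {x | 0 < x ∧ ∃ a, p a = x}

/-- `p` is the type (empirical distribution) of some sequence in `α ^ l`. -/
def IsTypeOfLength (p : α → ℝ) (l : ℕ) : Prop :=
  ∃ u : Fin l → α, ∀ a, p a = (Nat.card {i // u i = a} : ℝ) / (l : ℝ)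

end FiniteProbability

section Exponent

variable {U Y : Type*} [Fintype U] [Fintype Y]

/-- The conditional divergence `D(V ‖ W | p)`, for `V(· | u) ≪ W(· | u)` whenever `p u > 0`. -/
def condDiv (V W : U → Y → ℝ) (p : U → ℝ) : ℝ :=
  ∑ u, p u * ∑ y, V u y * Real.log (V u y / W u y)

/-- The random coding exponent `E_r(R, p, W) = min_V { D(V ‖ W | p) + |I(p; V) - R|⁺ }` for constant
composition codes of type `p`. The minimum is over the channels `V` with finite `D(V ‖ W | p)`;
all others contribute `+∞`. -/
def randomCodingExponent (R : ℝ) (p : U → ℝ) (W : U → Y → ℝ) : ℝ :=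
  sInf {e | ∃ V : U → Y → ℝ, (∀ u, V u ∈ stdSimplex ℝ Y) ∧
    (∀ u y, 0 < p u → W u y = 0 → V u y = 0) ∧
    e = condDiv V W p +
      max (mutualInfo (fun uy : U × Y => p uy.1 * V uy.1 uy.2) Prod.fst Prod.snd - R) 0}

end Exponent

section Terms

variable {S₁ S₂ K U V₁ V₂ X₁ X₂ Y₁ Y₂ : Type*} [Fintype S₁] [Fintype S₂] [Fintype K] [Fintype U]
  [Fintype V₁] [Fintype V₂] [Fintype X₁] [Fintype X₂] [Fintype Y₁] [Fintype Y₂]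

/-- `ξ^{[l]}(K₁, K₂) = P(K₁^l ≠ K₂^l)` for `K_j = f_j(S_j)` and `l` iid copies of `(S₁, S₂)`. -/
def blockDisagreement (pS : S₁ × S₂ → ℝ) (f₁ : S₁ → K) (f₂ : S₂ → K) (l : ℕ) : ℝ :=
  prob (iid pS l) {s | (fun i => f₁ (s i).1) ≠ (fun i => f₂ (s i).2)}

/-- `τ_{l,δ}(K) = 2 |𝒦| exp(-2 δ² p_K(a*)² l)`, with `p` the pmf of `K`. -/
def atypicalityBound (p : K → ℝ) (l : ℕ) (δ : ℝ) : ℝ :=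
  2 * (Fintype.card K : ℝ) * Real.exp (-2 * δ ^ 2 * minPosProb p ^ 2 * (l : ℝ))

/-- The joint pmf `p_U p_{V₁} p_{V₂} p_{X₁|UV₁} p_{X₂|UV₂} W_{Y₁Y₂|X₁X₂}`. -/
def jointPmf (pU : U → ℝ) (pV₁ : V₁ → ℝ) (pV₂ : V₂ → ℝ) (pX₁ : U → V₁ → X₁ → ℝ)
    (pX₂ : U → V₂ → X₂ → ℝ) (W : X₁ → X₂ → Y₁ × Y₂ → ℝ) :
    U × (V₁ × V₂) × (X₁ × X₂) × (Y₁ × Y₂) → ℝ :=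
  fun ω => pU ω.1 * pV₁ ω.2.1.1 * pV₂ ω.2.1.2 * pX₁ ω.1 ω.2.1.1 ω.2.2.1.1 *
    pX₂ ω.1 ω.2.1.2 ω.2.2.1.2 * W ω.2.2.1.1 ω.2.2.1.2 ω.2.2.2

/-- `g_{ρ,l} = ∑_j exp(-l (E_r(A + ρ, p_U, p_{Y_j|U}) - ρ))`, with `q` the joint pmf of all
channel variables. -/
def innerCodeError (q : U × (V₁ × V₂) × (X₁ × X₂) × (Y₁ × Y₂) → ℝ) (A ρ : ℝ) (l : ℕ) : ℝ :=
  Real.exp (-(l : ℝ) * (randomCodingExponent (A + ρ) (law q fun ω => ω.1)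
      (condLaw q (fun ω => ω.2.2.2.1) fun ω => ω.1) - ρ)) +
  Real.exp (-(l : ℝ) * (randomCodingExponent (A + ρ) (law q fun ω => ω.1)
      (condLaw q (fun ω => ω.2.2.2.2) fun ω => ω.1) - ρ))

/-- `L^S_l(φ, n) = h_b(φ) / l + φ log n`. -/
def sourceLoss (l : ℕ) (φ : ℝ) (n : ℕ) : ℝ := Real.binEntropy φ / (l : ℝ) + φ * Real.log n

/-- `L^C(φ, u) = h_b(φ) + φ log u + y u φ log (1 / φ)`, for an output alphabet of size `y`. -/
def channelLoss (y : ℕ) (φ : ℝ) (u : ℕ) : ℝ :=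
  Real.binEntropy φ + φ * Real.log u + (y : ℝ) * (u : ℝ) * φ * Real.log (1 / φ)

end Terms

section Transmissibility

variable {S₁ S₂ X₁ X₂ Y₁ Y₂ : Type*} [Fintype S₁] [Fintype S₂] [Fintype Y₁] [Fintype Y₂]

/-- The probability that some decoder `j` fails to reconstruct `S_j^n`, when the iid source block is
sent over `n` uses of the memoryless interference channel `W`. -/
def errorProb (pS : S₁ × S₂ → ℝ) (W : X₁ → X₂ → Y₁ × Y₂ → ℝ) (n : ℕ)
    (e₁ : (Fin n → S₁) → Fin n → X₁) (e₂ : (Fin n → S₂) → Fin n → X₂)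
    (d₁ : (Fin n → Y₁) → Fin n → S₁) (d₂ : (Fin n → Y₂) → Fin n → S₂) : ℝ :=
  prob (fun ω : (Fin n → S₁ × S₂) × (Fin n → Y₁ × Y₂) =>
      iid pS n ω.1 *
        ∏ i, W (e₁ (fun k => (ω.1 k).1) i) (e₂ (fun k => (ω.1 k).2) i) (ω.2 i))
    {ω | d₁ (fun k => (ω.2 k).1) ≠ (fun k => (ω.1 k).1) ∨
      d₂ (fun k => (ω.2 k).2) ≠ (fun k => (ω.1 k).2)}

/-- The sources are transmissible over the interference channel (one channel use per source
symbol): there are codes of every large block length whose error probabilities tend to `0`. -/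
def Transmissible (pS : S₁ × S₂ → ℝ) (W : X₁ → X₂ → Y₁ × Y₂ → ℝ) : Prop :=
  ∀ ε : ℝ, 0 < ε → ∃ N : ℕ, ∀ n : ℕ, N ≤ n →
    ∃ (e₁ : (Fin n → S₁) → Fin n → X₁) (e₂ : (Fin n → S₂) → Fin n → X₂)
      (d₁ : (Fin n → Y₁) → Fin n → S₁) (d₂ : (Fin n → Y₂) → Fin n → S₂),
      errorProb pS W n e₁ e₂ d₁ d₂ ≤ ε

end Transmissibility

end SourceIC

end

open SourceIC

noncomputable section

namespace SourceIC

open scoped Classical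

/-! A short inner code for the nearly common part is concatenated with a long outer random code.
Source and channel are grouped into super-letters of length `L = (|U| + 2) l`. The typical values of
`K₁^L` are split into roughly `exp (L A)` bins of at most `exp (L (B + β))` sequences, where `β` is
a small correction, and every bin gets a codeword of type `p_U`. User `j` looks up the bin of its
own `K_j^L`; given that codeword it feeds the channel through `V_j` and `p_{X_j|U V_j}`. When `K₁^L
= K₂^L` both users select the same codeword, and each receiver can recover the bin with small error.

The outer code assigns an independent random codeword to every sequence of source super-letters. The
receiver applies a threshold test to a product metric `θ(s, v, y)`: an information density between
`v` and `y` (`channelMetric`) times an estimate of the probability of `s` given the bin decoded from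
`y` (`sourceMetric`). The true law of a super-letter is awkward, but only two facts are needed
(`exists_code_of_pos_drift`). First, `∑_{s,v} p_V(v) θ(s, v, y) ≤ 1` for every `y`, so that false
candidates are controlled by Markov and union bounds. Second, `log θ` has positive mean under the
true law, so that a Chernoff bound controls the true candidate.

The metrics are mixed with small constants: `ψ = (|U| + 2) φ` in the channel factor and in the bin
weights, and `φ` in the source factor. A disagreement of the users, a wrong bin or an atypical block
therefore costs only its probability times the logarithm of a floor (`le_drift`). `budget_pos` shows
that the loss terms of the theorem pay for all of this. The same loss terms force `φ` to be small
enough for the numerical estimates (`small_of_loss_lt`).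

The inner code comes from random constant composition coding (`exists_constant_composition_code`).
Its exponent is reached through a dual description of `E_r`: the minimising channel is a geometric
mixture of `W` and the minimiser's own output pmf (`exists_tilting`). The coding bound carries a
polynomial factor `(L + 1)^|U|` that is absent from `g_{ρ,l}`, which is why `L` exceeds `l`. As
`g_{ρ,l} ≤ φ`, each `l (E_r - ρ)` is at least `log (1/φ)`. Hence `|U| + 1` of the `|U| + 2`
sub-blocks can be spent on the polynomial factor, and the last one still gives the error `exp (-l
(E_r - ρ))` (`inner_error_le`). The price is that the disagreement probability grows by the factor
`|U| + 2`.

Block lengths not divisible by `L` are treated by carrying the leftover source letters as a bounded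
extra message of the outer code (`transmissible_of_block_codes`). -/

/-- Real-valued indicator of a proposition. -/
def ind (P : Prop) : ℝ := if P then 1 else 0

lemma ind_of {P : Prop} (h : P) : ind P = 1 := if_pos h

lemma ind_not {P : Prop} (h : ¬P) : ind P = 0 := if_neg h

lemma ind_nonneg (P : Prop) : 0 ≤ ind P := by unfold ind; split_ifs <;> norm_num

lemma ind_le_one (P : Prop) : ind P ≤ 1 := by unfold ind; split_ifs <;> norm_num

/-! ### Expectations under product pmfs. -/

section ProductSums

variable {ι α : Type*} [Fintype ι] [DecidableEq ι] [Fintype α]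

lemma sum_fun_prod (g : ι → α → ℝ) : ∑ f : ι → α, ∏ i, g i (f i) = ∏ i, ∑ a, g i a := by
  rw [Finset.prod_univ_sum, Fintype.piFinset_univ]

/-- Inserting factors equal to `1` away from `i` and `j` makes the summand a product over all
coordinates. This is the independence of two coordinates of a product pmf. -/
lemma sum_fun_prod_mul_mul (w : ι → α → ℝ) (hw : ∀ i, ∑ a, w i a = 1) {i j : ι} (hij : i ≠ j)
    (g h : α → ℝ) :
    ∑ C : ι → α, (∏ k, w k (C k)) * (g (C i) * h (C j))
      = (∑ a, w i a * g a) * ∑ a, w j a * h a := by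
  have key : ∀ C : ι → α, (∏ k, w k (C k)) * (g (C i) * h (C j))
      = ∏ k, w k (C k) * ((if k = i then g (C k) else 1) * (if k = j then h (C k) else 1)) := by
    intro C
    rw [Finset.prod_mul_distrib, Finset.prod_mul_distrib]
    simp [Finset.prod_ite_eq']
  simp_rw [key]
  rw [sum_fun_prod (fun k a => w k a * ((if k = i then g a else 1) * (if k = j then h a else 1)))]
  have h2 : ∀ k, ∑ a, w k a * ((if k = i then g a else 1) * (if k = j then h a else 1))
      = (if k = i then ∑ a, w i a * g a else 1) * (if k = j then ∑ a, w j a * h a else 1) := by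
    intro k
    by_cases hi : k = i
    · subst hi; simp [hij]
    · by_cases hj : k = j
      · subst hj; simp [hi]
      · simp [hi, hj, hw]
  simp_rw [h2]
  rw [Finset.prod_mul_distrib]
  simp

lemma sum_fun_prod_mul (w : ι → α → ℝ) (hw : ∀ i, ∑ a, w i a = 1) (i : ι) (g : α → ℝ) :
    ∑ C : ι → α, (∏ k, w k (C k)) * g (C i) = ∑ a, w i a * g a := by
  have key : ∀ C : ι → α, (∏ k, w k (C k)) * g (C i)
      = ∏ k, w k (C k) * (if k = i then g (C k) else 1) := by
    intro C
    rw [Finset.prod_mul_distrib]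
    simp [Finset.prod_ite_eq']
  simp_rw [key]
  rw [sum_fun_prod (fun k a => w k a * (if k = i then g a else 1))]
  have h2 : ∀ k, ∑ a, w k a * (if k = i then g a else 1)
      = (if k = i then ∑ a, w i a * g a else 1) := by
    intro k
    by_cases hi : k = i
    · subst hi; simp
    · simp [hi, hw]
  simp_rw [h2]
  simp

/-- Splitting `f` along the value of the second coordinate reduces to product test functions. In the
coding arguments the pair consists of the transmitted codeword and a competing one. -/
lemma sum_fun_prod_mul_pair (w : ι → α → ℝ) (hw : ∀ i, ∑ a, w i a = 1) {i j : ι} (hij : i ≠ j)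
    (f : α → α → ℝ) :
    ∑ C : ι → α, (∏ k, w k (C k)) * f (C i) (C j) = ∑ a, ∑ b, w i a * (w j b * f a b) := by
  have key : ∀ C : ι → α, (∏ k, w k (C k)) * f (C i) (C j)
      = ∑ b, (∏ k, w k (C k)) * (f (C i) b * (if C j = b then 1 else 0)) := by
    intro C; simp
  simp_rw [key]
  rw [Finset.sum_comm]
  simp_rw [fun b => sum_fun_prod_mul_mul w hw hij (fun a => f a b) (fun c => if c = b then 1 else 0)]
  rw [Finset.sum_comm]
  refine Finset.sum_congr rfl fun b _ => ?_
  simp [Finset.sum_mul]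
  refine Finset.sum_congr rfl fun a _ => by ring

lemma sum_fun_prod_eq_one (w : ι → α → ℝ) (hw : ∀ i, ∑ a, w i a = 1) :
    ∑ C : ι → α, ∏ k, w k (C k) = 1 := by
  rw [sum_fun_prod]; simp [hw]

/-- Some point does at least as well as the average. -/
lemma exists_pos_le_of_average_le (p f : α → ℝ) (hp : p ∈ stdSimplex ℝ α)
    {c : ℝ} (h : ∑ a, p a * f a ≤ c) : ∃ a, 0 < p a ∧ f a ≤ c := by
  by_contra hcon
  push Not at hcon
  have h1 : ∀ a, p a * c ≤ p a * f a := fun a => by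
    rcases (hp.1 a).eq_or_lt with h | h
    · rw [← h]; simp
    · exact mul_le_mul_of_nonneg_left (hcon a h).le h.le
  obtain ⟨a, ha⟩ : ∃ a, 0 < p a := by
    by_contra hn
    push Not at hn
    have := hp.2
    rw [Finset.sum_eq_zero fun a _ => le_antisymm (hn a) (hp.1 a)] at this
    exact zero_ne_one this
  have h2 : ∑ a, p a * c < ∑ a, p a * f a := Finset.sum_lt_sum (fun a _ => h1 a)
    ⟨a, Finset.mem_univ a, mul_lt_mul_of_pos_left (hcon a ha) ha⟩
  rw [← Finset.sum_mul, hp.2, one_mul] at h2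
  linarith

end ProductSums

/-! ### One-shot random coding with threshold decoders. -/

section OneShot

variable {Ω₁ Ω₂ A₁ A₂ Z Y : Type*} [Fintype Ω₁] [Fintype Ω₂] [Fintype A₁] [Fintype A₂]
  [Fintype Z]

/-- The threshold decoder: some message whose metric exceeds `T`. -/
def thresholdDecoder {Ω Y : Type*} [Nonempty Ω] (Θ : Ω → Y → ℝ) (T : ℝ) (y : Y) : Ω :=
  if h : ∃ w, T < Θ w y then h.choose else Classical.arbitrary Ω

/-- If the true message passes the test, a wrong decision is a message whose metric exceeds `T`, so
its term `Θ / T` is above one. Being linear in the competing metrics, the bound needs only their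
means over the codebook. -/
lemma thresholdDecoder_error_le {Ω Y : Type*} [Fintype Ω] [Nonempty Ω] (Θ : Ω → Y → ℝ)
    (hΘ : ∀ w y, 0 ≤ Θ w y) {T : ℝ} (hT : 0 < T) (y : Y) (w : Ω) :
    ind (thresholdDecoder Θ T y ≠ w)
      ≤ ind (Θ w y ≤ T) + ∑ w', if w' ≠ w then Θ w' y / T else 0 := by
  have hnn : ∀ w', (0 : ℝ) ≤ if w' ≠ w then Θ w' y / T else 0 := by
    intro w'; split_ifs
    · exact div_nonneg (hΘ _ _) hT.le
    · exact le_rfl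
  have hsum : (0 : ℝ) ≤ ∑ w', if w' ≠ w then Θ w' y / T else 0 :=
    Finset.sum_nonneg fun w' _ => hnn w'
  by_cases hd : thresholdDecoder Θ T y = w
  · rw [ind_not (not_not.mpr hd)]
    linarith [ind_nonneg (Θ w y ≤ T)]
  · rw [ind_of hd]
    by_cases hw : Θ w y ≤ T
    · rw [ind_of hw]; linarith
    · rw [ind_not hw, zero_add]
      have hex : ∃ w, T < Θ w y := ⟨w, not_le.mp hw⟩
      have hspec := hex.choose_spec
      have hdef : thresholdDecoder Θ T y = hex.choose := by simp [thresholdDecoder, hex]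
      rw [← hdef] at hspec
      have := Finset.single_le_sum (f := fun w' => if w' ≠ w then Θ w' y / T else 0)
        (fun w' _ => hnn w') (Finset.mem_univ (thresholdDecoder Θ T y))
      simp only [ne_eq, hd, not_false_eq_true, if_true] at this
      refine le_trans ?_ this
      rw [le_div_iff₀ hT]; linarith

/-- Average performance of the threshold decoder for the first user over random codebooks. -/
lemma average_threshold_error_le [Nonempty Ω₁] (p : Ω₁ → Ω₂ → ℝ) (hp0 : ∀ w₁ w₂, 0 ≤ p w₁ w₂)
    (hp1 : ∑ w₁, ∑ w₂, p w₁ w₂ = 1)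
    (μ₁ : Ω₁ → A₁ → ℝ) (hμ₁ : ∀ w, μ₁ w ∈ stdSimplex ℝ A₁)
    (μ₂ : Ω₂ → A₂ → ℝ) (hμ₂ : ∀ w, μ₂ w ∈ stdSimplex ℝ A₂)
    (G : A₁ → A₂ → Z → ℝ) (hG : ∀ a₁ a₂, G a₁ a₂ ∈ stdSimplex ℝ Z) (π : Z → Y)
    (Θ : Ω₁ → A₁ → Y → ℝ) (hΘ : ∀ w a y, 0 ≤ Θ w a y) {D T : ℝ} (hT : 0 < T)
    (hD : ∀ y, ∑ w, ∑ a, μ₁ w a * Θ w a y ≤ D) :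
    ∑ C₁ : Ω₁ → A₁, ∑ C₂ : Ω₂ → A₂, (∏ w, μ₁ w (C₁ w)) * (∏ w, μ₂ w (C₂ w)) *
        ∑ w₁, ∑ w₂, ∑ z, p w₁ w₂ * G (C₁ w₁) (C₂ w₂) z *
          ind (thresholdDecoder (fun w y => Θ w (C₁ w) y) T (π z) ≠ w₁)
      ≤ (∑ w₁, ∑ w₂, ∑ a₁, ∑ a₂, ∑ z, p w₁ w₂ * μ₁ w₁ a₁ * μ₂ w₂ a₂ * G a₁ a₂ z *
          ind (Θ w₁ a₁ (π z) ≤ T)) + D / T := by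
  have hprod1 : ∀ C₁ : Ω₁ → A₁, 0 ≤ ∏ w, μ₁ w (C₁ w) := fun C =>
    Finset.prod_nonneg fun w _ => (hμ₁ w).1 _
  have hprod2 : ∀ C₂ : Ω₂ → A₂, 0 ≤ ∏ w, μ₂ w (C₂ w) := fun C =>
    Finset.prod_nonneg fun w _ => (hμ₂ w).1 _
  -- bound for a fixed message pair and output
  have hpt : ∀ w₁ w₂ z,
      ∑ C₁ : Ω₁ → A₁, ∑ C₂ : Ω₂ → A₂, (∏ w, μ₁ w (C₁ w)) * (∏ w, μ₂ w (C₂ w)) *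
        (G (C₁ w₁) (C₂ w₂) z *
          ind (thresholdDecoder (fun w y => Θ w (C₁ w) y) T (π z) ≠ w₁))
      ≤ (∑ a₁, ∑ a₂, μ₁ w₁ a₁ * μ₂ w₂ a₂ * G a₁ a₂ z * ind (Θ w₁ a₁ (π z) ≤ T))
        + (∑ a₁, ∑ a₂, μ₁ w₁ a₁ * μ₂ w₂ a₂ * G a₁ a₂ z) * (D / T) := by
    intro w₁ w₂ z
    have hC2 : ∀ C₁ : Ω₁ → A₁, ∀ e : ℝ,
        ∑ C₂ : Ω₂ → A₂, (∏ w, μ₁ w (C₁ w)) * (∏ w, μ₂ w (C₂ w)) * (G (C₁ w₁) (C₂ w₂) z * e)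
          = (∏ w, μ₁ w (C₁ w)) * ((∑ a₂, μ₂ w₂ a₂ * G (C₁ w₁) a₂ z) * e) := by
      intro C₁ e
      rw [← sum_fun_prod_mul μ₂ (fun w => (hμ₂ w).2) w₂ (fun a => G (C₁ w₁) a z),
        Finset.sum_mul, Finset.mul_sum]
      exact Finset.sum_congr rfl fun C₂ _ => by ring
    simp_rw [hC2]
    set g : A₁ → ℝ := fun a₁ => ∑ a₂, μ₂ w₂ a₂ * G a₁ a₂ z with hg
    have hg0 : ∀ a, 0 ≤ g a := fun a =>
      Finset.sum_nonneg fun a₂ _ => mul_nonneg ((hμ₂ _).1 _) ((hG _ _).1 _)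
    calc _ ≤ ∑ C₁ : Ω₁ → A₁, (∏ w, μ₁ w (C₁ w)) * (g (C₁ w₁) *
            (ind (Θ w₁ (C₁ w₁) (π z) ≤ T)
              + ∑ w', if w' ≠ w₁ then Θ w' (C₁ w') (π z) / T else 0)) := by
          refine Finset.sum_le_sum fun C₁ _ => mul_le_mul_of_nonneg_left
            (mul_le_mul_of_nonneg_left ?_ (hg0 _)) (hprod1 _)
          exact thresholdDecoder_error_le (fun w y => Θ w (C₁ w) y) (fun w y => hΘ _ _ _) hT (π z) w₁
      _ = (∑ a₁, μ₁ w₁ a₁ * (g a₁ * ind (Θ w₁ a₁ (π z) ≤ T)))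
          + ∑ w', if w' ≠ w₁ then
              (∑ a₁, ∑ b, μ₁ w₁ a₁ * (μ₁ w' b * (g a₁ * (Θ w' b (π z) / T)))) else 0 := by
          simp_rw [mul_add, Finset.sum_add_distrib]
          congr 1
          · exact sum_fun_prod_mul μ₁ (fun w => (hμ₁ w).2) w₁
              (fun a => g a * ind (Θ w₁ a (π z) ≤ T))
          · simp_rw [Finset.mul_sum]
            rw [Finset.sum_comm]
            refine Finset.sum_congr rfl fun w' _ => ?_
            by_cases hw : w' = w₁
            · simp [hw]
            · simp only [ne_eq, hw, not_false_eq_true, if_true]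
              -- A competing codeword is independent of the transmitted one, hence also of the
              -- output.
              exact sum_fun_prod_mul_pair μ₁ (fun w => (hμ₁ w).2) (Ne.symm hw)
                (fun a b => g a * (Θ w' b (π z) / T))
      -- The term `w' = w₁` is added back so that the hypothesis `hD`, a sum over all messages, can
      -- be applied.
      _ ≤ (∑ a₁, μ₁ w₁ a₁ * (g a₁ * ind (Θ w₁ a₁ (π z) ≤ T)))
          + ∑ w', (∑ a₁, μ₁ w₁ a₁ * g a₁) * (∑ b, μ₁ w' b * Θ w' b (π z)) / T := by
          gcongr with w' _
          have h1 : ∑ a₁, ∑ b, μ₁ w₁ a₁ * (μ₁ w' b * (g a₁ * (Θ w' b (π z) / T)))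
              = (∑ a₁, μ₁ w₁ a₁ * g a₁) * (∑ b, μ₁ w' b * Θ w' b (π z)) / T := by
            rw [Finset.sum_mul_sum, Finset.sum_div]
            refine Finset.sum_congr rfl fun a _ => ?_
            rw [Finset.sum_div]
            exact Finset.sum_congr rfl fun b _ => by ring
          split_ifs
          · exact h1.le
          · refine div_nonneg (mul_nonneg ?_ ?_) hT.le
            · exact Finset.sum_nonneg fun a _ => mul_nonneg ((hμ₁ _).1 _) (hg0 _)
            · exact Finset.sum_nonneg fun a _ => mul_nonneg ((hμ₁ _).1 _) (hΘ _ _ _)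
      _ ≤ _ := by
          rw [← Finset.sum_div, ← Finset.mul_sum]
          have e1 : ∀ a₁, μ₁ w₁ a₁ * (g a₁ * ind (Θ w₁ a₁ (π z) ≤ T))
              = ∑ a₂, μ₁ w₁ a₁ * μ₂ w₂ a₂ * G a₁ a₂ z * ind (Θ w₁ a₁ (π z) ≤ T) := by
            intro a₁
            rw [hg, Finset.sum_mul, Finset.mul_sum]
            exact Finset.sum_congr rfl fun _ _ => by ring
          have e2 : ∀ a₁, μ₁ w₁ a₁ * g a₁ = ∑ a₂, μ₁ w₁ a₁ * μ₂ w₂ a₂ * G a₁ a₂ z := by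
            intro a₁
            rw [hg, Finset.mul_sum]
            exact Finset.sum_congr rfl fun _ _ => by ring
          simp_rw [e1, e2, mul_div_assoc]
          gcongr
          · exact Finset.sum_nonneg fun a _ => Finset.sum_nonneg fun b _ =>
              mul_nonneg (mul_nonneg ((hμ₁ _).1 _) ((hμ₂ _).1 _)) ((hG _ _).1 _)
          · exact hD _
  have hre : ∑ C₁ : Ω₁ → A₁, ∑ C₂ : Ω₂ → A₂, (∏ w, μ₁ w (C₁ w)) * (∏ w, μ₂ w (C₂ w)) *
        ∑ w₁, ∑ w₂, ∑ z, p w₁ w₂ * G (C₁ w₁) (C₂ w₂) z *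
          ind (thresholdDecoder (fun w y => Θ w (C₁ w) y) T (π z) ≠ w₁)
      = ∑ w₁, ∑ w₂, p w₁ w₂ * ∑ z,
        ∑ C₁ : Ω₁ → A₁, ∑ C₂ : Ω₂ → A₂, (∏ w, μ₁ w (C₁ w)) * (∏ w, μ₂ w (C₂ w)) *
        (G (C₁ w₁) (C₂ w₂) z *
          ind (thresholdDecoder (fun w y => Θ w (C₁ w) y) T (π z) ≠ w₁)) := by
    simp_rw [Finset.mul_sum]
    have sw : ∀ F : (Ω₁ → A₁) → (Ω₂ → A₂) → Ω₁ → Ω₂ → Z → ℝ,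
        ∑ C₁, ∑ C₂, ∑ w₁, ∑ w₂, ∑ z, F C₁ C₂ w₁ w₂ z
          = ∑ w₁, ∑ w₂, ∑ z, ∑ C₁, ∑ C₂, F C₁ C₂ w₁ w₂ z := by
      intro F
      have := Finset.sum_comm (s := (Finset.univ : Finset ((Ω₁ → A₁) × (Ω₂ → A₂))))
        (t := (Finset.univ : Finset (Ω₁ × Ω₂ × Z)))
        (f := fun C w => F C.1 C.2 w.1 w.2.1 w.2.2)
      simp only [Fintype.sum_prod_type] at this ⊢
      exact this
    rw [sw]
    refine Finset.sum_congr rfl fun w₁ _ => Finset.sum_congr rfl fun w₂ _ =>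
      Finset.sum_congr rfl fun z _ => Finset.sum_congr rfl fun C₁ _ =>
      Finset.sum_congr rfl fun C₂ _ => by ring
  rw [hre]
  calc _ ≤ ∑ w₁, ∑ w₂, p w₁ w₂ * ∑ z,
        ((∑ a₁, ∑ a₂, μ₁ w₁ a₁ * μ₂ w₂ a₂ * G a₁ a₂ z * ind (Θ w₁ a₁ (π z) ≤ T))
        + (∑ a₁, ∑ a₂, μ₁ w₁ a₁ * μ₂ w₂ a₂ * G a₁ a₂ z) * (D / T)) := by
        refine Finset.sum_le_sum fun w₁ _ => Finset.sum_le_sum fun w₂ _ =>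
          mul_le_mul_of_nonneg_left (Finset.sum_le_sum fun z _ => hpt w₁ w₂ z) (hp0 _ _)
    _ = ∑ w₁, ∑ w₂, (p w₁ w₂ * ∑ z,
        (∑ a₁, ∑ a₂, μ₁ w₁ a₁ * μ₂ w₂ a₂ * G a₁ a₂ z * ind (Θ w₁ a₁ (π z) ≤ T))
        + p w₁ w₂ * (D / T)) := by
        refine Finset.sum_congr rfl fun w₁ _ => Finset.sum_congr rfl fun w₂ _ => ?_
        rw [Finset.sum_add_distrib, mul_add, ← Finset.sum_mul]
        congr 2
        have : ∑ z, ∑ a₁, ∑ a₂, μ₁ w₁ a₁ * μ₂ w₂ a₂ * G a₁ a₂ z = 1 := by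
          rw [Finset.sum_comm]
          have : ∀ a₁, ∑ z, ∑ a₂, μ₁ w₁ a₁ * μ₂ w₂ a₂ * G a₁ a₂ z = μ₁ w₁ a₁ := by
            intro a₁
            rw [Finset.sum_comm]
            simp_rw [← Finset.mul_sum, (hG _ _).2, mul_one, ← Finset.mul_sum, (hμ₂ w₂).2, mul_one]
          simp_rw [this, (hμ₁ w₁).2]
        rw [this, one_mul]
    _ = _ := by
        simp_rw [Finset.sum_add_distrib]
        have hlast : ∑ w₁, ∑ w₂, p w₁ w₂ * (D / T) = D / T := by
          simp_rw [← Finset.sum_mul, hp1, one_mul]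
        rw [hlast]
        congr 1
        refine Finset.sum_congr rfl fun w₁ _ => Finset.sum_congr rfl fun w₂ _ => ?_
        rw [Finset.sum_comm, Finset.mul_sum]
        refine Finset.sum_congr rfl fun a₁ _ => ?_
        rw [Finset.sum_comm, Finset.mul_sum]
        refine Finset.sum_congr rfl fun a₂ _ => ?_
        rw [Finset.mul_sum]
        exact Finset.sum_congr rfl fun z _ => by ring

/-- One-shot joint source-channel coding for two users with threshold decoders. -/
lemma exists_code_threshold_error_le {Y₁ Y₂ : Type*} [Nonempty Ω₁] [Nonempty Ω₂]
    (p : Ω₁ → Ω₂ → ℝ) (hp0 : ∀ w₁ w₂, 0 ≤ p w₁ w₂) (hp1 : ∑ w₁, ∑ w₂, p w₁ w₂ = 1)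
    (μ₁ : Ω₁ → A₁ → ℝ) (hμ₁ : ∀ w, μ₁ w ∈ stdSimplex ℝ A₁)
    (μ₂ : Ω₂ → A₂ → ℝ) (hμ₂ : ∀ w, μ₂ w ∈ stdSimplex ℝ A₂)
    (G : A₁ → A₂ → Z → ℝ) (hG : ∀ a₁ a₂, G a₁ a₂ ∈ stdSimplex ℝ Z) (π₁ : Z → Y₁) (π₂ : Z → Y₂)
    (Θ₁ : Ω₁ → A₁ → Y₁ → ℝ) (hΘ₁ : ∀ w a y, 0 ≤ Θ₁ w a y)
    (Θ₂ : Ω₂ → A₂ → Y₂ → ℝ) (hΘ₂ : ∀ w a y, 0 ≤ Θ₂ w a y) {D₁ D₂ T : ℝ} (hT : 0 < T)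
    (hD₁ : ∀ y, ∑ w, ∑ a, μ₁ w a * Θ₁ w a y ≤ D₁)
    (hD₂ : ∀ y, ∑ w, ∑ a, μ₂ w a * Θ₂ w a y ≤ D₂) :
    ∃ (C₁ : Ω₁ → A₁) (C₂ : Ω₂ → A₂) (d₁ : Y₁ → Ω₁) (d₂ : Y₂ → Ω₂),
      ∑ w₁, ∑ w₂, ∑ z, p w₁ w₂ * G (C₁ w₁) (C₂ w₂) z *
          ind (d₁ (π₁ z) ≠ w₁ ∨ d₂ (π₂ z) ≠ w₂)
      ≤ ((∑ w₁, ∑ w₂, ∑ a₁, ∑ a₂, ∑ z, p w₁ w₂ * μ₁ w₁ a₁ * μ₂ w₂ a₂ * G a₁ a₂ z *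
          ind (Θ₁ w₁ a₁ (π₁ z) ≤ T)) + D₁ / T)
        + ((∑ w₁, ∑ w₂, ∑ a₁, ∑ a₂, ∑ z, p w₁ w₂ * μ₁ w₁ a₁ * μ₂ w₂ a₂ * G a₁ a₂ z *
          ind (Θ₂ w₂ a₂ (π₂ z) ≤ T)) + D₂ / T) := by
  have h1 := average_threshold_error_le p hp0 hp1 μ₁ hμ₁ μ₂ hμ₂ G hG π₁ Θ₁ hΘ₁ hT hD₁
  have h2 := average_threshold_error_le (fun w₂ w₁ => p w₁ w₂) (fun _ _ => hp0 _ _)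
    (by rw [Finset.sum_comm]; exact hp1) μ₂ hμ₂ μ₁ hμ₁ (fun a₂ a₁ => G a₁ a₂)
    (fun _ _ => hG _ _) π₂ Θ₂ hΘ₂ hT hD₂
  have h2' : ∑ w₂, ∑ w₁, ∑ a₂, ∑ a₁, ∑ z, p w₁ w₂ * μ₂ w₂ a₂ * μ₁ w₁ a₁ * G a₁ a₂ z *
          ind (Θ₂ w₂ a₂ (π₂ z) ≤ T)
      = ∑ w₁, ∑ w₂, ∑ a₁, ∑ a₂, ∑ z, p w₁ w₂ * μ₁ w₁ a₁ * μ₂ w₂ a₂ * G a₁ a₂ z *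
          ind (Θ₂ w₂ a₂ (π₂ z) ≤ T) := by
    rw [Finset.sum_comm]
    refine Finset.sum_congr rfl fun w₁ _ => Finset.sum_congr rfl fun w₂ _ => ?_
    rw [Finset.sum_comm]
    exact Finset.sum_congr rfl fun _ _ => Finset.sum_congr rfl fun _ _ =>
      Finset.sum_congr rfl fun _ _ => by ring
  rw [h2'] at h2
  have hw : (fun C : (Ω₁ → A₁) × (Ω₂ → A₂) => (∏ w, μ₁ w (C.1 w)) * (∏ w, μ₂ w (C.2 w)))
      ∈ stdSimplex ℝ ((Ω₁ → A₁) × (Ω₂ → A₂)) := by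
    refine ⟨fun C => mul_nonneg (Finset.prod_nonneg fun w _ => (hμ₁ w).1 _)
      (Finset.prod_nonneg fun w _ => (hμ₂ w).1 _), ?_⟩
    rw [Fintype.sum_prod_type]
    simp_rw [← Finset.mul_sum, sum_fun_prod_eq_one μ₂ (fun w => (hμ₂ w).2), mul_one,
      sum_fun_prod_eq_one μ₁ (fun w => (hμ₁ w).2)]
  have h12 := add_le_add h1 h2
  generalize ((_ : ℝ) + D₁ / T) + (_ + D₂ / T) = R at h12 ⊢
  -- Both errors are averaged over the same pair of codebooks, so that one pair serves both
  -- receivers.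
  have havg : ∑ C : (Ω₁ → A₁) × (Ω₂ → A₂), (∏ w, μ₁ w (C.1 w)) * (∏ w, μ₂ w (C.2 w)) *
      (∑ w₁, ∑ w₂, ∑ z, p w₁ w₂ * G (C.1 w₁) (C.2 w₂) z *
      ind (thresholdDecoder (fun w y => Θ₁ w (C.1 w) y) T (π₁ z) ≠ w₁
        ∨ thresholdDecoder (fun w y => Θ₂ w (C.2 w) y) T (π₂ z) ≠ w₂)) ≤ R := by
    refine le_trans ?_ h12
    rw [Fintype.sum_prod_type]
    rw [Finset.sum_comm (γ := Ω₂ → A₂), ← Finset.sum_add_distrib]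
    refine Finset.sum_le_sum fun C₁ _ => ?_
    rw [← Finset.sum_add_distrib]
    refine Finset.sum_le_sum fun C₂ _ => ?_
    rw [mul_comm (∏ w, μ₂ w (C₂ w)), ← mul_add]
    refine mul_le_mul_of_nonneg_left ?_ (hw.1 (C₁, C₂))
    rw [Finset.sum_comm (γ := Ω₂), ← Finset.sum_add_distrib]
    refine Finset.sum_le_sum fun w₁ _ => ?_
    rw [← Finset.sum_add_distrib]
    refine Finset.sum_le_sum fun w₂ _ => ?_
    rw [← Finset.sum_add_distrib]
    refine Finset.sum_le_sum fun z _ => ?_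
    rw [← mul_add]
    refine mul_le_mul_of_nonneg_left ?_ (mul_nonneg (hp0 _ _) ((hG _ _).1 _))
    unfold ind
    split_ifs <;> first | (norm_num; done) | (exfalso; tauto)
  obtain ⟨C, -, hC⟩ := exists_pos_le_of_average_le _ _ hw havg
  exact ⟨C.1, C.2, _, _, hC⟩

end OneShot

/-! ### Exponential moments of variables with positive mean. -/

section Chernoff

variable {Ω : Type*} [Fintype Ω]

/-- If `f` has positive mean then its exponential moment is below `1` for some negative tilt. -/
lemma exists_exp_moment_lt_one (p f : Ω → ℝ) (hp : p ∈ stdSimplex ℝ Ω)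
    (hf : 0 < ∑ ω, p ω * f ω) : ∃ s : ℝ, 0 < s ∧ ∑ ω, p ω * Real.exp (-s * f ω) < 1 := by
  set μ := ∑ ω, p ω * f ω with hμ
  set C : ℝ := 1 + ∑ ω, |f ω| with hC
  have hC1 : 1 ≤ C := by
    have : 0 ≤ ∑ ω, |f ω| := Finset.sum_nonneg fun _ _ => abs_nonneg _
    linarith
  have hfC : ∀ ω, |f ω| ≤ C := fun ω => by
    have := Finset.single_le_sum (f := fun ω => |f ω|) (fun _ _ => abs_nonneg _)
      (Finset.mem_univ ω)
    linarith
  have hμC : μ ≤ C := by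
    calc μ ≤ ∑ ω, p ω * C := Finset.sum_le_sum fun ω _ =>
          mul_le_mul_of_nonneg_left ((le_abs_self _).trans (hfC ω)) (hp.1 ω)
      _ = C := by rw [← Finset.sum_mul, hp.2, one_mul]
  have hCpos : 0 < C := by linarith
  -- This tilt minimises the quadratic bound `1 - s μ + s² C²`; it also keeps `s |f| ≤ 1`, where
  -- `exp x ≤ 1 + x + x²` is available.
  refine ⟨μ / (2 * C ^ 2), by positivity, ?_⟩
  set s := μ / (2 * C ^ 2) with hs
  have hs0 : 0 < s := by positivity
  have hsC : s * C ≤ 1 := by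
    rw [hs, div_mul_eq_mul_div, div_le_one (by positivity)]
    nlinarith
  have hpt : ∀ ω, Real.exp (-s * f ω) ≤ 1 - s * f ω + s ^ 2 * C ^ 2 := by
    intro ω
    have h1 : |-s * f ω| ≤ 1 := by
      rw [abs_mul, abs_neg, abs_of_pos hs0]
      exact (mul_le_mul_of_nonneg_left (hfC ω) hs0.le).trans hsC
    have h2 := (abs_le.mp (Real.abs_exp_sub_one_sub_id_le h1)).2
    have h3 : (-s * f ω) ^ 2 ≤ s ^ 2 * C ^ 2 := by
      have : (f ω) ^ 2 ≤ C ^ 2 := sq_le_sq' (by linarith [neg_abs_le (f ω), hfC ω])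
        ((le_abs_self _).trans (hfC ω))
      nlinarith [sq_nonneg s]
    linarith
  calc ∑ ω, p ω * Real.exp (-s * f ω) ≤ ∑ ω, p ω * (1 - s * f ω + s ^ 2 * C ^ 2) :=
        Finset.sum_le_sum fun ω _ => mul_le_mul_of_nonneg_left (hpt ω) (hp.1 ω)
    _ = 1 - s * μ + s ^ 2 * C ^ 2 := by
        have : ∀ ω, p ω * (1 - s * f ω + s ^ 2 * C ^ 2)
            = p ω * (1 + s ^ 2 * C ^ 2) - s * (p ω * f ω) := fun ω => by ring
        simp_rw [this, Finset.sum_sub_distrib, ← Finset.sum_mul, ← Finset.mul_sum, hp.2]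
        ring
    _ < 1 := by
        have : s ^ 2 * C ^ 2 = s * μ / 2 := by
          rw [hs]; field_simp
        rw [this]
        nlinarith [mul_pos hs0 hf]

end Chernoff

/-! ### Products of sums over several families of sequences. -/

section Nested

variable {ι A B C D E : Type*} [Fintype ι] [DecidableEq ι] [Fintype A] [Fintype B] [Fintype C] [Fintype D]
  [Fintype E]

lemma sum_fun_prod₂ (F : ι → A → B → ℝ) :
    ∑ a : ι → A, ∑ b : ι → B, ∏ i, F i (a i) (b i) = ∏ i, ∑ a, ∑ b, F i a b := by
  rw [← sum_fun_prod]
  exact Finset.sum_congr rfl fun a _ => sum_fun_prod fun i b => F i (a i) b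

lemma sum_fun_prod₃ (F : ι → A → B → C → ℝ) :
    ∑ a : ι → A, ∑ b : ι → B, ∑ c : ι → C, ∏ i, F i (a i) (b i) (c i)
      = ∏ i, ∑ a, ∑ b, ∑ c, F i a b c := by
  rw [← sum_fun_prod₂]
  exact Finset.sum_congr rfl fun a _ => Finset.sum_congr rfl fun b _ =>
    sum_fun_prod fun i c => F i (a i) (b i) c

lemma sum_fun_prod₅ (F : ι → A → B → C → D → E → ℝ) :
    ∑ a : ι → A, ∑ b : ι → B, ∑ c : ι → C, ∑ d : ι → D, ∑ e : ι → E,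
        ∏ i, F i (a i) (b i) (c i) (d i) (e i)
      = ∏ i, ∑ a, ∑ b, ∑ c, ∑ d, ∑ e, F i a b c d e := by
  rw [← sum_fun_prod₂]
  exact Finset.sum_congr rfl fun a _ => Finset.sum_congr rfl fun b _ =>
    sum_fun_prod₃ fun i c d e => F i (a i) (b i) c d e

end Nested

/-! ### The outer code: positive drift of the metric suffices. -/

section Outer

variable {S₁ S₂ V₁ V₂ X₁ X₂ Y₁ Y₂ : Type*} [Fintype S₁] [Fintype S₂] [Fintype V₁] [Fintype V₂]
  [Fintype X₁] [Fintype X₂] [Fintype Y₁] [Fintype Y₂]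

/-- Geometric decay of the probability that the true message fails the threshold test. -/
lemma exists_threshold_miss_le {A₁ A₂ Z : Type*} [Fintype A₁] [Fintype A₂] [Fintype Z]
    (p : S₁ → S₂ → ℝ) (hp0 : ∀ s₁ s₂, 0 ≤ p s₁ s₂) (hp1 : ∑ s₁, ∑ s₂, p s₁ s₂ = 1)
    (κ₁ : S₁ → A₁ → ℝ) (hκ₁ : ∀ s, κ₁ s ∈ stdSimplex ℝ A₁)
    (κ₂ : S₂ → A₂ → ℝ) (hκ₂ : ∀ s, κ₂ s ∈ stdSimplex ℝ A₂)
    (G : A₁ → A₂ → Z → ℝ) (hG : ∀ a₁ a₂, G a₁ a₂ ∈ stdSimplex ℝ Z)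
    (θ : S₁ → S₂ → A₁ → A₂ → Z → ℝ) (hθ : ∀ s₁ s₂ a₁ a₂ z, 0 < θ s₁ s₂ a₁ a₂ z) (η : ℝ)
    (hη : η < ∑ s₁, ∑ s₂, ∑ a₁, ∑ a₂, ∑ z,
      p s₁ s₂ * κ₁ s₁ a₁ * κ₂ s₂ a₂ * G a₁ a₂ z * Real.log (θ s₁ s₂ a₁ a₂ z)) :
    ∃ r : ℝ, 0 ≤ r ∧ r < 1 ∧ ∀ m : ℕ,
      ∑ s₁ : Fin m → S₁, ∑ s₂ : Fin m → S₂, ∑ a₁ : Fin m → A₁, ∑ a₂ : Fin m → A₂,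
        ∑ z : Fin m → Z, (∏ i, p (s₁ i) (s₂ i)) * (∏ i, κ₁ (s₁ i) (a₁ i)) *
          (∏ i, κ₂ (s₂ i) (a₂ i)) * (∏ i, G (a₁ i) (a₂ i) (z i)) *
          ind (∏ i, θ (s₁ i) (s₂ i) (a₁ i) (a₂ i) (z i) ≤ Real.exp (m * η))
      ≤ r ^ m := by
  set P : S₁ × S₂ × A₁ × A₂ × Z → ℝ := fun ω =>
    p ω.1 ω.2.1 * κ₁ ω.1 ω.2.2.1 * κ₂ ω.2.1 ω.2.2.2.1 * G ω.2.2.1 ω.2.2.2.1 ω.2.2.2.2 with hP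
  have hPs : P ∈ stdSimplex ℝ (S₁ × S₂ × A₁ × A₂ × Z) := by
    refine ⟨fun ω => mul_nonneg (mul_nonneg (mul_nonneg (hp0 _ _) ((hκ₁ _).1 _)) ((hκ₂ _).1 _))
      ((hG _ _).1 _), ?_⟩
    simp only [hP, Fintype.sum_prod_type]
    simp_rw [← Finset.mul_sum, (hG _ _).2, mul_one, ← Finset.mul_sum, (hκ₂ _).2, mul_one,
      ← Finset.mul_sum, (hκ₁ _).2, mul_one, hp1]
  obtain ⟨s, hs, hs1⟩ := exists_exp_moment_lt_one P
    (fun ω => Real.log (θ ω.1 ω.2.1 ω.2.2.1 ω.2.2.2.1 ω.2.2.2.2) - η) hPs (by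
      simp_rw [mul_sub, Finset.sum_sub_distrib, ← Finset.sum_mul, hPs.2, one_mul]
      simp only [hP, Fintype.sum_prod_type]
      linarith)
  refine ⟨_, Finset.sum_nonneg fun ω _ => mul_nonneg (hPs.1 ω) (Real.exp_pos _).le, hs1, ?_⟩
  intro m
  set F : S₁ → S₂ → A₁ → A₂ → Z → ℝ := fun s₁ s₂ a₁ a₂ z =>
    p s₁ s₂ * κ₁ s₁ a₁ * κ₂ s₂ a₂ * G a₁ a₂ z *
      Real.exp (-s * (Real.log (θ s₁ s₂ a₁ a₂ z) - η)) with hF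
  have hsum : ∑ ω, P ω * Real.exp (-s * (Real.log (θ ω.1 ω.2.1 ω.2.2.1 ω.2.2.2.1 ω.2.2.2.2) - η))
      = ∑ s₁, ∑ s₂, ∑ a₁, ∑ a₂, ∑ z, F s₁ s₂ a₁ a₂ z := by
    simp only [hP, hF, Fintype.sum_prod_type]
  rw [hsum]
  have hpow : (∑ s₁, ∑ s₂, ∑ a₁, ∑ a₂, ∑ z, F s₁ s₂ a₁ a₂ z) ^ m
      = ∑ s₁ : Fin m → S₁, ∑ s₂ : Fin m → S₂, ∑ a₁ : Fin m → A₁, ∑ a₂ : Fin m → A₂,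
        ∑ z : Fin m → Z, ∏ i, F (s₁ i) (s₂ i) (a₁ i) (a₂ i) (z i) := by
    rw [sum_fun_prod₅ fun (_ : Fin m) => F]
    simp
  rw [hpow]
  refine Finset.sum_le_sum fun s₁ _ => Finset.sum_le_sum fun s₂ _ => Finset.sum_le_sum fun a₁ _ =>
    Finset.sum_le_sum fun a₂ _ => Finset.sum_le_sum fun z _ => ?_
  -- Markov's inequality sequence by sequence: the failure indicator is at most `exp (-s ∑ (log θ -
  -- η))`.
  simp only [hF, Finset.prod_mul_distrib]
  refine mul_le_mul_of_nonneg_left ?_ ?_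
  · rw [← Real.exp_sum]
    unfold ind
    split_ifs with h
    · rw [Real.one_le_exp_iff]
      rw [← Finset.mul_sum, Finset.sum_sub_distrib]
      have hlog : ∑ i, Real.log (θ (s₁ i) (s₂ i) (a₁ i) (a₂ i) (z i)) ≤ m * η := by
        rw [← Real.log_prod (fun i _ => (hθ _ _ _ _ _).ne')]
        rw [← Real.log_exp (m * η)]
        exact Real.log_le_log (Finset.prod_pos fun i _ => hθ _ _ _ _ _) h
      simp only [Finset.sum_const, Finset.card_univ, Fintype.card_fin, nsmul_eq_mul]
      nlinarith
    · exact (Real.exp_pos _).le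
  · refine mul_nonneg (mul_nonneg (mul_nonneg ?_ ?_) ?_) ?_ <;>
      refine Finset.prod_nonneg fun i _ => ?_
    · exact hp0 _ _
    · exact (hκ₁ _).1 _
    · exact (hκ₂ _).1 _
    · exact (hG _ _).1 _

/-- Union bound constant of the product metric. -/
lemma sum_product_metric_le {S V X Y T : Type*} [Fintype S] [Fintype V] [Fintype X] [Fintype T]
    (κ : S → V × X → ℝ) (π : V → ℝ) (hκ : ∀ s v, ∑ x, κ s (v, x) = π v)
    (hπ : ∀ v, 0 ≤ π v)
    (θ : S → V → Y → ℝ) (hθ : ∀ s v y, 0 < θ s v y) (hsum : ∀ y, ∑ s, ∑ v, π v * θ s v y ≤ 1)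
    (m : ℕ) (y : Fin m → Y) :
    ∑ w : (Fin m → S) × T, ∑ a : Fin m → V × X, (∏ i, κ (w.1 i) (a i)) *
      ∏ i, θ (w.1 i) (a i).1 (y i) ≤ Fintype.card T := by
  rw [Fintype.sum_prod_type]
  -- The metric ignores the extra message, which therefore contributes just its number of values.
  simp only [Finset.sum_const, Finset.card_univ, nsmul_eq_mul]
  rw [← Finset.mul_sum]
  have h : ∑ s : Fin m → S, ∑ a : Fin m → V × X, (∏ i, κ (s i) (a i)) *
      ∏ i, θ (s i) (a i).1 (y i) ≤ 1 := by
    simp_rw [← Finset.prod_mul_distrib]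
    rw [sum_fun_prod₂ fun i s a => κ s a * θ s a.1 (y i)]
    refine Finset.prod_le_one (fun i _ => ?_) (fun i _ => ?_)
    · have : ∀ s, ∑ a : V × X, κ s a * θ s a.1 (y i) = ∑ v, π v * θ s v (y i) := by
        intro s
        rw [Fintype.sum_prod_type]
        exact Finset.sum_congr rfl fun v _ => by rw [← hκ s v, Finset.sum_mul]
      simp_rw [this]
      exact Finset.sum_nonneg fun s _ => Finset.sum_nonneg fun v _ =>
        mul_nonneg (hπ v) (hθ _ _ _).le
    · have : ∀ s, ∑ a : V × X, κ s a * θ s a.1 (y i) = ∑ v, π v * θ s v (y i) := by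
        intro s
        rw [Fintype.sum_prod_type]
        exact Finset.sum_congr rfl fun v _ => by rw [← hκ s v, Finset.sum_mul]
      simp_rw [this]
      exact hsum (y i)
  exact mul_le_of_le_one_right (Nat.cast_nonneg _) h

lemma prod_mem_stdSimplex {ι α : Type*} [Fintype ι] [DecidableEq ι] [Fintype α] (w : ι → α → ℝ)
    (hw : ∀ i, w i ∈ stdSimplex ℝ α) :
    (fun f : ι → α => ∏ i, w i (f i)) ∈ stdSimplex ℝ (ι → α) :=
  ⟨fun _ => Finset.prod_nonneg fun i _ => (hw i).1 _,
    sum_fun_prod_eq_one w fun i => (hw i).2⟩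

/-- Joint source-channel coding over a two-user channel: positive drift of the two decoding
metrics makes the error probability vanish. `T₁`, `T₂` carry a bounded amount of extra
messages. -/
theorem exists_code_of_pos_drift
    (p : S₁ → S₂ → ℝ) (hp0 : ∀ s₁ s₂, 0 ≤ p s₁ s₂) (hp1 : ∑ s₁, ∑ s₂, p s₁ s₂ = 1)
    (κ₁ : S₁ → V₁ × X₁ → ℝ) (hκ₁ : ∀ s, κ₁ s ∈ stdSimplex ℝ (V₁ × X₁))
    (κ₂ : S₂ → V₂ × X₂ → ℝ) (hκ₂ : ∀ s, κ₂ s ∈ stdSimplex ℝ (V₂ × X₂))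
    (π₁ : V₁ → ℝ) (hπ₁ : ∀ s v, ∑ x, κ₁ s (v, x) = π₁ v)
    (π₂ : V₂ → ℝ) (hπ₂ : ∀ s v, ∑ x, κ₂ s (v, x) = π₂ v)
    (G : X₁ → X₂ → Y₁ × Y₂ → ℝ) (hG : ∀ x₁ x₂, G x₁ x₂ ∈ stdSimplex ℝ (Y₁ × Y₂))
    (θ₁ : S₁ → V₁ → Y₁ → ℝ) (hθ₁ : ∀ s v y, 0 < θ₁ s v y)
    (hθ₁' : ∀ y, ∑ s, ∑ v, π₁ v * θ₁ s v y ≤ 1)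
    (θ₂ : S₂ → V₂ → Y₂ → ℝ) (hθ₂ : ∀ s v y, 0 < θ₂ s v y)
    (hθ₂' : ∀ y, ∑ s, ∑ v, π₂ v * θ₂ s v y ≤ 1)
    (h₁ : 0 < ∑ s₁, ∑ s₂, ∑ a₁, ∑ a₂, ∑ z,
      p s₁ s₂ * κ₁ s₁ a₁ * κ₂ s₂ a₂ * G a₁.2 a₂.2 z * Real.log (θ₁ s₁ a₁.1 z.1))
    (h₂ : 0 < ∑ s₁, ∑ s₂, ∑ a₁, ∑ a₂, ∑ z,
      p s₁ s₂ * κ₁ s₁ a₁ * κ₂ s₂ a₂ * G a₁.2 a₂.2 z * Real.log (θ₂ s₂ a₂.1 z.2))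
    {T₁ T₂ : Type*} [Fintype T₁] [Fintype T₂] (pT : T₁ → T₂ → ℝ)
    (hT0 : ∀ t₁ t₂, 0 ≤ pT t₁ t₂) (hT1 : ∑ t₁, ∑ t₂, pT t₁ t₂ = 1) (ε : ℝ) (hε : 0 < ε) :
    ∃ m₀ : ℕ, ∀ m ≥ m₀,
      ∃ (e₁ : (Fin m → S₁) × T₁ → Fin m → X₁) (e₂ : (Fin m → S₂) × T₂ → Fin m → X₂)
        (d₁ : (Fin m → Y₁) → (Fin m → S₁) × T₁) (d₂ : (Fin m → Y₂) → (Fin m → S₂) × T₂),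
        ∑ w₁, ∑ w₂, ∑ z : Fin m → Y₁ × Y₂,
          (∏ i, p (w₁.1 i) (w₂.1 i)) * pT w₁.2 w₂.2 * (∏ i, G (e₁ w₁ i) (e₂ w₂ i) (z i)) *
          ind (d₁ (fun i => (z i).1) ≠ w₁ ∨ d₂ (fun i => (z i).2) ≠ w₂) ≤ ε := by
  have hne : Nonempty S₁ ∧ Nonempty S₂ := by
    refine ⟨?_, ?_⟩ <;> by_contra h <;> rw [not_nonempty_iff] at h <;> simp at hp1
  have hneT : Nonempty T₁ ∧ Nonempty T₂ := by
    refine ⟨?_, ?_⟩ <;> by_contra h <;> rw [not_nonempty_iff] at h <;> simp at hT1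
  obtain ⟨hS₁, hS₂⟩ := hne
  obtain ⟨hT₁', hT₂'⟩ := hneT
  have hπ₁0 : ∀ v, 0 ≤ π₁ v := fun v => by
    rw [← hπ₁ (Classical.arbitrary S₁) v]; exact Finset.sum_nonneg fun x _ => (hκ₁ _).1 _
  have hπ₂0 : ∀ v, 0 ≤ π₂ v := fun v => by
    rw [← hπ₂ (Classical.arbitrary S₂) v]; exact Finset.sum_nonneg fun x _ => (hκ₂ _).1 _
  -- The threshold is `exp (m η)`: below the typical growth of both metrics, yet exponentially large
  -- against the constant number of extra messages in the union bound.
  obtain ⟨η, hη0, hη⟩ := exists_between (lt_min h₁ h₂)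
  obtain ⟨r₁, hr₁0, hr₁1, hr₁⟩ := exists_threshold_miss_le p hp0 hp1 κ₁ hκ₁ κ₂ hκ₂
    (fun a₁ a₂ => G a₁.2 a₂.2) (fun _ _ => hG _ _) (fun s₁ _ a₁ _ z => θ₁ s₁ a₁.1 z.1)
    (fun _ _ _ _ _ => hθ₁ _ _ _) η (hη.trans_le (min_le_left _ _))
  obtain ⟨r₂, hr₂0, hr₂1, hr₂⟩ := exists_threshold_miss_le p hp0 hp1 κ₁ hκ₁ κ₂ hκ₂
    (fun a₁ a₂ => G a₁.2 a₂.2) (fun _ _ => hG _ _) (fun _ s₂ _ a₂ z => θ₂ s₂ a₂.1 z.2)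
    (fun _ _ _ _ _ => hθ₂ _ _ _) η (hη.trans_le (min_le_right _ _))
  have hlim : Filter.Tendsto (fun m : ℕ => (r₁ ^ m + (Fintype.card T₁ : ℝ) * (Real.exp (-η)) ^ m)
      + (r₂ ^ m + (Fintype.card T₂ : ℝ) * (Real.exp (-η)) ^ m)) Filter.atTop (nhds 0) := by
    have e1 := tendsto_pow_atTop_nhds_zero_of_lt_one hr₁0 hr₁1
    have e2 := tendsto_pow_atTop_nhds_zero_of_lt_one hr₂0 hr₂1
    have e3 := tendsto_pow_atTop_nhds_zero_of_lt_one (Real.exp_pos (-η)).le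
      (by rw [Real.exp_lt_one_iff]; linarith)
    simpa using (e1.add (e3.const_mul (Fintype.card T₁ : ℝ))).add
      (e2.add (e3.const_mul (Fintype.card T₂ : ℝ)))
  obtain ⟨m₀, hm₀⟩ := Filter.eventually_atTop.mp (hlim.eventually (gt_mem_nhds hε))
  refine ⟨m₀, fun m hm => ?_⟩
  have hwsum : ∑ w₁ : (Fin m → S₁) × T₁, ∑ w₂ : (Fin m → S₂) × T₂,
      (∏ i, p (w₁.1 i) (w₂.1 i)) * pT w₁.2 w₂.2 = 1 := by
    simp only [Fintype.sum_prod_type]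
    simp_rw [← Finset.mul_sum]
    have : ∀ s₁ : Fin m → S₁, ∑ t₁, ∑ s₂ : Fin m → S₂, (∏ i, p (s₁ i) (s₂ i)) * ∑ t₂, pT t₁ t₂
        = ∑ s₂ : Fin m → S₂, ∏ i, p (s₁ i) (s₂ i) := by
      intro s₁
      rw [Finset.sum_comm]
      exact Finset.sum_congr rfl fun s₂ _ => by rw [← Finset.mul_sum, hT1, mul_one]
    simp_rw [this]
    rw [sum_fun_prod₂ fun (_ : Fin m) => p]
    simp [hp1]
  have hD1 : ∀ y : Fin m → Y₁, ∑ w : (Fin m → S₁) × T₁, ∑ a : Fin m → V₁ × X₁,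
      (∏ i, κ₁ (w.1 i) (a i)) * ∏ i, θ₁ (w.1 i) (a i).1 (y i) ≤ Fintype.card T₁ :=
    fun y => sum_product_metric_le κ₁ π₁ hπ₁ hπ₁0 θ₁ hθ₁ hθ₁' m y
  have hD2 : ∀ y : Fin m → Y₂, ∑ w : (Fin m → S₂) × T₂, ∑ a : Fin m → V₂ × X₂,
      (∏ i, κ₂ (w.1 i) (a i)) * ∏ i, θ₂ (w.1 i) (a i).1 (y i) ≤ Fintype.card T₂ :=
    fun y => sum_product_metric_le κ₂ π₂ hπ₂ hπ₂0 θ₂ hθ₂ hθ₂' m y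
  have hk1 : ∀ w : (Fin m → S₁) × T₁, (fun a : Fin m → V₁ × X₁ => ∏ i, κ₁ (w.1 i) (a i)) ∈
    stdSimplex ℝ (Fin m → V₁ × X₁) := fun w => prod_mem_stdSimplex _ fun i => hκ₁ (w.1 i)
  have hk2 : ∀ w : (Fin m → S₂) × T₂, (fun a : Fin m → V₂ × X₂ => ∏ i, κ₂ (w.1 i) (a i)) ∈
    stdSimplex ℝ (Fin m → V₂ × X₂) := fun w => prod_mem_stdSimplex _ fun i => hκ₂ (w.1 i)
  have hGm : ∀ (a₁ : Fin m → V₁ × X₁) (a₂ : Fin m → V₂ × X₂),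
      (fun z : Fin m → Y₁ × Y₂ => ∏ i, G (a₁ i).2 (a₂ i).2 (z i)) ∈
        stdSimplex ℝ (Fin m → Y₁ × Y₂) :=
    fun a₁ a₂ => prod_mem_stdSimplex (fun i z => G (a₁ i).2 (a₂ i).2 z) fun i => hG _ _
  have hone := exists_code_threshold_error_le
    (Ω₁ := (Fin m → S₁) × T₁) (Ω₂ := (Fin m → S₂) × T₂)
    (fun w₁ w₂ => (∏ i, p (w₁.1 i) (w₂.1 i)) * pT w₁.2 w₂.2)
    (fun w₁ w₂ => mul_nonneg (Finset.prod_nonneg fun i _ => hp0 _ _) (hT0 _ _)) hwsum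
    _ hk1 _ hk2
    (fun (a₁ : Fin m → V₁ × X₁) (a₂ : Fin m → V₂ × X₂) (z : Fin m → Y₁ × Y₂) =>
      ∏ i, G (a₁ i).2 (a₂ i).2 (z i)) hGm
    (fun (z : Fin m → Y₁ × Y₂) i => (z i).1) (fun z i => (z i).2)
    (fun w a y => ∏ i, θ₁ (w.1 i) (a i).1 (y i))
    (fun w a y => Finset.prod_nonneg fun i _ => (hθ₁ _ _ _).le)
    (fun w a y => ∏ i, θ₂ (w.1 i) (a i).1 (y i))
    (fun w a y => Finset.prod_nonneg fun i _ => (hθ₂ _ _ _).le) (Real.exp_pos (m * η)) hD1 hD2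
  obtain ⟨C₁, C₂, d₁, d₂, hC⟩ := hone
  refine ⟨fun w i => (C₁ w i).2, fun w i => (C₂ w i).2, d₁, d₂, hC.trans ((?_ : _ ≤ _).trans
    (hm₀ m hm).le)⟩
  have hexp : (Real.exp (m * η))⁻¹ = Real.exp (-η) ^ m := by
    rw [← Real.exp_neg, ← Real.exp_nat_mul]; ring_nf
  -- Neither the codeword law nor the metric depends on the extra messages, so their pmf sums out.
  have hcollect : ∀ H : (Fin m → S₁) → (Fin m → S₂) → (Fin m → V₁ × X₁) → (Fin m → V₂ × X₂) →
      (Fin m → Y₁ × Y₂) → ℝ,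
      ∑ w₁ : (Fin m → S₁) × T₁, ∑ w₂ : (Fin m → S₂) × T₂, ∑ a₁, ∑ a₂, ∑ z,
        (∏ i, p (w₁.1 i) (w₂.1 i)) * pT w₁.2 w₂.2 * (∏ i, κ₁ (w₁.1 i) (a₁ i)) *
          (∏ i, κ₂ (w₂.1 i) (a₂ i)) * (∏ i, G (a₁ i).2 (a₂ i).2 (z i)) * H w₁.1 w₂.1 a₁ a₂ z
      = ∑ s₁, ∑ s₂, ∑ a₁, ∑ a₂, ∑ z,
        (∏ i, p (s₁ i) (s₂ i)) * (∏ i, κ₁ (s₁ i) (a₁ i)) *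
          (∏ i, κ₂ (s₂ i) (a₂ i)) * (∏ i, G (a₁ i).2 (a₂ i).2 (z i)) * H s₁ s₂ a₁ a₂ z := by
    intro H
    simp only [Fintype.sum_prod_type (α₁ := Fin m → S₁), Fintype.sum_prod_type (α₁ := Fin m → S₂)]
    refine Finset.sum_congr rfl fun s₁ _ => ?_
    rw [Finset.sum_comm]
    refine Finset.sum_congr rfl fun s₂ _ => ?_
    set R := ∑ a₁, ∑ a₂, ∑ z,
        (∏ i, p (s₁ i) (s₂ i)) * (∏ i, κ₁ (s₁ i) (a₁ i)) *
          (∏ i, κ₂ (s₂ i) (a₂ i)) * (∏ i, G (a₁ i).2 (a₂ i).2 (z i)) * H s₁ s₂ a₁ a₂ z with hR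
    have : ∀ t₁ t₂, ∑ a₁, ∑ a₂, ∑ z,
        (∏ i, p (s₁ i) (s₂ i)) * pT t₁ t₂ * (∏ i, κ₁ (s₁ i) (a₁ i)) *
          (∏ i, κ₂ (s₂ i) (a₂ i)) * (∏ i, G (a₁ i).2 (a₂ i).2 (z i)) * H s₁ s₂ a₁ a₂ z
        = pT t₁ t₂ * R := by
      intro t₁ t₂
      rw [hR]
      simp_rw [Finset.mul_sum]
      exact Finset.sum_congr rfl fun _ _ => Finset.sum_congr rfl fun _ _ =>
        Finset.sum_congr rfl fun _ _ => by ring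
    simp_rw [this, ← Finset.sum_mul, hT1, one_mul]
  refine add_le_add (add_le_add ?_ ?_) (add_le_add ?_ ?_)
  · exact (hcollect fun s₁ _ a₁ _ z =>
      ind (∏ i, θ₁ (s₁ i) (a₁ i).1 (z i).1 ≤ Real.exp (m * η))).trans_le (hr₁ m)
  · rw [div_eq_mul_inv, hexp]
  · exact (hcollect fun _ s₂ _ a₂ z =>
      ind (∏ i, θ₂ (s₂ i) (a₂ i).1 (z i).2 ≤ Real.exp (m * η))).trans_le (hr₂ m)
  · rw [div_eq_mul_inv, hexp]

end Outer

/-! ### Elementary inequalities for entropy and mutual information. -/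

section Information

/-- This is `1 + x ≤ exp x` at `x = -log (a / c)`. The hypothesis `h` excludes a positive `a` over
`c = 0`, where the value of `log (a / 0)` would be meaningless. -/
lemma sub_le_mul_log_div {a c : ℝ} (ha : 0 ≤ a) (hc : 0 ≤ c) (h : c = 0 → a = 0) :
    a - c ≤ a * Real.log (a / c) := by
  rcases ha.eq_or_lt with rfl | ha
  · simp [hc]
  · have hc' : 0 < c := lt_of_le_of_ne hc fun h' => ha.ne' (h h'.symm)
    have h1 := Real.add_one_le_exp (-Real.log (a / c))
    rw [Real.exp_neg, Real.exp_log (by positivity), inv_div] at h1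
    have h2 := mul_le_mul_of_nonneg_left h1 ha.le
    have h3 : a * (c / a) = c := by field_simp
    nlinarith

/-- `1 + x < exp x` away from `0` settles the equality case. It is what identifies a channel at zero
divergence from a tilted one. -/
lemma eq_of_mul_log_div_le {a c : ℝ} (ha : 0 ≤ a) (hc : 0 ≤ c) (h : c = 0 → a = 0)
    (hle : a * Real.log (a / c) ≤ a - c) : a = c := by
  rcases ha.eq_or_lt with rfl | ha
  · simp at hle; linarith
  · have hc' : 0 < c := lt_of_le_of_ne hc fun h' => ha.ne' (h h'.symm)
    by_contra hne
    have hlog : Real.log (a / c) ≠ 0 := by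
      intro h0
      have := Real.exp_log (show 0 < a / c by positivity)
      rw [h0, Real.exp_zero] at this
      exact hne ((div_eq_one_iff_eq hc'.ne').mp this.symm)
    have h1 := Real.add_one_lt_exp (neg_ne_zero.mpr hlog)
    rw [Real.exp_neg, Real.exp_log (by positivity), inv_div] at h1
    have h2 := mul_lt_mul_of_pos_left h1 ha
    have h3 : a * (c / a) = c := by field_simp
    nlinarith

/-- A family of lower bounds obtained by rescaling `c`, tight at `t = a / c`. The log-sum inequality
follows by taking the same `t` in both terms. -/
lemma mul_log_add_sub_le {a c t : ℝ} (ha : 0 ≤ a) (hc : 0 ≤ c) (h : c = 0 → a = 0) (ht : 0 < t) :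
    a * Real.log t + a - c * t ≤ a * Real.log (a / c) := by
  rcases ha.eq_or_lt with rfl | ha
  · simp; positivity
  · have hc' : 0 < c := lt_of_le_of_ne hc fun h' => ha.ne' (h h'.symm)
    have h1 := sub_le_mul_log_div ha.le (mul_pos hc' ht).le (fun h0 => absurd h0 (by positivity))
    have h2 : Real.log (a / (c * t)) = Real.log (a / c) - Real.log t := by
      rw [← div_div, Real.log_div (by positivity) ht.ne']
    rw [h2] at h1
    nlinarith

/-- The log-sum inequality for two terms. -/
lemma log_sum_le {a b c d : ℝ} (ha : 0 ≤ a) (hb : 0 ≤ b) (hc : 0 ≤ c) (hd : 0 ≤ d)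
    (hac : c = 0 → a = 0) (hbd : d = 0 → b = 0) :
    (a + b) * Real.log ((a + b) / (c + d)) ≤ a * Real.log (a / c) + b * Real.log (b / d) := by
  rcases (add_nonneg ha hb).eq_or_lt with h0 | h0
  · have ha0 : a = 0 := by linarith
    have hb0 : b = 0 := by linarith
    simp [ha0, hb0]
  · have hcd : 0 < c + d := by
      rcases (add_nonneg hc hd).eq_or_lt with h1 | h1
      · have : c = 0 := by linarith
        have : d = 0 := by linarith
        have := hac ‹_›
        have := hbd ‹_›
        linarith
      · exact h1
    have ht : 0 < (a + b) / (c + d) := by positivity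
    have h1 := mul_log_add_sub_le ha hc hac ht
    have h2 := mul_log_add_sub_le hb hd hbd ht
    have h3 : c * ((a + b) / (c + d)) + d * ((a + b) / (c + d)) = a + b := by field_simp
    nlinarith

variable {Ω α β : Type*} [Fintype Ω]

lemma law_eq (p : Ω → ℝ) (X : Ω → α) (a : α) : law p X a = ∑ ω, p ω * ind (X ω = a) := by
  unfold law prob ind
  refine Finset.sum_congr rfl fun ω _ => ?_
  by_cases h : X ω = a <;> simp [Set.indicator, h]

lemma law_nonneg {p : Ω → ℝ} (hp : ∀ ω, 0 ≤ p ω) (X : Ω → α) (a : α) : 0 ≤ law p X a := by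
  rw [law_eq]; exact Finset.sum_nonneg fun ω _ => mul_nonneg (hp ω) (ind_nonneg _)

lemma law_pos {p : Ω → ℝ} (hp : ∀ ω, 0 ≤ p ω) (X : Ω → α) {ω : Ω} (hω : 0 < p ω) :
    0 < law p X (X ω) := by
  rw [law_eq]
  refine Finset.sum_pos' (fun ω _ => mul_nonneg (hp ω) (ind_nonneg _)) ⟨ω, Finset.mem_univ _, ?_⟩
  rw [ind_of rfl, mul_one]; exact hω

lemma law_pair_le_left {p : Ω → ℝ} (hp : ∀ ω, 0 ≤ p ω) (X : Ω → α) (Z : Ω → β) (a : α) (b : β) :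
    law p (fun ω => (X ω, Z ω)) (a, b) ≤ law p X a := by
  rw [law_eq, law_eq]
  refine Finset.sum_le_sum fun ω _ => mul_le_mul_of_nonneg_left ?_ (hp ω)
  by_cases h : X ω = a
  · rw [ind_of h]; exact ind_le_one _
  · rw [ind_not (fun h' => h (Prod.ext_iff.mp h').1)]; exact ind_nonneg _

variable [Fintype α] [Fintype β]

lemma sum_law (p : Ω → ℝ) (X : Ω → α) (g : α → ℝ) :
    ∑ a, law p X a * g a = ∑ ω, p ω * g (X ω) := by
  simp_rw [law_eq, Finset.sum_mul]
  rw [Finset.sum_comm]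
  refine Finset.sum_congr rfl fun ω _ => ?_
  rw [Finset.sum_eq_single (X ω)]
  · rw [ind_of rfl, mul_one]
  · intro b _ hb; rw [ind_not (Ne.symm hb)]; ring
  · simp

lemma law_mem_stdSimplex {p : Ω → ℝ} (hp : p ∈ stdSimplex ℝ Ω) (X : Ω → α) :
    law p X ∈ stdSimplex ℝ α :=
  ⟨law_nonneg hp.1 X, by simpa [hp.2] using sum_law p X fun _ => (1 : ℝ)⟩

/-- Entropy as the mean of the self-information. -/
lemma entropy_eq_sum (p : Ω → ℝ) (X : Ω → α) :
    entropy p X = ∑ ω, p ω * -Real.log (law p X (X ω)) := by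
  rw [← sum_law p X fun a => -Real.log (law p X a)]
  unfold entropy
  exact Finset.sum_congr rfl fun a _ => by rw [Real.negMulLog]; ring

lemma mutualInfo_eq_sum {p : Ω → ℝ} (hp : ∀ ω, 0 ≤ p ω) (X : Ω → α) (Z : Ω → β) :
    mutualInfo p X Z = ∑ ω, p ω * Real.log (law p (fun ω => (X ω, Z ω)) (X ω, Z ω) /
      (law p X (X ω) * law p Z (Z ω))) := by
  unfold mutualInfo
  rw [entropy_eq_sum, entropy_eq_sum, entropy_eq_sum, ← Finset.sum_add_distrib,
    ← Finset.sum_sub_distrib]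
  refine Finset.sum_congr rfl fun ω _ => ?_
  rcases (hp ω).eq_or_lt with h | h
  · simp [← h]
  · have h1 := law_pos hp X h
    have h2 := law_pos hp Z h
    have h3 := law_pos hp (fun ω => (X ω, Z ω)) h
    rw [Real.log_div h3.ne' (by positivity), Real.log_mul h1.ne' h2.ne']
    ring

/-- Since `P(x, z) ≤ P(x)`, the information density is at most `1 / P(z)`, and the mean of `log (1 /
P(z))` is compared with the uniform pmf. -/
lemma mutualInfo_le_log_card {p : Ω → ℝ} (hp : p ∈ stdSimplex ℝ Ω) (X : Ω → α) (Z : Ω → β) :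
    mutualInfo p X Z ≤ Real.log (Fintype.card β) := by
  have hne : Nonempty Ω := by
    by_contra h
    rw [not_nonempty_iff] at h
    simpa using hp.2
  have hβ : Nonempty β := ⟨Z (Classical.arbitrary Ω)⟩
  have hcard : (0 : ℝ) < Fintype.card β := by exact_mod_cast Fintype.card_pos
  rw [mutualInfo_eq_sum hp.1]
  have key : ∀ ω, p ω * Real.log (law p (fun ω => (X ω, Z ω)) (X ω, Z ω) /
      (law p X (X ω) * law p Z (Z ω))) ≤ p ω * Real.log (Fintype.card β)
        + (p ω * (1 / (Fintype.card β * law p Z (Z ω))) - p ω) := by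
    intro ω
    rcases (hp.1 ω).eq_or_lt with h | h
    · simp [← h]
    · have h1 := law_pos hp.1 X h
      have h2 := law_pos hp.1 Z h
      have h3 := law_pos hp.1 (fun ω => (X ω, Z ω)) h
      have h4 := law_pair_le_left hp.1 X Z (X ω) (Z ω)
      have h5 : Real.log (law p (fun ω => (X ω, Z ω)) (X ω, Z ω) /
          (law p X (X ω) * law p Z (Z ω))) ≤ Real.log (1 / law p Z (Z ω)) := by
        refine Real.log_le_log (by positivity) ?_
        rw [div_le_div_iff₀ (by positivity) h2]
        nlinarith
      have h6 : Real.log (1 / law p Z (Z ω)) = Real.log (Fintype.card β)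
          + Real.log (1 / (Fintype.card β * law p Z (Z ω))) := by
        rw [← Real.log_mul hcard.ne' (by positivity)]
        congr 1; field_simp
      have h7 := Real.log_le_sub_one_of_pos
        (show 0 < 1 / (Fintype.card β * law p Z (Z ω)) by positivity)
      have := mul_le_mul_of_nonneg_left (h5.trans (h6.le.trans (by linarith [h7] :
        _ ≤ Real.log (Fintype.card β) + (1 / (Fintype.card β * law p Z (Z ω)) - 1)))) h.le
      linarith
  refine (Finset.sum_le_sum fun ω _ => key ω).trans ?_
  rw [Finset.sum_add_distrib, Finset.sum_sub_distrib, ← Finset.sum_mul, hp.2, one_mul]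
  have h8 : ∑ ω, p ω * (1 / (Fintype.card β * law p Z (Z ω))) ≤ 1 := by
    rw [← sum_law p Z fun b => 1 / ((Fintype.card β : ℝ) * law p Z b)]
    calc ∑ b, law p Z b * (1 / ((Fintype.card β : ℝ) * law p Z b))
        ≤ ∑ _b : β, 1 / (Fintype.card β : ℝ) := by
          refine Finset.sum_le_sum fun b _ => ?_
          rcases (law_nonneg hp.1 Z b).eq_or_lt with h | h
          · rw [← h]; simp
          · apply le_of_eq; field_simp
      _ = 1 := by simp
  linarith

lemma mutualInfo_comm {p : Ω → ℝ} (hp : ∀ ω, 0 ≤ p ω) (X : Ω → α) (Z : Ω → β) :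
    mutualInfo p X Z = mutualInfo p Z X := by
  rw [mutualInfo_eq_sum hp, mutualInfo_eq_sum hp]
  refine Finset.sum_congr rfl fun ω _ => ?_
  have : law p (fun ω => (X ω, Z ω)) (X ω, Z ω) = law p (fun ω => (Z ω, X ω)) (Z ω, X ω) := by
    rw [law_eq, law_eq]
    refine Finset.sum_congr rfl fun ω' _ => ?_
    congr 2
    simp [and_comm]
  rw [this, mul_comm (law p X _)]

end Information

/-! ### Dual form of the random coding exponent. -/

section Saddle

variable {U Y : Type*}

section

variable [Fintype Y]

/-- The channels over which the random coding exponent is minimised. -/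
def feasibleChannels (p : U → ℝ) (W : U → Y → ℝ) : Set (U → Y → ℝ) :=
  {V | (∀ u, V u ∈ stdSimplex ℝ Y) ∧ ∀ u y, 0 < p u → W u y = 0 → V u y = 0}

lemma isCompact_feasibleChannels (p : U → ℝ) (W : U → Y → ℝ) :
    IsCompact (feasibleChannels p W) := by
  have h1 : IsCompact {V : U → Y → ℝ | ∀ u, V u ∈ stdSimplex ℝ Y} := by
    have := isCompact_univ_pi (fun _ : U => isCompact_stdSimplex ℝ Y)
    simpa [Set.pi] using this
  have h2 : IsClosed {V : U → Y → ℝ | ∀ u y, 0 < p u → W u y = 0 → V u y = 0} := by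
    simp only [Set.ofPred_forall]
    refine isClosed_iInter fun u => isClosed_iInter fun y => isClosed_iInter fun _ =>
      isClosed_iInter fun _ => ?_
    exact isClosed_eq (by fun_prop) continuous_const
  exact h1.inter_right h2

/-- Unnormalised geometric mixture of `W` and `q`. -/
def tiltWeight (W : U → Y → ℝ) (q : Y → ℝ) (s : ℝ) (u : U) (y : Y) : ℝ :=
  W u y * Real.exp (-(s / (1 + s)) * Real.log (W u y / q y))

/-- The geometric mixture of `W` and `q`, normalised. -/
def tiltChannel (W : U → Y → ℝ) (q : Y → ℝ) (s : ℝ) (u : U) (y : Y) : ℝ :=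
  tiltWeight W q s u y / ∑ y', tiltWeight W q s u y'

lemma sum_tiltWeight_pos {W : U → Y → ℝ} (hW : ∀ u, W u ∈ stdSimplex ℝ Y) (q : Y → ℝ) (s : ℝ)
    (u : U) : 0 < ∑ y, tiltWeight W q s u y := by
  have hnn : ∀ y, 0 ≤ tiltWeight W q s u y := fun y =>
    mul_nonneg ((hW u).1 y) (Real.exp_pos _).le
  refine lt_of_le_of_ne (Finset.sum_nonneg fun y _ => hnn y) fun h => ?_
  have h0 := (Finset.sum_eq_zero_iff_of_nonneg fun y _ => hnn y).mp h.symm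
  have : ∑ y, W u y = 0 := Finset.sum_eq_zero fun y hy => by
    rcases mul_eq_zero.mp (h0 y hy) with h | h
    · exact h
    · exact absurd h (Real.exp_pos _).ne'
  rw [(hW u).2] at this
  exact one_ne_zero this

lemma tiltChannel_mem {W : U → Y → ℝ} (hW : ∀ u, W u ∈ stdSimplex ℝ Y) (q : Y → ℝ) (s : ℝ)
    (u : U) : tiltChannel W q s u ∈ stdSimplex ℝ Y := by
  have h := sum_tiltWeight_pos hW q s u
  refine ⟨fun y => div_nonneg (mul_nonneg ((hW u).1 y) (Real.exp_pos _).le) h.le, ?_⟩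
  unfold tiltChannel
  rw [← Finset.sum_div, div_self h.ne']

lemma tiltChannel_pos {W : U → Y → ℝ} (hW : ∀ u, W u ∈ stdSimplex ℝ Y) (q : Y → ℝ) (s : ℝ)
    {u : U} {y : Y} (h : 0 < W u y) : 0 < tiltChannel W q s u y :=
  div_pos (mul_pos h (Real.exp_pos _)) (sum_tiltWeight_pos hW q s u)

/-- The mixture is proportional to `W ^ (1 / (1 + s)) * q ^ (s / (1 + s))`; the factor `1 + s`
clears the exponents. -/
lemma log_tiltChannel {W : U → Y → ℝ} (hW : ∀ u, W u ∈ stdSimplex ℝ Y) {q : Y → ℝ} {s : ℝ}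
    (hs : 0 ≤ s) {u : U} {y : Y} (h : 0 < W u y) (hq : 0 < q y) :
    (1 + s) * Real.log (tiltChannel W q s u y) = Real.log (W u y) + s * Real.log (q y)
      - (1 + s) * Real.log (∑ y', tiltWeight W q s u y') := by
  have h1 := sum_tiltWeight_pos hW q s u
  have h2 : 0 < tiltWeight W q s u y := mul_pos h (Real.exp_pos _)
  have hs1 : (1 + s) ≠ 0 := by positivity
  rw [tiltChannel, Real.log_div h2.ne' h1.ne']
  have : Real.log (tiltWeight W q s u y)
      = Real.log (W u y) - s / (1 + s) * (Real.log (W u y) - Real.log (q y)) := by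
    rw [tiltWeight, Real.log_mul h.ne' (Real.exp_pos _).ne', Real.log_exp,
      Real.log_div h.ne' hq.ne']; ring
  rw [this]
  field_simp
  ring

end
variable [Fintype U]

/-- Output pmf of the channel `V` for the input pmf `p`. -/
def outLaw (p : U → ℝ) (V : U → Y → ℝ) (y : Y) : ℝ := ∑ u, p u * V u y

lemma outLaw_pos {p : U → ℝ} (hp : ∀ u, 0 ≤ p u) {V : U → Y → ℝ} (hV : ∀ u y, 0 ≤ V u y) {u : U}
    {y : Y} (hu : 0 < p u) (hy : 0 < V u y) : 0 < outLaw p V y :=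
  Finset.sum_pos' (fun u _ => mul_nonneg (hp u) (hV u y)) ⟨u, Finset.mem_univ _, mul_pos hu hy⟩

lemma outLaw_nonneg {p : U → ℝ} (hp : ∀ u, 0 ≤ p u) {V : U → Y → ℝ} (hV : ∀ u y, 0 ≤ V u y)
    (y : Y) : 0 ≤ outLaw p V y :=
  Finset.sum_nonneg fun u _ => mul_nonneg (hp u) (hV u y)

variable [Fintype Y]

lemma mutualInfo_channel {p : U → ℝ} (hp : p ∈ stdSimplex ℝ U) {V : U → Y → ℝ}
    (hV : ∀ u, V u ∈ stdSimplex ℝ Y) :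
    mutualInfo (fun uy : U × Y => p uy.1 * V uy.1 uy.2) Prod.fst Prod.snd
      = condDiv V (fun _ => outLaw p V) p := by
  have hP : ∀ uy : U × Y, 0 ≤ p uy.1 * V uy.1 uy.2 := fun uy =>
    mul_nonneg (hp.1 _) ((hV _).1 _)
  rw [mutualInfo_eq_sum hP, Fintype.sum_prod_type]
  unfold condDiv
  refine Finset.sum_congr rfl fun u _ => ?_
  rw [Finset.mul_sum]
  refine Finset.sum_congr rfl fun y _ => ?_
  have h1 : law (fun uy : U × Y => p uy.1 * V uy.1 uy.2) Prod.fst u = p u := by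
    rw [law_eq, Fintype.sum_prod_type, Finset.sum_eq_single u]
    · have h : ∀ y, p (u, y).1 * V (u, y).1 (u, y).2 * ind ((u, y).1 = u) = p u * V u y := by
        intro y; rw [ind_of (P := (u, y).1 = u) rfl, mul_one]
      rw [Finset.sum_congr rfl fun y _ => h y, ← Finset.mul_sum, (hV u).2, mul_one]
    · intro b _ hb; simp [ind_not hb]
    · simp
  have h2 : law (fun uy : U × Y => p uy.1 * V uy.1 uy.2) Prod.snd y = outLaw p V y := by
    rw [law_eq, Fintype.sum_prod_type]
    refine Finset.sum_congr rfl fun u _ => ?_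
    rw [Finset.sum_eq_single y]
    · rw [ind_of rfl, mul_one]
    · intro b _ hb; simp [ind_not hb]
    · simp
  have h3 : law (fun uy : U × Y => p uy.1 * V uy.1 uy.2) (fun ω => (ω.1, ω.2)) (u, y)
      = p u * V u y := by
    rw [law_eq, Finset.sum_eq_single (u, y)]
    · rw [ind_of rfl, mul_one]
    · intro b _ hb; rw [ind_not hb, mul_zero]
    · simp
  rw [h1, h2, h3]
  rcases (hp.1 u).eq_or_lt with h | h
  · simp [← h]
  · rw [mul_assoc, mul_div_mul_left _ _ h.ne']

lemma outLaw_mem_stdSimplex {p : U → ℝ} (hp : p ∈ stdSimplex ℝ U) {V : U → Y → ℝ}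
    (hV : ∀ u, V u ∈ stdSimplex ℝ Y) : outLaw p V ∈ stdSimplex ℝ Y := by
  refine ⟨outLaw_nonneg hp.1 fun u => (hV u).1, ?_⟩
  unfold outLaw
  rw [Finset.sum_comm]
  simp_rw [← Finset.mul_sum, (hV _).2, mul_one, hp.2]

lemma condDiv_nonneg {p : U → ℝ} (hp : ∀ u, 0 ≤ p u) {V W : U → Y → ℝ}
    (hV : ∀ u, V u ∈ stdSimplex ℝ Y) (hW : ∀ u, 0 < p u → W u ∈ stdSimplex ℝ Y)
    (hVW : ∀ u y, 0 < p u → W u y = 0 → V u y = 0) : 0 ≤ condDiv V W p := by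
  refine Finset.sum_nonneg fun u _ => ?_
  rcases (hp u).eq_or_lt with h | h
  · simp [← h]
  · refine mul_nonneg h.le ?_
    calc (0 : ℝ) = ∑ y, (V u y - W u y) := by
          rw [Finset.sum_sub_distrib, (hV u).2, (hW u h).2, sub_self]
      _ ≤ _ := Finset.sum_le_sum fun y _ =>
          sub_le_mul_log_div ((hV u).1 y) ((hW u h).1 y) (hVW u y h)

lemma eq_of_condDiv_le_zero {p : U → ℝ} (hp : ∀ u, 0 ≤ p u) {V W : U → Y → ℝ}
    (hV : ∀ u, V u ∈ stdSimplex ℝ Y) (hW : ∀ u, 0 < p u → W u ∈ stdSimplex ℝ Y)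
    (hVW : ∀ u y, 0 < p u → W u y = 0 → V u y = 0) (hle : condDiv V W p ≤ 0)
    {u : U} (hu : 0 < p u) (y : Y) : V u y = W u y := by
  have hterm : ∀ u, 0 < p u → ∀ y, V u y - W u y ≤ V u y * Real.log (V u y / W u y) :=
    fun u h y => sub_le_mul_log_div ((hV u).1 y) ((hW u h).1 y) (hVW u y h)
  have hrow : ∀ u, 0 < p u → 0 ≤ ∑ y, V u y * Real.log (V u y / W u y) := fun u h =>
    calc (0 : ℝ) = ∑ y, (V u y - W u y) := by
          rw [Finset.sum_sub_distrib, (hV u).2, (hW u h).2, sub_self]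
      _ ≤ _ := Finset.sum_le_sum fun y _ => hterm u h y
  have hnn : ∀ u ∈ Finset.univ, 0 ≤ p u * ∑ y, V u y * Real.log (V u y / W u y) := by
    intro u _
    rcases (hp u).eq_or_lt with h | h
    · simp [← h]
    · exact mul_nonneg h.le (hrow u h)
  have h0 : condDiv V W p = 0 := le_antisymm hle (Finset.sum_nonneg hnn)
  have h1 := (Finset.sum_eq_zero_iff_of_nonneg hnn).mp h0 u (Finset.mem_univ _)
  have h2 : ∑ y, V u y * Real.log (V u y / W u y) = 0 := by
    rcases mul_eq_zero.mp h1 with h | h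
    · exact absurd h hu.ne'
    · exact h
  have h3 : ∑ y, (V u y * Real.log (V u y / W u y) - (V u y - W u y)) = 0 := by
    rw [Finset.sum_sub_distrib, Finset.sum_sub_distrib, h2, (hV u).2, (hW u hu).2]; ring
  have h4 := (Finset.sum_eq_zero_iff_of_nonneg fun y _ => sub_nonneg.mpr (hterm u hu y)).mp h3 y
    (Finset.mem_univ _)
  exact eq_of_mul_log_div_le ((hV u).1 y) ((hW u hu).1 y) (hVW u y hu) (by linarith)

/-- The objective of the random coding exponent. -/
def exponentObjective (R : ℝ) (p : U → ℝ) (W V : U → Y → ℝ) : ℝ :=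
  condDiv V W p + max (condDiv V (fun _ => outLaw p V) p - R) 0

lemma randomCodingExponent_le {R : ℝ} {p : U → ℝ} (hp : p ∈ stdSimplex ℝ U) {W V : U → Y → ℝ}
    (hW : ∀ u, W u ∈ stdSimplex ℝ Y) (hV : V ∈ feasibleChannels p W) :
    randomCodingExponent R p W ≤ exponentObjective R p W V := by
  refine csInf_le ⟨0, ?_⟩ ⟨V, hV.1, hV.2, ?_⟩
  · rintro e ⟨V, h1, h2, rfl⟩
    exact add_nonneg (condDiv_nonneg hp.1 h1 (fun u _ => hW u) h2) (le_max_right _ _)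
  · rw [mutualInfo_channel hp hV.1]; rfl

/-- The entropy form is visibly continuous in `V`, while the divergence form has denominators that
may vanish; `exists_minimizer` needs the former. -/
lemma condDiv_outLaw_eq {p : U → ℝ} (hp : ∀ u, 0 ≤ p u) {V : U → Y → ℝ}
    (hV : ∀ u y, 0 ≤ V u y) :
    condDiv V (fun _ => outLaw p V) p
      = ∑ y, Real.negMulLog (outLaw p V y) - ∑ u, p u * ∑ y, Real.negMulLog (V u y) := by
  have h1 : ∑ y, Real.negMulLog (outLaw p V y)
      = ∑ u, p u * ∑ y, -(V u y * Real.log (outLaw p V y)) := by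
    simp_rw [Finset.mul_sum]
    rw [Finset.sum_comm]
    refine Finset.sum_congr rfl fun y _ => ?_
    rw [Real.negMulLog]
    generalize Real.log (outLaw p V y) = t
    rw [outLaw, neg_mul, Finset.sum_mul, ← Finset.sum_neg_distrib]
    exact Finset.sum_congr rfl fun u _ => by ring
  rw [h1, ← Finset.sum_sub_distrib]
  unfold condDiv
  refine Finset.sum_congr rfl fun u _ => ?_
  rw [← mul_sub, ← Finset.sum_sub_distrib]
  rcases (hp u).eq_or_lt with h | h
  · simp [← h]
  · congr 1
    refine Finset.sum_congr rfl fun y _ => ?_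
    rcases (hV u y).eq_or_lt with h0 | h0
    · simp [← h0]
    · rw [Real.log_div h0.ne' (outLaw_pos hp hV h h0).ne', Real.negMulLog]; ring

lemma continuous_mul_log_div (w : ℝ) : Continuous fun x : ℝ => x * Real.log (x / w) := by
  by_cases hw : w = 0
  · simp only [hw, div_zero, Real.log_zero, mul_zero]; exact continuous_const
  · have : (fun x : ℝ => x * Real.log (x / w)) = fun x => x * Real.log x - x * Real.log w := by
      funext x
      by_cases hx : x = 0
      · simp [hx]
      · rw [Real.log_div hx hw]; ring
    rw [this]
    exact Real.continuous_mul_log.sub (continuous_id.mul continuous_const)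

lemma continuous_condDiv (p : U → ℝ) (W : U → Y → ℝ) :
    Continuous fun V : U → Y → ℝ => condDiv V W p := by
  unfold condDiv
  refine continuous_finsetSum _ fun u _ => continuous_const.mul
    (continuous_finsetSum _ fun y _ => ?_)
  exact (continuous_mul_log_div (W u y)).comp
    ((continuous_apply y).comp (continuous_apply u))

lemma exists_minimizer (R : ℝ) {p : U → ℝ} (hp : p ∈ stdSimplex ℝ U) {W : U → Y → ℝ}
    (hW : ∀ u, W u ∈ stdSimplex ℝ Y) :
    ∃ V ∈ feasibleChannels p W, ∀ V' ∈ feasibleChannels p W,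
      exponentObjective R p W V ≤ exponentObjective R p W V' := by
  suffices h : ContinuousOn (exponentObjective R p W) (feasibleChannels p W) from
    (isCompact_feasibleChannels p W).exists_isMinOn ⟨W, hW, fun _ _ _ h => h⟩ h
  refine (continuous_condDiv p W).continuousOn.add ?_
  refine ContinuousOn.sup (ContinuousOn.sub ?_ continuousOn_const) continuousOn_const
  have : Continuous fun V : U → Y → ℝ =>
      ∑ y, Real.negMulLog (outLaw p V y) - ∑ u, p u * ∑ y, Real.negMulLog (V u y) := by
    unfold outLaw
    have := Real.continuous_negMulLog
    fun_prop
  exact this.continuousOn.congr fun V hV => condDiv_outLaw_eq hp.1 fun u => (hV.1 u).1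

/-- The output pmf of a minimiser charges every output that the channel can produce. -/
lemma outLaw_minimizer_pos {R : ℝ} {p : U → ℝ} (hp : p ∈ stdSimplex ℝ U) {W V : U → Y → ℝ}
    (hW : ∀ u, W u ∈ stdSimplex ℝ Y) (hV : V ∈ feasibleChannels p W)
    (hmin : ∀ V' ∈ feasibleChannels p W, exponentObjective R p W V ≤ exponentObjective R p W V')
    {u₀ : U} {y₀ : Y} (hu₀ : 0 < p u₀) (hy₀ : 0 < W u₀ y₀) : 0 < outLaw p V y₀ := by
  have hV0 : ∀ u y, 0 ≤ V u y := fun u => (hV.1 u).1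
  have hW0 : ∀ u y, 0 ≤ W u y := fun u => (hW u).1
  by_contra hcon
  have hq0 : outLaw p V y₀ = 0 := le_antisymm (not_lt.mp hcon) (outLaw_nonneg hp.1 hV0 y₀)
  have hV₀ : V u₀ y₀ = 0 := by
    by_contra h
    exact (outLaw_pos hp.1 hV0 hu₀ (lt_of_le_of_ne (hV0 _ _) (Ne.symm h))).ne' hq0
  set d := p u₀ * W u₀ y₀ with hd
  have hd0 : 0 < d := mul_pos hu₀ hy₀
  set J := max (condDiv W (fun _ => outLaw p W) p - R) 0 with hJ
  have hJ0 : 0 ≤ J := le_max_right _ _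
  have hF0 : 0 ≤ exponentObjective R p W V :=
    add_nonneg (condDiv_nonneg hp.1 hV.1 (fun u _ => hW u) hV.2) (le_max_right _ _)
  -- Moving `V` towards `W` by `ε` changes the convex parts by `O(ε)` but gains `ε d log ε`. This
  -- `ε` gives `d log ε = -(J + 1)`, which outweighs the possible increase `ε J` and contradicts
  -- minimality.
  set ε := Real.exp (-((J + 1) / d)) with hε
  have hε0 : 0 < ε := Real.exp_pos _
  have hε1 : ε < 1 := by
    rw [hε, Real.exp_lt_one_iff]
    have := div_pos (by linarith : 0 < J + 1) hd0
    linarith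
  set Vε : U → Y → ℝ := fun u y => (1 - ε) * V u y + ε * W u y with hVε
  have hq : ∀ y, outLaw p Vε y = (1 - ε) * outLaw p V y + ε * outLaw p W y := by
    intro y
    simp only [outLaw, hVε, Finset.mul_sum, ← Finset.sum_add_distrib]
    exact Finset.sum_congr rfl fun u _ => by ring
  have hVεC : Vε ∈ feasibleChannels p W := by
    refine ⟨fun u => ⟨fun y => ?_, ?_⟩, fun u y hu hy => ?_⟩
    · exact add_nonneg (mul_nonneg (by linarith) (hV0 u y)) (mul_nonneg hε0.le (hW0 u y))
    · simp only [hVε]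
      rw [Finset.sum_add_distrib, ← Finset.mul_sum, ← Finset.mul_sum, (hV.1 u).2, (hW u).2]; ring
    · simp only [hVε]; rw [hV.2 u y hu hy, hy]; ring
  have hscale : ∀ {a b t : ℝ}, 0 < t → (t * a) * Real.log ((t * a) / (t * b))
      = t * (a * Real.log (a / b)) := by
    intro a b t ht
    rw [mul_div_mul_left _ _ ht.ne']; ring
  have hI : condDiv Vε (fun _ => outLaw p Vε) p
      ≤ (1 - ε) * condDiv V (fun _ => outLaw p V) p + ε * condDiv W (fun _ => outLaw p W) p := by
    simp only [condDiv, Finset.mul_sum, ← Finset.sum_add_distrib]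
    refine Finset.sum_le_sum fun u _ => Finset.sum_le_sum fun y _ => ?_
    rcases (hp.1 u).eq_or_lt with h | h
    · simp [← h]
    · have := log_sum_le (a := (1 - ε) * V u y) (b := ε * W u y) (c := (1 - ε) * outLaw p V y)
        (d := ε * outLaw p W y) (mul_nonneg (by linarith) (hV0 u y))
        (mul_nonneg hε0.le (hW0 u y)) (mul_nonneg (by linarith) (outLaw_nonneg hp.1 hV0 y))
        (mul_nonneg hε0.le (outLaw_nonneg hp.1 hW0 y)) ?_ ?_
      · rw [hscale (by linarith), hscale hε0] at this
        rw [hq]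
        have := mul_le_mul_of_nonneg_left this h.le
        simp only [hVε]
        linarith
      · intro h0
        rcases mul_eq_zero.mp h0 with h0 | h0
        · linarith
        · rcases (hV0 u y).eq_or_lt with h1 | h1
          · rw [← h1, mul_zero]
          · exact absurd h0 (outLaw_pos hp.1 hV0 h h1).ne'
      · intro h0
        rcases mul_eq_zero.mp h0 with h0 | h0
        · linarith
        · rcases (hW0 u y).eq_or_lt with h1 | h1
          · rw [← h1, mul_zero]
          · exact absurd h0 (outLaw_pos hp.1 hW0 h h1).ne'
  -- The extra term comes from the single entry `(u₀, y₀)`, where `V` vanishes and `Vε / W = ε`; all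
  -- other entries are handled by convexity.
  have hD : condDiv Vε W p ≤ (1 - ε) * condDiv V W p + ε * (d * Real.log ε) := by
    have hpoint : ∀ u y, p u * (Vε u y * Real.log (Vε u y / W u y))
        ≤ (1 - ε) * (p u * (V u y * Real.log (V u y / W u y)))
          + (if u = u₀ then if y = y₀ then ε * (d * Real.log ε) else 0 else 0) := by
      intro u y
      have hgen : p u * (Vε u y * Real.log (Vε u y / W u y))
          ≤ (1 - ε) * (p u * (V u y * Real.log (V u y / W u y))) := by
        rcases (hp.1 u).eq_or_lt with h | h
        · simp [← h]
        · have := log_sum_le (a := (1 - ε) * V u y) (b := ε * W u y) (c := (1 - ε) * W u y)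
            (d := ε * W u y) (mul_nonneg (by linarith) (hV0 u y))
            (mul_nonneg hε0.le (hW0 u y)) (mul_nonneg (by linarith) (hW0 u y))
            (mul_nonneg hε0.le (hW0 u y)) ?_ (fun h => h)
          · rw [hscale (by linarith), hscale hε0] at this
            have h1 : (1 - ε) * W u y + ε * W u y = W u y := by ring
            have h2 : W u y * Real.log (W u y / W u y) = 0 := by
              by_cases hw : W u y = 0
              · simp [hw]
              · rw [div_self hw, Real.log_one, mul_zero]
            rw [h1, h2] at this
            have := mul_le_mul_of_nonneg_left this h.le
            simp only [hVε]
            linarith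
          · intro h0
            rcases mul_eq_zero.mp h0 with h0 | h0
            · linarith
            · rw [hV.2 u y h h0, mul_zero]
      by_cases hu : u = u₀
      · by_cases hy : y = y₀
        · subst hu; subst hy
          simp only [if_true, hVε, hV₀]
          have : ((1 - ε) * 0 + ε * W u y) / W u y = ε := by field_simp; ring
          rw [this, hd]
          apply le_of_eq; ring
        · simp only [hy, if_false, ite_self, add_zero]; exact hgen
      · simp only [hu, if_false, add_zero]; exact hgen
    calc condDiv Vε W p = ∑ u, ∑ y, p u * (Vε u y * Real.log (Vε u y / W u y)) := by
          simp only [condDiv, Finset.mul_sum]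
      _ ≤ _ := Finset.sum_le_sum fun u _ => Finset.sum_le_sum fun y _ => hpoint u y
      _ = _ := by
          simp only [Finset.sum_add_distrib, condDiv, Finset.mul_sum]
          congr 1
          rw [Finset.sum_eq_single u₀, Finset.sum_eq_single y₀] <;> simp +contextual
  have hmax : max (condDiv Vε (fun _ => outLaw p Vε) p - R) 0
      ≤ (1 - ε) * max (condDiv V (fun _ => outLaw p V) p - R) 0 + ε * J := by
    have h1 := le_max_left (condDiv V (fun _ => outLaw p V) p - R) 0
    have h2 := le_max_right (condDiv V (fun _ => outLaw p V) p - R) 0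
    have h3 := le_max_left (condDiv W (fun _ => outLaw p W) p - R) 0
    refine max_le ?_ (add_nonneg (mul_nonneg (by linarith) h2) (mul_nonneg hε0.le hJ0))
    nlinarith [mul_le_mul_of_nonneg_left h1 (by linarith : 0 ≤ 1 - ε),
      mul_le_mul_of_nonneg_left h3 hε0.le]
  have hm := hmin Vε hVεC
  have hlog : d * Real.log ε = -(J + 1) := by
    rw [hε, Real.log_exp]; field_simp
  rw [hlog] at hD
  unfold exponentObjective at hm hF0
  nlinarith

/-- The gap between the two sides is the divergence of the output pmf from `q`: mutual information
is the smallest divergence to a constant channel. -/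
lemma condDiv_outLaw_le {p : U → ℝ} (hp : p ∈ stdSimplex ℝ U) {V : U → Y → ℝ} {q : Y → ℝ}
    (hV : ∀ u, V u ∈ stdSimplex ℝ Y) (hq : q ∈ stdSimplex ℝ Y)
    (hVq : ∀ u y, 0 < p u → 0 < V u y → 0 < q y) :
    condDiv V (fun _ => outLaw p V) p ≤ condDiv V (fun _ => q) p := by
  have hV0 : ∀ u y, 0 ≤ V u y := fun u => (hV u).1
  have hout := outLaw_mem_stdSimplex hp hV
  have hsupp : ∀ y, q y = 0 → outLaw p V y = 0 := by
    intro y hy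
    refine Finset.sum_eq_zero fun u _ => ?_
    rcases (hp.1 u).eq_or_lt with h | h
    · rw [← h, zero_mul]
    · rcases (hV0 u y).eq_or_lt with h1 | h1
      · rw [← h1, mul_zero]
      · exact absurd hy (hVq u y h h1).ne'
  have hdiff : condDiv V (fun _ => q) p - condDiv V (fun _ => outLaw p V) p
      = ∑ y, outLaw p V y * Real.log (outLaw p V y / q y) := by
    have h1 : ∀ y, outLaw p V y * Real.log (outLaw p V y / q y)
        = ∑ u, p u * (V u y * Real.log (outLaw p V y / q y)) := by
      intro y
      generalize Real.log (outLaw p V y / q y) = t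
      rw [outLaw, Finset.sum_mul]
      exact Finset.sum_congr rfl fun u _ => by ring
    simp_rw [h1]
    rw [Finset.sum_comm]
    simp only [condDiv, Finset.mul_sum, ← Finset.sum_sub_distrib]
    refine Finset.sum_congr rfl fun u _ => Finset.sum_congr rfl fun y _ => ?_
    rcases (hp.1 u).eq_or_lt with h | h
    · simp [← h]
    · rcases (hV0 u y).eq_or_lt with h1 | h1
      · simp [← h1]
      · have h2 := outLaw_pos hp.1 hV0 h h1
        have h3 := hVq u y h h1
        rw [Real.log_div h1.ne' h3.ne', Real.log_div h1.ne' h2.ne', Real.log_div h2.ne' h3.ne']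
        ring
  have : 0 ≤ ∑ y, outLaw p V y * Real.log (outLaw p V y / q y) :=
    calc (0 : ℝ) = ∑ y, (outLaw p V y - q y) := by
          rw [Finset.sum_sub_distrib, hout.2, hq.2, sub_self]
      _ ≤ _ := Finset.sum_le_sum fun y _ => sub_le_mul_log_div (hout.1 y) (hq.1 y) (hsupp y)
  linarith

/-- The analogue of completing the square. The weighted sum of divergences to `W` and to `q` becomes
one divergence to their normalised geometric mixture plus a term free of `V`, so the minimiser can
be read off. -/
lemma condDiv_add_mul_condDiv {p : U → ℝ} (hp : p ∈ stdSimplex ℝ U) {W V : U → Y → ℝ} {q : Y → ℝ}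
    (hW : ∀ u, W u ∈ stdSimplex ℝ Y) (hq : ∀ u y, 0 < p u → 0 < W u y → 0 < q y)
    (hV : V ∈ feasibleChannels p W) {s : ℝ} (hs : 0 ≤ s) :
    condDiv V W p + s * condDiv V (fun _ => q) p
      = (1 + s) * condDiv V (tiltChannel W q s) p
        + ∑ u, p u * (-((1 + s) * Real.log (∑ y', tiltWeight W q s u y'))) := by
  simp only [condDiv, Finset.mul_sum (s := (Finset.univ : Finset U)), ← Finset.sum_add_distrib]
  refine Finset.sum_congr rfl fun u _ => ?_
  rcases (hp.1 u).eq_or_lt with h | h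
  · simp [← h]
  · have hone : (-((1 + s) * Real.log (∑ y', tiltWeight W q s u y')))
        = ∑ y, V u y * (-((1 + s) * Real.log (∑ y', tiltWeight W q s u y'))) := by
      rw [← Finset.sum_mul, (hV.1 u).2, one_mul]
    rw [hone]
    have : ∀ y, V u y * Real.log (V u y / W u y) + s * (V u y * Real.log (V u y / q y))
        = (1 + s) * (V u y * Real.log (V u y / tiltChannel W q s u y))
          + V u y * (-((1 + s) * Real.log (∑ y', tiltWeight W q s u y'))) := by
      intro y
      rcases ((hV.1 u).1 y).eq_or_lt with h1 | h1
      · simp [← h1]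
      · have hw : 0 < W u y := lt_of_le_of_ne ((hW u).1 y) fun h0 => h1.ne' (hV.2 u y h h0.symm)
        have hq' := hq u y h hw
        have hl := log_tiltChannel hW hs hw hq'
        rw [Real.log_div h1.ne' hw.ne', Real.log_div h1.ne' hq'.ne',
          Real.log_div h1.ne' (tiltChannel_pos hW q s hw).ne']
        linear_combination V u y * hl
    have h2 : ∑ y, V u y * Real.log (V u y / W u y) + s * ∑ y, V u y * Real.log (V u y / q y)
        = (1 + s) * ∑ y, V u y * Real.log (V u y / tiltChannel W q s u y)
          + ∑ y, V u y * (-((1 + s) * Real.log (∑ y', tiltWeight W q s u y'))) := by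
      rw [Finset.mul_sum, Finset.mul_sum, ← Finset.sum_add_distrib, ← Finset.sum_add_distrib]
      exact Finset.sum_congr rfl fun y _ => this y
    linear_combination p u * h2

/-- Dual description of the random coding exponent by an optimal tilting. -/
theorem exists_tilting (R : ℝ) {p : U → ℝ} (hp : p ∈ stdSimplex ℝ U) {W : U → Y → ℝ}
    (hW : ∀ u, W u ∈ stdSimplex ℝ Y) :
    ∃ (V : U → Y → ℝ) (s : ℝ) (c : U → ℝ), (∀ u, V u ∈ stdSimplex ℝ Y) ∧ s ∈ Set.Icc 0 1 ∧
      (∀ u y, 0 < p u → 0 < W u y → 0 < V u y ∧ 0 < outLaw p V y ∧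
        W u y * Real.exp (s * Real.log (outLaw p V y / V u y)) = V u y * Real.exp (-c u)) ∧
      randomCodingExponent R p W ≤ ∑ u, p u * c u - s * R := by
  obtain ⟨V, hV, hmin⟩ := exists_minimizer R hp hW
  set q := outLaw p V with hqdef
  have hq : ∀ u y, 0 < p u → 0 < W u y → 0 < q y := fun u y hu hy =>
    outLaw_minimizer_pos hp hW hV hmin hu hy
  have hqs : q ∈ stdSimplex ℝ Y := outLaw_mem_stdSimplex hp hV.1
  have hVs : ∀ s, tiltChannel W q s ∈ feasibleChannels p W := fun s =>
    ⟨tiltChannel_mem hW q s, fun u y _ h0 => by simp [tiltChannel, tiltWeight, h0]⟩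
  -- Freezing the output pmf at that of the minimiser replaces mutual information by a larger
  -- quantity that agrees with it at `V`. Hence `V` also minimises `Φ`, where `q` no longer varies.
  set Φ : (U → Y → ℝ) → ℝ := fun V => condDiv V W p + max (condDiv V (fun _ => q) p - R) 0 with hΦ
  have hΦmin : ∀ V' ∈ feasibleChannels p W, Φ V ≤ Φ V' := by
    intro V' hV'
    refine (hmin V' hV').trans ?_
    have : condDiv V' (fun _ => outLaw p V') p ≤ condDiv V' (fun _ => q) p :=
      condDiv_outLaw_le hp hV'.1 hqs fun u y hu hy => hq u y hu
        (lt_of_le_of_ne ((hW u).1 y) fun h0 => hy.ne' (hV'.2 u y hu h0.symm))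
    exact add_le_add le_rfl (max_le_max (by linarith) le_rfl)
  set h : ℝ → ℝ := fun s => condDiv (tiltChannel W q s) (fun _ => q) p with hh
  have hcont : ContinuousOn h (Set.Icc 0 1) := by
    refine (continuous_condDiv p (fun _ => q)).comp_continuousOn ?_
    rw [continuousOn_pi]
    intro u
    rw [continuousOn_pi]
    intro y
    have hw : ∀ y, ContinuousOn (fun s => tiltWeight W q s u y) (Set.Icc 0 1) := by
      intro y
      unfold tiltWeight
      refine continuousOn_const.mul (Real.continuous_exp.comp_continuousOn
        (ContinuousOn.mul (ContinuousOn.neg ?_) continuousOn_const))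
      refine continuousOn_id.div (continuousOn_const.add continuousOn_id) fun s hs => ?_
      have := hs.1
      positivity
    exact (hw y).div (continuousOn_finsetSum _ fun y _ => hw y)
      fun s _ => (sum_tiltWeight_pos hW q s u).ne'
  -- The multiplier with `max (h s - R) 0 = s (h s - R)`: an endpoint if the positive part is
  -- inactive at `0` or active at `1`, and otherwise, by the intermediate value theorem, a point
  -- with `h s = R`.
  have hs : ∃ s ∈ Set.Icc (0 : ℝ) 1, Φ (tiltChannel W q s)
      = condDiv (tiltChannel W q s) W p + s * (h s - R) := by
    rcases le_total (h 0) R with h0 | h0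
    · exact ⟨0, by simp, by
        simp only [hΦ]; rw [max_eq_right (by simp only [hh] at h0; linarith)]; ring⟩
    rcases le_total R (h 1) with h1 | h1
    · exact ⟨1, by simp, by
        simp only [hΦ]; rw [max_eq_left (by simp only [hh] at h1; linarith)]; ring⟩
    obtain ⟨s, hs, hsR⟩ := intermediate_value_Icc' zero_le_one hcont ⟨h1, h0⟩
    refine ⟨s, hs, ?_⟩
    simp only [hΦ]
    simp only [hh] at hsR ⊢
    rw [hsR]; simp
  obtain ⟨s, hs, hsΦ⟩ := hs
  have hs0 := hs.1
  set c : U → ℝ := fun u => -((1 + s) * Real.log (∑ y', tiltWeight W q s u y')) with hc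
  have e1 := condDiv_add_mul_condDiv hp hW hq (hVs s) hs0
  have e2 := condDiv_add_mul_condDiv hp hW hq hV hs0
  have hself : condDiv (tiltChannel W q s) (tiltChannel W q s) p = 0 := by
    refine Finset.sum_eq_zero fun u _ => ?_
    rw [Finset.sum_eq_zero, mul_zero]
    intro y _
    by_cases h0 : tiltChannel W q s u y = 0
    · rw [h0, zero_mul]
    · rw [div_self h0, Real.log_one, mul_zero]
  rw [hself] at e1
  have hle : condDiv V W p + s * (condDiv V (fun _ => q) p - R) ≤ Φ V := by
    simp only [hΦ]
    have h1 := le_max_left (condDiv V (fun _ => q) p - R) 0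
    have h2 := le_max_right (condDiv V (fun _ => q) p - R) 0
    nlinarith [hs.2]
  have hm := hΦmin _ (hVs s)
  rw [hsΦ] at hm
  have hac : ∀ u y, 0 < p u → tiltChannel W q s u y = 0 → V u y = 0 := by
    intro u y hu h0
    refine hV.2 u y hu ?_
    by_contra hw
    exact (tiltChannel_pos hW q s (lt_of_le_of_ne ((hW u).1 y) (Ne.symm hw))).ne' h0
  -- By the completed square, `Φ V` is at least `Φ` of the tilted channel plus `(1 + s)` times this
  -- divergence, while `V` minimises `Φ`. So the divergence vanishes and `V` is the tilted channel
  -- on the support of `p`.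
  have hdiv : condDiv V (tiltChannel W q s) p ≤ 0 := by
    have h3 : (1 + s) * condDiv V (tiltChannel W q s) p ≤ 0 := by
      simp only [hh] at hm
      linarith
    by_contra hcon
    have := mul_pos (by linarith : 0 < 1 + s) (not_le.mp hcon)
    linarith
  have hVeq : ∀ u y, 0 < p u → V u y = tiltChannel W q s u y := fun u y hu =>
    eq_of_condDiv_le_zero hp.1 hV.1 (fun u _ => tiltChannel_mem hW q s u) hac hdiv hu y
  refine ⟨V, s, c, hV.1, hs, fun u y hu hy => ?_, ?_⟩
  · have hv : 0 < V u y := by rw [hVeq u y hu]; exact tiltChannel_pos hW q s hy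
    have hq' := hq u y hu hy
    refine ⟨hv, hq', ?_⟩
    have hl := log_tiltChannel hW hs0 hy hq'
    rw [← hVeq u y hu] at hl
    rw [← Real.exp_log hy, ← Real.exp_add]
    conv_rhs => rw [← Real.exp_log hv, ← Real.exp_add]
    rw [Real.log_div hq'.ne' hv.ne']
    congr 1
    simp only [hc]
    linarith
  · refine (randomCodingExponent_le hp hW hV).trans ?_
    change Φ V ≤ _
    simp only [hh] at hm
    linarith

/-- The competitor `V = W` has zero divergence. -/
lemma randomCodingExponent_le_max {R : ℝ} {p : U → ℝ} (hp : p ∈ stdSimplex ℝ U) {W : U → Y → ℝ}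
    (hW : ∀ u, W u ∈ stdSimplex ℝ Y) :
    randomCodingExponent R p W
      ≤ max (mutualInfo (fun uy : U × Y => p uy.1 * W uy.1 uy.2) Prod.fst Prod.snd - R) 0 := by
  refine (randomCodingExponent_le hp hW ⟨hW, fun _ _ _ h => h⟩).trans ?_
  rw [mutualInfo_channel hp hW, exponentObjective]
  have : condDiv W W p = 0 := by
    refine Finset.sum_eq_zero fun u _ => ?_
    rw [Finset.sum_eq_zero, mul_zero]
    intro y _
    by_cases h0 : W u y = 0
    · rw [h0, zero_mul]
    · rw [div_self h0, Real.log_one, mul_zero]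
  rw [this, zero_add]

/-- Rows outside the support of `p` never enter. This matters because a conditional pmf is
meaningless there. -/
lemma randomCodingExponent_congr (R : ℝ) {p : U → ℝ} (hp : ∀ u, 0 ≤ p u) {W W' : U → Y → ℝ}
    (h : ∀ u, 0 < p u → W u = W' u) : randomCodingExponent R p W = randomCodingExponent R p W' := by
  unfold randomCodingExponent
  congr 1
  ext e
  refine exists_congr fun V => and_congr_right fun _ => and_congr ?_ ?_
  · refine forall_congr' fun u => forall_congr' fun y => forall_congr' fun hu => ?_
    rw [h u hu]
  · have : condDiv V W p = condDiv V W' p := by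
      refine Finset.sum_congr rfl fun u _ => ?_
      rcases (hp u).eq_or_lt with h0 | h0
      · rw [← h0]; simp
      · rw [h u h0]
    rw [this]

end Saddle

/-! ### The method of types. -/

section Types

variable {U : Type*}

/-- Number of occurrences of `u` in the sequence `f`. -/
def occurrences {L : ℕ} (f : Fin L → U) (u : U) : ℕ := Nat.card {i // f i = u}

lemma occurrences_eq {L : ℕ} (f : Fin L → U) (u : U) :
    occurrences f u = (Finset.univ.filter fun i => f i = u).card := by
  rw [occurrences, Nat.card_eq_fintype_card, Fintype.card_subtype]

lemma occurrences_le {L : ℕ} (f : Fin L → U) (u : U) : occurrences f u ≤ L := by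
  rw [occurrences_eq]
  exact (Finset.card_le_univ _).trans (by simp)

/-- Positions carrying the same letter can be matched in the two sequences, and the matchings glue
to a permutation. -/
lemma exists_perm_of_occurrences_eq {L : ℕ} {f g : Fin L → U}
    (h : ∀ u, occurrences f u = occurrences g u) : ∃ σ : Equiv.Perm (Fin L), f ∘ σ = g := by
  have e : ∀ u, Nonempty ({i // g i = u} ≃ {i // f i = u}) := fun u =>
    Finite.card_eq.mp (h u).symm
  let e := fun u => (e u).some
  refine ⟨(Equiv.sigmaFiberEquiv g).symm.trans
    ((Equiv.sigmaCongrRight e).trans (Equiv.sigmaFiberEquiv f)), ?_⟩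
  funext i
  simp only [Function.comp, Equiv.trans_apply]
  exact (e (g i) ⟨i, rfl⟩).2

variable [Fintype U]

lemma prod_eq_prod_pow_occurrences {L : ℕ} (f : Fin L → U) (x : U → ℝ) :
    ∏ i, x (f i) = ∏ u, x u ^ occurrences f u := by
  rw [← Finset.prod_fiberwise_of_maps_to (s := Finset.univ) (t := Finset.univ) (g := f)
    (fun _ _ => Finset.mem_univ _)]
  refine Finset.prod_congr rfl fun u _ => ?_
  rw [Finset.prod_congr rfl (g := fun _ => x u)
    (fun i hi => by rw [(Finset.mem_filter.mp hi).2]), Finset.prod_const, occurrences_eq]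

lemma sum_eq_sum_occurrences_mul {L : ℕ} (f : Fin L → U) (x : U → ℝ) :
    ∑ i, x (f i) = ∑ u, (occurrences f u : ℝ) * x u := by
  rw [← Finset.sum_fiberwise_of_maps_to (s := Finset.univ) (t := Finset.univ) (g := f)
    (fun _ _ => Finset.mem_univ _)]
  refine Finset.sum_congr rfl fun u _ => ?_
  rw [Finset.sum_congr rfl (g := fun _ => x u)
    (fun i hi => by rw [(Finset.mem_filter.mp hi).2]), Finset.sum_const, occurrences_eq,
    nsmul_eq_mul]

lemma sum_occurrences {L : ℕ} (f : Fin L → U) : ∑ u, occurrences f u = L := by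
  have h := sum_eq_sum_occurrences_mul f fun _ => 1
  simp only [Finset.sum_const, Finset.card_univ, Fintype.card_fin, nsmul_eq_mul, mul_one] at h
  exact_mod_cast h.symm

/-- The sequences with the same type as `f`. -/
def typeClass {L : ℕ} (f : Fin L → U) : Finset (Fin L → U) :=
  Finset.univ.filter fun g => ∀ u, occurrences g u = occurrences f u

lemma mem_typeClass {L : ℕ} {f g : Fin L → U} :
    g ∈ typeClass f ↔ ∀ u, occurrences g u = occurrences f u := by
  simp [typeClass]

/-- Orbit counting: permutations of positions act transitively on the type class, and each fibre of
`σ ↦ f ∘ σ` is in bijection with the stabiliser of `f`. -/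
lemma card_typeClass_mul {L : ℕ} (f : Fin L → U) :
    (typeClass f).card * ∏ u, (occurrences f u).factorial = L.factorial := by
  have hmaps : ∀ σ ∈ (Finset.univ : Finset (Equiv.Perm (Fin L))), f ∘ σ ∈ typeClass f := by
    intro σ _
    rw [mem_typeClass]
    intro u
    exact Nat.card_congr (σ.subtypeEquiv fun i => Iff.rfl)
  have hfib : ∀ g ∈ typeClass f,
      (Finset.univ.filter fun σ : Equiv.Perm (Fin L) => f ∘ σ = g).card
        = ∏ u, (occurrences f u).factorial := by
    intro g hg
    obtain ⟨τ, rfl⟩ := exists_perm_of_occurrences_eq fun u => (mem_typeClass.mp hg u).symm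
    rw [← Fintype.card_subtype]
    have hst := DomMulAct.stabilizer_card f
    have : ∏ u, (occurrences f u).factorial = ∏ u, (Fintype.card {a // f a = u}).factorial :=
      Finset.prod_congr rfl fun u _ => by rw [occurrences, Nat.card_eq_fintype_card]
    rw [this, ← hst]
    refine Fintype.card_congr ((Equiv.mulRight τ⁻¹).subtypeEquiv fun σ => ?_)
    constructor
    · intro h
      funext i
      have := congrFun h (τ⁻¹ i)
      simpa using this
    · intro h
      funext i
      have := congrFun h (τ i)
      simpa using this
  have := Finset.card_eq_sum_card_fiberwise hmaps
  rw [Finset.sum_congr rfl hfib, Finset.sum_const, smul_eq_mul] at this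
  rw [← this, Finset.card_univ, Fintype.card_perm, Fintype.card_fin]

/-- In other words `n ^ k / k!` is largest at `k = n`: every factor separating the two factorials is
compared with `n`. -/
lemma pow_mul_factorial_le (n k : ℕ) : n ^ k * n.factorial ≤ n ^ n * k.factorial := by
  rcases le_total n k with h | h
  · have := Nat.factorial_mul_pow_sub_le_factorial h
    calc n ^ k * n.factorial = n ^ n * (n.factorial * n ^ (k - n)) := by
          rw [mul_comm n.factorial, ← mul_assoc, ← pow_add, Nat.add_sub_cancel' h]
      _ ≤ _ := Nat.mul_le_mul_left _ this
  · have h1 := Nat.factorial_mul_descFactorial (Nat.sub_le n k)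
    rw [Nat.sub_sub_self h] at h1
    calc n ^ k * n.factorial = n ^ k * (k.factorial * n.descFactorial (n - k)) := by rw [h1]
      _ ≤ n ^ k * (k.factorial * n ^ (n - k)) := by
          gcongr; exact Nat.descFactorial_le_pow _ _
      _ = _ := by
          rw [mul_comm k.factorial, ← mul_assoc, ← pow_add, Nat.add_sub_cancel' h]

/-- A type class has at least polynomially small probability under its own type. -/
lemma one_le_mul_prob_typeClass {L : ℕ} (hL : 0 < L) (f : Fin L → U) (p : U → ℝ)
    (hp : ∀ u, p u = occurrences f u / L) :
    1 ≤ ((L : ℝ) + 1) ^ Fintype.card U * ∑ g ∈ typeClass f, ∏ i, p (g i) := by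
  have hL' : (0 : ℝ) < L := by exact_mod_cast hL
  have hp0 : ∀ u, 0 ≤ p u := fun u => by rw [hp]; positivity
  have hp1 : ∑ u, p u = 1 := by
    simp_rw [hp, ← Finset.sum_div]
    rw [div_eq_one_iff_eq hL'.ne']
    exact_mod_cast sum_occurrences f
  have hconst : ∀ g : Fin L → U, ∑ h ∈ typeClass g, ∏ i, p (h i)
      = (typeClass g).card * ∏ u, p u ^ occurrences g u := by
    intro g
    rw [Finset.sum_congr rfl (g := fun _ => ∏ u, p u ^ occurrences g u), Finset.sum_const,
      nsmul_eq_mul]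
    intro h hh
    rw [prod_eq_prod_pow_occurrences]
    exact Finset.prod_congr rfl fun u _ => by rw [mem_typeClass.mp hh u]
  -- Under the empirical pmf of `f`, no type class is more probable than that of `f` itself.
  have hmax : ∀ g : Fin L → U, ∑ h ∈ typeClass g, ∏ i, p (h i)
      ≤ ∑ h ∈ typeClass f, ∏ i, p (h i) := by
    intro g
    rw [hconst, hconst]
    have hg : ((typeClass g).card : ℝ) = L.factorial / ∏ u, ((occurrences g u).factorial : ℝ) := by
      rw [eq_div_iff (by positivity)]
      exact_mod_cast card_typeClass_mul g
    have hf : ((typeClass f).card : ℝ) = L.factorial / ∏ u, ((occurrences f u).factorial : ℝ) := by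
      rw [eq_div_iff (by positivity)]
      exact_mod_cast card_typeClass_mul f
    rw [hg, hf, div_mul_eq_mul_div, div_mul_eq_mul_div, div_le_div_iff₀ (by positivity)
      (by positivity), mul_assoc, mul_assoc]
    refine mul_le_mul_of_nonneg_left ?_ (by positivity)
    have hpow : ∀ h : Fin L → U, ∏ u, p u ^ occurrences h u
        = (∏ u, (occurrences f u : ℝ) ^ occurrences h u) / (L : ℝ) ^ L := by
      intro h
      simp_rw [hp, div_pow, Finset.prod_div_distrib]
      rw [Finset.prod_pow_eq_pow_sum, sum_occurrences]
    rw [hpow, hpow, div_mul_eq_mul_div, div_mul_eq_mul_div]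
    refine div_le_div_of_nonneg_right ?_ (by positivity)
    rw [← Finset.prod_mul_distrib, ← Finset.prod_mul_distrib]
    refine Finset.prod_le_prod (fun u _ => by positivity) fun u _ => ?_
    exact_mod_cast pow_mul_factorial_le (occurrences f u) (occurrences g u)
  set Q := ∑ h ∈ typeClass f, ∏ i, p (h i) with hQ
  have hQ0 : 0 ≤ Q := Finset.sum_nonneg fun h _ => Finset.prod_nonneg fun i _ => hp0 _
  calc (1 : ℝ) = ∑ g : Fin L → U, ∏ i, p (g i) := by
        rw [sum_fun_prod fun (_ : Fin L) => p]; simp [hp1]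
    -- A type is a vector of counts in `{0, …, L}`, so there are at most `(L + 1) ^ |U|` classes.
    _ = ∑ k : U → Fin (L + 1), ∑ g ∈ Finset.univ.filter
          (fun g : Fin L → U => (fun u => (⟨occurrences g u,
            Nat.lt_succ_of_le (occurrences_le g u)⟩ : Fin (L + 1))) = k), ∏ i, p (g i) := by
        rw [Finset.sum_fiberwise]
    _ ≤ ∑ _k : U → Fin (L + 1), Q := by
        refine Finset.sum_le_sum fun k _ => ?_
        by_cases hk : ∃ g : Fin L → U, (fun u => (⟨occurrences g u,
            Nat.lt_succ_of_le (occurrences_le g u)⟩ : Fin (L + 1))) = k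
        · obtain ⟨g, rfl⟩ := hk
          refine le_trans (le_of_eq ?_) (hmax g)
          refine Finset.sum_congr ?_ fun _ _ => rfl
          ext h
          simp [mem_typeClass, funext_iff, Fin.ext_iff]
        · rw [Finset.filter_false_of_mem, Finset.sum_empty]
          · exact hQ0
          · exact fun g _ hg => hk ⟨g, hg⟩
    _ = _ := by
        rw [Finset.sum_const, nsmul_eq_mul, Finset.card_univ, Fintype.card_fun, Fintype.card_fin]
        push_cast; ring

end Types

/-! ### The inner code: random coding with constant composition. -/

section InnerCode

variable {U Y Msg : Type*} [Fintype U] [Fintype Y] [Fintype Msg]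

/-- A maximiser of the metric. -/
def argmaxDecoder {Y : Type*} [Nonempty Msg] (Θ : Msg → Y → ℝ) (y : Y) : Msg :=
  (Finite.exists_max fun m => Θ m y).choose

lemma le_argmaxDecoder {Y : Type*} [Nonempty Msg] (Θ : Msg → Y → ℝ) (y : Y) (m : Msg) :
    Θ m y ≤ Θ (argmaxDecoder Θ y) y :=
  (Finite.exists_max fun m => Θ m y).choose_spec m

/-- The pmf `p ^ L` conditioned on the type class of `f`. -/
def typeClassPmf {L : ℕ} (f : Fin L → U) (p : U → ℝ) (g : Fin L → U) : ℝ :=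
  (∏ i, p (g i)) * ind (g ∈ typeClass f) / ∑ h ∈ typeClass f, ∏ i, p (h i)

lemma typeClassPmf_mem {L : ℕ} (hL : 0 < L) {f : Fin L → U} {p : U → ℝ}
    (hp : ∀ u, p u = occurrences f u / L) : typeClassPmf f p ∈ stdSimplex ℝ (Fin L → U) := by
  have h1 := one_le_mul_prob_typeClass hL f p hp
  have hp0 : ∀ u, 0 ≤ p u := fun u => by rw [hp]; positivity
  have hQ0 : 0 ≤ ∑ h ∈ typeClass f, ∏ i, p (h i) :=
    Finset.sum_nonneg fun h _ => Finset.prod_nonneg fun i _ => hp0 _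
  have hQ : 0 < ∑ h ∈ typeClass f, ∏ i, p (h i) := by
    refine lt_of_le_of_ne hQ0 fun h => ?_
    rw [← h] at h1
    norm_num at h1
  refine ⟨fun g => div_nonneg (mul_nonneg (Finset.prod_nonneg fun i _ => hp0 _) (ind_nonneg _))
    hQ0, ?_⟩
  unfold typeClassPmf
  rw [← Finset.sum_div, div_eq_one_iff_eq hQ.ne']
  unfold ind
  simp

/-- Conditioning on the type class costs the inverse of its probability, which is at most polynomial
in `L`. -/
lemma typeClassPmf_le {L : ℕ} (hL : 0 < L) {f : Fin L → U} {p : U → ℝ}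
    (hp : ∀ u, p u = occurrences f u / L) (g : Fin L → U) :
    typeClassPmf f p g ≤ ((L : ℝ) + 1) ^ Fintype.card U * ∏ i, p (g i) := by
  have h1 := one_le_mul_prob_typeClass hL f p hp
  have hp0 : ∀ u, 0 ≤ p u := fun u => by rw [hp]; positivity
  have hQ0 : 0 ≤ ∑ h ∈ typeClass f, ∏ i, p (h i) :=
    Finset.sum_nonneg fun h _ => Finset.prod_nonneg fun i _ => hp0 _
  have hQ : 0 < ∑ h ∈ typeClass f, ∏ i, p (h i) := by
    refine lt_of_le_of_ne hQ0 fun h => ?_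
    rw [← h] at h1
    norm_num at h1
  unfold typeClassPmf
  rw [div_le_iff₀ hQ]
  have hpg : 0 ≤ ∏ i, p (g i) := Finset.prod_nonneg fun i _ => hp0 _
  calc (∏ i, p (g i)) * ind (g ∈ typeClass f) ≤ (∏ i, p (g i)) * 1 :=
        mul_le_mul_of_nonneg_left (ind_le_one _) hpg
    _ ≤ (∏ i, p (g i)) * (((L : ℝ) + 1) ^ Fintype.card U * ∑ h ∈ typeClass f, ∏ i, p (h i)) :=
        mul_le_mul_of_nonneg_left h1 hpg
    _ = _ := by ring

lemma mem_typeClass_of_typeClassPmf_ne_zero {L : ℕ} {f g : Fin L → U} {p : U → ℝ}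
    (h : typeClassPmf f p g ≠ 0) : g ∈ typeClass f := by
  by_contra hg
  exact h (by rw [typeClassPmf, ind_not hg]; simp)

lemma pos_of_mem_typeClass {L : ℕ} {f g : Fin L → U} {p : U → ℝ}
    (hp : ∀ u, p u = occurrences f u / L) (hg : g ∈ typeClass f) (i : Fin L) : 0 < p (g i) := by
  rw [hp, ← mem_typeClass.mp hg (g i), occurrences_eq]
  have h1 : 0 < (Finset.univ.filter fun j => g j = g i).card :=
    Finset.card_pos.mpr ⟨i, by simp⟩
  have h2 : 0 < L := Fin.pos i
  positivity

lemma sum_of_mem_typeClass {L : ℕ} (hL : 0 < L) {f g : Fin L → U} {p : U → ℝ}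
    (hp : ∀ u, p u = occurrences f u / L) (hg : g ∈ typeClass f) (x : U → ℝ) :
    ∑ i, x (g i) = L * ∑ u, p u * x u := by
  have hL' : (L : ℝ) ≠ 0 := by positivity
  rw [sum_eq_sum_occurrences_mul, Finset.mul_sum]
  refine Finset.sum_congr rfl fun u _ => ?_
  rw [hp, mem_typeClass.mp hg u]
  field_simp

/-- One-sided Young inequality used to bound an error event linearly in the number of
confusable codewords. -/
lemma one_le_exp_mul_add {s t x : ℝ} (hs : s ∈ Set.Icc (0 : ℝ) 1) (hx : Real.exp (-t) ≤ x) :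
    1 ≤ Real.exp (s * t) * ((1 - s) + s * x) := by
  -- Convexity of `exp` on the segment from `0` to `-t` plays the role of the power `x ^ s` in
  -- Gallager's bound, and is already linear in `x`.
  have h1 := convexOn_exp.2 (Set.mem_univ (0 : ℝ)) (Set.mem_univ (-t))
    (by linarith [hs.2] : (0 : ℝ) ≤ 1 - s) hs.1 (by ring)
  simp only [smul_eq_mul, mul_zero, zero_add, Real.exp_zero, mul_one] at h1
  have h2 : Real.exp (s * -t) ≤ (1 - s) + s * x :=
    h1.trans (add_le_add le_rfl (mul_le_mul_of_nonneg_left hx hs.1))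
  calc (1 : ℝ) = Real.exp (s * t) * Real.exp (s * -t) := by
        rw [← Real.exp_add, ← mul_add]; simp
    _ ≤ _ := mul_le_mul_of_nonneg_left h2 (Real.exp_pos _).le

/-- Random coding bound for constant composition codes. -/
lemma average_constant_composition_error_le [Nonempty Msg] {L : ℕ} (hL : 0 < L)
    {f : Fin L → U} {p : U → ℝ} (hps : p ∈ stdSimplex ℝ U)
    (hp : ∀ u, p u = occurrences f u / L) {W : U → Y → ℝ}
    (hW : ∀ u, W u ∈ stdSimplex ℝ Y) (R D : ℝ) (hD : 0 ≤ D)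
    (hcard : ((Fintype.card Msg : ℝ) - 1) * ((L : ℝ) + 1) ^ Fintype.card U
      ≤ Real.exp (L * R + D)) :
    ∃ dec : (Msg → Fin L → U) → (Fin L → Y) → Msg, ∀ m,
      ∑ C : Msg → Fin L → U, (∏ m, typeClassPmf f p (C m)) *
        ∑ y : Fin L → Y, (∏ i, W (C m i) (y i)) * ind (dec C y ≠ m)
      ≤ Real.exp (D - L * randomCodingExponent R p W) := by
  obtain ⟨V, s, c, hV, hs, hVW, hE⟩ := exists_tilting R hps hW
  set q := outLaw p V with hq
  have hV0 : ∀ u y, 0 ≤ V u y := fun u => (hV u).1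
  have hq0 : ∀ y, 0 ≤ q y := outLaw_nonneg hps.1 hV0
  set Q := typeClassPmf f p with hQdef
  have hQ := typeClassPmf_mem hL hp
  set N := Real.exp (L * R + D) with hN
  have hN0 : 0 < N := Real.exp_pos _
  set Θ : (Fin L → U) → (Fin L → Y) → ℝ := fun u y => ∏ i, V (u i) (y i) with hΘ
  have hΘ0 : ∀ u y, 0 ≤ Θ u y := fun u y => Finset.prod_nonneg fun i _ => hV0 _ _
  -- `E` is the channel law multiplied by `(N ∏ q / V) ^ s`, the factor that `one_le_exp_mul_add`
  -- produces.
  set E : (Fin L → U) → (Fin L → Y) → ℝ := fun u y =>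
    (∏ i, W (u i) (y i)) *
      Real.exp (s * (L * R + D + ∑ i, Real.log (q (y i) / V (u i) (y i)))) with hEdef
  have hE0 : ∀ u y, 0 ≤ E u y := fun u y =>
    mul_nonneg (Finset.prod_nonneg fun i _ => (hW _).1 _) (Real.exp_pos _).le
  -- Decoding maximises the likelihood under the optimal `V` instead of `W`: the likelihood of a
  -- competing codeword then averages to at most a polynomial times `∏ q`.
  refine ⟨fun C => argmaxDecoder fun m y => Θ (C m) y, fun m => ?_⟩
  -- pointwise bound
  have hpt : ∀ (C : Msg → Fin L → U) (y : Fin L → Y), Q (C m) ≠ 0 →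
      (∏ i, W (C m i) (y i)) * ind (argmaxDecoder (fun m y => Θ (C m) y) y ≠ m)
      ≤ E (C m) y * ((1 - s) + s * ∑ m', if m' ≠ m then Θ (C m') y / (N * ∏ i, q (y i)) else 0) := by
    intro C y hC
    have hmem := mem_typeClass_of_typeClassPmf_ne_zero hC
    have hpos : ∀ i, 0 < p (C m i) := pos_of_mem_typeClass hp hmem
    have hterm : ∀ m', 0 ≤ if m' ≠ m then Θ (C m') y / (N * ∏ i, q (y i)) else 0 := by
      intro m'; split_ifs
      · exact div_nonneg (hΘ0 _ _) (mul_nonneg hN0.le (Finset.prod_nonneg fun i _ => hq0 _))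
      · exact le_rfl
    have hsum0 : 0 ≤ ∑ m', if m' ≠ m then Θ (C m') y / (N * ∏ i, q (y i)) else 0 :=
      Finset.sum_nonneg fun m' _ => hterm m'
    have hrhs : 0 ≤ E (C m) y *
        ((1 - s) + s * ∑ m', if m' ≠ m then Θ (C m') y / (N * ∏ i, q (y i)) else 0) :=
      mul_nonneg (hE0 _ _) (add_nonneg (by linarith [hs.2]) (mul_nonneg hs.1 hsum0))
    by_cases hdec : argmaxDecoder (fun m y => Θ (C m) y) y = m
    · rw [ind_not (not_not.mpr hdec), mul_zero]; exact hrhs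
    rw [ind_of hdec, mul_one]
    by_cases hw : ∀ i, 0 < W (C m i) (y i)
    swap
    · push Not at hw
      obtain ⟨i, hi⟩ := hw
      rw [Finset.prod_eq_zero (Finset.mem_univ i) (le_antisymm hi ((hW _).1 _))]
      exact hrhs
    have hv : ∀ i, 0 < V (C m i) (y i) := fun i => (hVW _ _ (hpos i) (hw i)).1
    have hqp : ∀ i, 0 < q (y i) := fun i => (hVW _ _ (hpos i) (hw i)).2.1
    set t := L * R + D + ∑ i, Real.log (q (y i) / V (C m i) (y i)) with ht
    have hexpt : Real.exp (-t) = Θ (C m) y / (N * ∏ i, q (y i)) := by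
      have h1 : ∑ i, Real.log (q (y i) / V (C m i) (y i))
          = Real.log ((∏ i, q (y i)) / Θ (C m) y) := by
        rw [hΘ, ← Finset.prod_div_distrib,
          Real.log_prod fun i _ => (div_pos (hqp i) (hv i)).ne']
      have hΘp : 0 < Θ (C m) y := Finset.prod_pos fun i _ => hv i
      have hqpp : 0 < ∏ i, q (y i) := Finset.prod_pos fun i _ => hqp i
      rw [Real.exp_neg, ht, h1, Real.exp_add, Real.exp_log (div_pos hqpp hΘp), ← hN]
      field_simp
    have hx : Real.exp (-t) ≤ ∑ m', if m' ≠ m then Θ (C m') y / (N * ∏ i, q (y i)) else 0 := by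
      rw [hexpt]
      have h1 := Finset.single_le_sum (f := fun m' => if m' ≠ m then
        Θ (C m') y / (N * ∏ i, q (y i)) else 0) (fun m' _ => hterm m')
        (Finset.mem_univ (argmaxDecoder (fun m y => Θ (C m) y) y))
      simp only [ne_eq, hdec, not_false_eq_true, if_true] at h1
      refine le_trans ?_ h1
      refine div_le_div_of_nonneg_right (le_argmaxDecoder (fun m y => Θ (C m) y) y m) ?_
      exact mul_nonneg hN0.le (Finset.prod_nonneg fun i _ => hq0 _)
    have := one_le_exp_mul_add hs hx
    calc ∏ i, W (C m i) (y i) = (∏ i, W (C m i) (y i)) * 1 := (mul_one _).symm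
      _ ≤ (∏ i, W (C m i) (y i)) * (Real.exp (s * t) *
            ((1 - s) + s * ∑ m', if m' ≠ m then Θ (C m') y / (N * ∏ i, q (y i)) else 0)) :=
          mul_le_mul_of_nonneg_left this (Finset.prod_nonneg fun i _ => (hW _).1 _)
      _ = _ := by simp only [hEdef, ht]; ring
  -- average over the codebook for a fixed output
  have havg : ∀ y : Fin L → Y, ∑ C : Msg → Fin L → U, (∏ m, Q (C m)) *
      ((∏ i, W (C m i) (y i)) * ind (argmaxDecoder (fun m y => Θ (C m) y) y ≠ m))
      ≤ ∑ u, Q u * E u y := by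
    intro y
    have hQsum : ∑ u, Q u * Θ u y ≤ ((L : ℝ) + 1) ^ Fintype.card U * ∏ i, q (y i) := by
      calc ∑ u, Q u * Θ u y
          ≤ ∑ u : Fin L → U, (((L : ℝ) + 1) ^ Fintype.card U * ∏ i, p (u i)) * Θ u y :=
            Finset.sum_le_sum fun u _ => mul_le_mul_of_nonneg_right (typeClassPmf_le hL hp u)
              (hΘ0 u y)
        _ = ((L : ℝ) + 1) ^ Fintype.card U * ∑ u : Fin L → U, ∏ i, p (u i) * V (u i) (y i) := by
            rw [Finset.mul_sum]
            refine Finset.sum_congr rfl fun u _ => ?_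
            rw [Finset.prod_mul_distrib]; ring
        _ = _ := by
            rw [sum_fun_prod fun i u => p u * V u (y i)]; rfl
    calc _ ≤ ∑ C : Msg → Fin L → U, (∏ m, Q (C m)) * (E (C m) y *
          ((1 - s) + s * ∑ m', if m' ≠ m then Θ (C m') y / (N * ∏ i, q (y i)) else 0)) := by
          refine Finset.sum_le_sum fun C _ => ?_
          by_cases hC : Q (C m) = 0
          · rw [Finset.prod_eq_zero (Finset.mem_univ m) hC]; simp
          · exact mul_le_mul_of_nonneg_left (hpt C y hC)
              (Finset.prod_nonneg fun m _ => hQ.1 _)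
      _ = (1 - s) * ∑ u, Q u * E u y + ∑ m', if m' ≠ m then
            (∑ u, ∑ u', Q u * (Q u' * (s * E u y * (Θ u' y / (N * ∏ i, q (y i)))))) else 0 := by
          have h1 : ∀ C : Msg → Fin L → U, (∏ m, Q (C m)) * (E (C m) y *
              ((1 - s) + s * ∑ m', if m' ≠ m then Θ (C m') y / (N * ∏ i, q (y i)) else 0))
              = (1 - s) * ((∏ m, Q (C m)) * E (C m) y) + ∑ m', (∏ m, Q (C m)) *
                (if m' ≠ m then s * E (C m) y * (Θ (C m') y / (N * ∏ i, q (y i))) else 0) := by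
            intro C
            rw [mul_add, mul_add, Finset.mul_sum, Finset.mul_sum, Finset.mul_sum]
            congr 1
            · ring
            · refine Finset.sum_congr rfl fun m' _ => ?_
              split_ifs <;> ring
          simp_rw [h1, Finset.sum_add_distrib]
          congr 1
          · rw [← Finset.mul_sum,
              sum_fun_prod_mul (fun _ : Msg => Q) (fun _ => hQ.2) m fun u => E u y]
          · rw [Finset.sum_comm]
            refine Finset.sum_congr rfl fun m' _ => ?_
            by_cases hm : m' = m
            · simp [hm]
            · simp only [ne_eq, hm, not_false_eq_true, if_true]
              exact sum_fun_prod_mul_pair (fun _ : Msg => Q) (fun _ => hQ.2) (Ne.symm hm)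
                fun u u' => s * E u y * (Θ u' y / (N * ∏ i, q (y i)))
      _ = (1 - s) * ∑ u, Q u * E u y + ((Fintype.card Msg : ℝ) - 1) *
            (s * (∑ u, Q u * E u y) * ((∑ u', Q u' * Θ u' y) / (N * ∏ i, q (y i)))) := by
          congr 1
          have h2 : ∑ u, ∑ u', Q u * (Q u' * (s * E u y * (Θ u' y / (N * ∏ i, q (y i)))))
              = s * (∑ u, Q u * E u y) * ((∑ u', Q u' * Θ u' y) / (N * ∏ i, q (y i))) := by
            rw [Finset.sum_div, mul_assoc, Finset.sum_mul_sum, Finset.mul_sum]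
            refine Finset.sum_congr rfl fun u _ => ?_
            rw [Finset.mul_sum]
            exact Finset.sum_congr rfl fun u' _ => by ring
          rw [h2, ← Finset.sum_filter, Finset.sum_const, nsmul_eq_mul, Finset.filter_ne',
            Finset.card_erase_of_mem (Finset.mem_univ m), Finset.card_univ,
            Nat.cast_sub Fintype.card_pos, Nat.cast_one]
      _ ≤ (1 - s) * ∑ u, Q u * E u y + s * ∑ u, Q u * E u y := by
          have hT0 : 0 ≤ ∑ u, Q u * E u y :=
            Finset.sum_nonneg fun u _ => mul_nonneg (hQ.1 u) (hE0 u y)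
          have hqn : 0 ≤ ∏ i, q (y i) := Finset.prod_nonneg fun i _ => hq0 _
          have hM1 : (0 : ℝ) ≤ (Fintype.card Msg : ℝ) - 1 := by
            have : (1 : ℝ) ≤ Fintype.card Msg := by exact_mod_cast Fintype.card_pos
            linarith
          -- The bound on the number of messages enters here: the mean of the competitors' term is
          -- at most one, so the weights `1 - s` and `s` recombine to `1`.
          have hfrac : ((Fintype.card Msg : ℝ) - 1) *
              ((∑ u', Q u' * Θ u' y) / (N * ∏ i, q (y i))) ≤ 1 := by
            rw [← mul_div_assoc]
            refine div_le_one_of_le₀ ?_ (mul_nonneg hN0.le hqn)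
            calc ((Fintype.card Msg : ℝ) - 1) * ∑ u', Q u' * Θ u' y
                ≤ ((Fintype.card Msg : ℝ) - 1) *
                  (((L : ℝ) + 1) ^ Fintype.card U * ∏ i, q (y i)) :=
                  mul_le_mul_of_nonneg_left hQsum hM1
              _ = (((Fintype.card Msg : ℝ) - 1) * ((L : ℝ) + 1) ^ Fintype.card U)
                  * ∏ i, q (y i) := by ring
              _ ≤ _ := mul_le_mul_of_nonneg_right hcard hqn
          have := mul_le_mul_of_nonneg_left hfrac (mul_nonneg hs.1 hT0)
          linarith
      _ = _ := by ring
  -- sum over the outputs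
  have hsumE : ∀ u, Q u * ∑ y, E u y ≤ Q u * Real.exp (D - L * randomCodingExponent R p W) := by
    intro u
    by_cases hu : Q u = 0
    · simp [hu]
    have hmem := mem_typeClass_of_typeClassPmf_ne_zero hu
    have hpos : ∀ i, 0 < p (u i) := pos_of_mem_typeClass hp hmem
    refine mul_le_mul_of_nonneg_left ?_ (hQ.1 u)
    have h1 : ∀ y : Fin L → Y, E u y = Real.exp (s * (L * R + D)) *
        ∏ i, (W (u i) (y i) * Real.exp (s * Real.log (q (y i) / V (u i) (y i)))) := by
      intro y
      simp only [hEdef]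
      rw [Finset.prod_mul_distrib, ← Real.exp_sum, ← Finset.mul_sum, mul_add, Real.exp_add]
      ring
    simp_rw [h1]
    rw [← Finset.mul_sum, sum_fun_prod fun i y =>
      W (u i) y * Real.exp (s * Real.log (q y / V (u i) y))]
    have h2 : ∏ i, ∑ y, W (u i) y * Real.exp (s * Real.log (q y / V (u i) y))
        ≤ ∏ i, Real.exp (-c (u i)) := by
      refine Finset.prod_le_prod (fun i _ => Finset.sum_nonneg fun y _ =>
        mul_nonneg ((hW _).1 _) (Real.exp_pos _).le) fun i _ => ?_
      calc ∑ y, W (u i) y * Real.exp (s * Real.log (q y / V (u i) y))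
          ≤ ∑ y, V (u i) y * Real.exp (-c (u i)) := by
            refine Finset.sum_le_sum fun y _ => ?_
            rcases ((hW (u i)).1 y).eq_or_lt with h | h
            · rw [← h, zero_mul]; exact mul_nonneg (hV0 _ _) (Real.exp_pos _).le
            · exact (hVW _ _ (hpos i) h).2.2.le
        _ = _ := by rw [← Finset.sum_mul, (hV _).2, one_mul]
    -- For a codeword of type `p` the sum of `c (u i)` is `L ∑ p u * c u`, whatever the codeword, so
    -- the dual bound applies to each one.
    refine (mul_le_mul_of_nonneg_left h2 (Real.exp_pos _).le).trans ?_
    rw [← Real.exp_sum, ← Real.exp_add, Real.exp_le_exp, Finset.sum_neg_distrib,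
      sum_of_mem_typeClass hL hp hmem]
    have hL0 : (0 : ℝ) ≤ L := by positivity
    have h3 := mul_le_mul_of_nonneg_left hE hL0
    have h4 : s * D ≤ D := mul_le_of_le_one_left hD hs.2
    nlinarith
  calc _ = ∑ y : Fin L → Y, ∑ C : Msg → Fin L → U, (∏ m, Q (C m)) *
      ((∏ i, W (C m i) (y i)) * ind (argmaxDecoder (fun m y => Θ (C m) y) y ≠ m)) := by
        simp_rw [Finset.mul_sum]
        rw [Finset.sum_comm]
    _ ≤ ∑ y : Fin L → Y, ∑ u, Q u * E u y := Finset.sum_le_sum fun y _ => havg y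
    _ = ∑ u, Q u * ∑ y, E u y := by
        rw [Finset.sum_comm]
        simp_rw [Finset.mul_sum]
    _ ≤ ∑ u, Q u * Real.exp (D - L * randomCodingExponent R p W) :=
        Finset.sum_le_sum fun u _ => hsumE u
    _ = _ := by rw [← Finset.sum_mul, hQ.2, one_mul]

/-- A constant composition code that is good for two channels simultaneously. -/
theorem exists_constant_composition_code {Y₁ Y₂ : Type*} [Fintype Y₁] [Fintype Y₂]
    [Nonempty Msg] {L : ℕ} (hL : 0 < L)
    {f : Fin L → U} {p : U → ℝ} (hps : p ∈ stdSimplex ℝ U)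
    (hp : ∀ u, p u = occurrences f u / L) {W₁ : U → Y₁ → ℝ} (hW₁ : ∀ u, W₁ u ∈ stdSimplex ℝ Y₁)
    {W₂ : U → Y₂ → ℝ} (hW₂ : ∀ u, W₂ u ∈ stdSimplex ℝ Y₂) (R D : ℝ) (hD : 0 ≤ D)
    (hcard : ((Fintype.card Msg : ℝ) - 1) * ((L : ℝ) + 1) ^ Fintype.card U
      ≤ Real.exp (L * R + D)) (pM : Msg → ℝ) (hpM : pM ∈ stdSimplex ℝ Msg) :
    ∃ (C : Msg → Fin L → U) (d₁ : (Fin L → Y₁) → Msg) (d₂ : (Fin L → Y₂) → Msg),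
      (∀ m, C m ∈ typeClass f) ∧
      (∑ m, pM m * ∑ y : Fin L → Y₁, (∏ i, W₁ (C m i) (y i)) * ind (d₁ y ≠ m))
        + (∑ m, pM m * ∑ y : Fin L → Y₂, (∏ i, W₂ (C m i) (y i)) * ind (d₂ y ≠ m))
      ≤ Real.exp (D - L * randomCodingExponent R p W₁)
        + Real.exp (D - L * randomCodingExponent R p W₂) := by
  obtain ⟨dec₁, hd₁⟩ := average_constant_composition_error_le (Msg := Msg) hL hps hp hW₁ R D hD hcard
  obtain ⟨dec₂, hd₂⟩ := average_constant_composition_error_le (Msg := Msg) hL hps hp hW₂ R D hD hcard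
  have hQ := typeClassPmf_mem hL hp
  set w : (Msg → Fin L → U) → ℝ := fun C => ∏ m, typeClassPmf f p (C m) with hw
  set e₁ : (Msg → Fin L → U) → Msg → ℝ := fun C m =>
    ∑ y : Fin L → Y₁, (∏ i, W₁ (C m i) (y i)) * ind (dec₁ C y ≠ m) with he₁
  set e₂ : (Msg → Fin L → U) → Msg → ℝ := fun C m =>
    ∑ y : Fin L → Y₂, (∏ i, W₂ (C m i) (y i)) * ind (dec₂ C y ≠ m) with he₂
  have hswap : ∀ (e : (Msg → Fin L → U) → Msg → ℝ) (b : ℝ), (∀ m, ∑ C, w C * e C m ≤ b) →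
      ∑ C, w C * ∑ m, pM m * e C m ≤ b := by
    intro e b he
    calc ∑ C, w C * ∑ m, pM m * e C m = ∑ m, pM m * ∑ C, w C * e C m := by
          simp_rw [Finset.mul_sum]
          rw [Finset.sum_comm]
          exact Finset.sum_congr rfl fun m _ => Finset.sum_congr rfl fun C _ => by ring
      _ ≤ ∑ m, pM m * b :=
          Finset.sum_le_sum fun m _ => mul_le_mul_of_nonneg_left (he m) (hpM.1 m)
      _ = b := by rw [← Finset.sum_mul, hpM.2, one_mul]
  have hwm : w ∈ stdSimplex ℝ (Msg → Fin L → U) :=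
    ⟨fun C => Finset.prod_nonneg fun m _ => hQ.1 _, sum_fun_prod_eq_one _ fun _ => hQ.2⟩
  -- Positive weight of the chosen codebook is needed as well as a small error: it puts every
  -- codeword in the type class.
  obtain ⟨C, hC, hle⟩ := exists_pos_le_of_average_le w
    (fun C => (∑ m, pM m * e₁ C m) + ∑ m, pM m * e₂ C m) hwm
    (c := Real.exp (D - L * randomCodingExponent R p W₁)
        + Real.exp (D - L * randomCodingExponent R p W₂)) (by
      simp_rw [mul_add]
      rw [Finset.sum_add_distrib]
      exact add_le_add (hswap e₁ _ hd₁) (hswap e₂ _ hd₂))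
  refine ⟨C, dec₁ C, dec₂ C, fun m => ?_, hle⟩
  exact mem_typeClass_of_typeClassPmf_ne_zero (p := p)
    (Finset.prod_ne_zero_iff.mp hC.ne' m (Finset.mem_univ m))

end InnerCode

/-! ### Typical sequences of the common part. -/

section Typicality

variable {K : Type*} [Fintype K]

lemma exists_eq_minPosProb {p : K → ℝ} (hp : p ∈ stdSimplex ℝ K) :
    ∃ a, 0 < p a ∧ p a = minPosProb p := by
  have hne : {x | 0 < x ∧ ∃ a, p a = x}.Nonempty := by
    by_contra hn
    rw [Set.not_nonempty_iff_eq_empty] at hn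
    have h0 : ∀ a, p a = 0 := fun a => by
      by_contra ha
      have : p a ∈ {x | 0 < x ∧ ∃ a, p a = x} :=
        ⟨lt_of_le_of_ne (hp.1 a) (Ne.symm ha), a, rfl⟩
      rw [hn] at this
      exact this
    have := hp.2
    simp [h0] at this
  have hfin : {x | 0 < x ∧ ∃ a, p a = x}.Finite :=
    (Set.finite_range p).subset fun x hx => hx.2
  obtain ⟨hpos, a, ha⟩ := hne.csInf_mem hfin
  exact ⟨a, by rw [ha]; exact hpos, ha⟩

lemma minPosProb_pos {p : K → ℝ} (hp : p ∈ stdSimplex ℝ K) : 0 < minPosProb p := by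
  obtain ⟨a, ha, he⟩ := exists_eq_minPosProb hp
  rwa [← he]

lemma minPosProb_le {p : K → ℝ} {a : K} (ha : 0 < p a) : minPosProb p ≤ p a :=
  csInf_le ⟨0, fun _ hx => hx.1.le⟩ ⟨ha, a, rfl⟩

lemma le_one_of_mem_stdSimplex {p : K → ℝ} (hp : p ∈ stdSimplex ℝ K) (a : K) : p a ≤ 1 := by
  rw [← hp.2]
  exact Finset.single_le_sum (fun b _ => hp.1 b) (Finset.mem_univ a)

/-- Either the pmf is deterministic or its least positive value is at most `1 / 2`. -/
lemma minPosProb_eq_one_or_le_half {p : K → ℝ} (hp : p ∈ stdSimplex ℝ K) :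
    minPosProb p = 1 ∨ minPosProb p ≤ 1 / 2 := by
  obtain ⟨a, ha, he⟩ := exists_eq_minPosProb hp
  by_cases hb : ∃ b, b ≠ a ∧ 0 < p b
  · right
    obtain ⟨b, hba, hb⟩ := hb
    have h1 := minPosProb_le hb
    have h2 : p a + p b ≤ 1 := by
      rw [← hp.2, ← Finset.sum_pair hba.symm]
      exact Finset.sum_le_sum_of_subset_of_nonneg (Finset.subset_univ _) fun i _ _ => hp.1 i
    linarith
  · left
    push Not at hb
    rw [← he, ← hp.2]
    exact (Finset.sum_eq_single a (fun b _ hba => le_antisymm (hb b hba) (hp.1 b))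
      (by simp)).symm

/-- The pmf entropy is at least the contribution of the least likely symbol. -/
lemma minPosProb_mul_log_le {p : K → ℝ} (hp : p ∈ stdSimplex ℝ K) :
    minPosProb p * -Real.log (minPosProb p) ≤ ∑ a, Real.negMulLog (p a) := by
  obtain ⟨a, ha, he⟩ := exists_eq_minPosProb hp
  rw [← he]
  have := Finset.single_le_sum (f := fun a => Real.negMulLog (p a))
    (fun b _ => Real.negMulLog_nonneg (hp.1 b) (le_one_of_mem_stdSimplex hp b))
    (Finset.mem_univ a)
  simp only [Real.negMulLog] at this ⊢
  linarith

/-- Sequences whose probability is at least `exp (-L (1 + δ) H)`. -/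
def typicalSet (p : K → ℝ) (δ : ℝ) (L : ℕ) : Finset (Fin L → K) :=
  Finset.univ.filter fun k =>
    Real.exp (-(L * ((1 + δ) * ∑ a, Real.negMulLog (p a)))) ≤ ∏ i, p (k i)

lemma mem_typicalSet {p : K → ℝ} {δ : ℝ} {L : ℕ} {k : Fin L → K} : k ∈ typicalSet p δ L ↔
    Real.exp (-(L * ((1 + δ) * ∑ a, Real.negMulLog (p a)))) ≤ ∏ i, p (k i) := by
  simp [typicalSet]

/-- Every member has at least the threshold probability and the total is at most one. -/
lemma card_typicalSet_le {p : K → ℝ} (hp : p ∈ stdSimplex ℝ K) (δ : ℝ) (L : ℕ) :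
    ((typicalSet p δ L).card : ℝ) ≤ Real.exp (L * ((1 + δ) * ∑ a, Real.negMulLog (p a))) := by
  set x := L * ((1 + δ) * ∑ a, Real.negMulLog (p a)) with hx
  have h1 : ((typicalSet p δ L).card : ℝ) * Real.exp (-x) ≤ 1 := by
    calc ((typicalSet p δ L).card : ℝ) * Real.exp (-x)
        = ∑ k ∈ typicalSet p δ L, Real.exp (-x) := by rw [Finset.sum_const, nsmul_eq_mul]
      _ ≤ ∑ k ∈ typicalSet p δ L, ∏ i, p (k i) :=
          Finset.sum_le_sum fun k hk => mem_typicalSet.mp hk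
      _ ≤ ∑ k : Fin L → K, ∏ i, p (k i) :=
          Finset.sum_le_sum_of_subset_of_nonneg (Finset.subset_univ _) fun k _ _ =>
            Finset.prod_nonneg fun i _ => hp.1 _
      _ = 1 := sum_fun_prod_eq_one (fun _ => p) fun _ => hp.2
  have h2 := mul_le_mul_of_nonneg_right h1 (Real.exp_pos x).le
  rwa [mul_assoc, ← Real.exp_add, neg_add_cancel, Real.exp_zero, mul_one, one_mul] at h2

/-- Chernoff bound for the self-information of a pmf. -/
lemma prob_not_typical_le_exp {p : K → ℝ} (hp : p ∈ stdSimplex ℝ K) (δ : ℝ) (L : ℕ)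
    {r z : ℝ} (hr : 0 < r) (hpr : ∀ a, 0 < p a → -Real.log (p a) ≤ r) (hz : z ∈ Set.Icc (0 : ℝ) 1) :
    ∑ k : Fin L → K, (∏ i, p (k i)) * ind (k ∉ typicalSet p δ L)
      ≤ Real.exp (-(L * ((∑ a, Real.negMulLog (p a)) / r * (δ * z - z ^ 2)))) := by
  set H := ∑ a, Real.negMulLog (p a) with hH
  have hH0 : 0 ≤ H := Finset.sum_nonneg fun a _ =>
    Real.negMulLog_nonneg (hp.1 a) (le_one_of_mem_stdSimplex hp a)
  set c := (1 + δ) * H with hc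
  have hpt : ∀ k : Fin L → K, (∏ i, p (k i)) * ind (k ∉ typicalSet p δ L)
      ≤ ∏ i, p (k i) * Real.exp (z / r * (-Real.log (p (k i)) - c)) := by
    intro k
    have hrhs : 0 ≤ ∏ i, p (k i) * Real.exp (z / r * (-Real.log (p (k i)) - c)) :=
      Finset.prod_nonneg fun i _ => mul_nonneg (hp.1 _) (Real.exp_pos _).le
    by_cases hk : k ∈ typicalSet p δ L
    · rw [ind_not (not_not.mpr hk), mul_zero]; exact hrhs
    by_cases h0 : ∀ i, 0 < p (k i)
    swap
    · push Not at h0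
      obtain ⟨i, hi⟩ := h0
      rw [Finset.prod_eq_zero (Finset.mem_univ i) (le_antisymm hi (hp.1 _)), zero_mul]
      exact hrhs
    rw [ind_of hk, mul_one, Finset.prod_mul_distrib, ← Real.exp_sum, ← Finset.mul_sum]
    refine le_mul_of_one_le_right (Finset.prod_nonneg fun i _ => hp.1 _) ?_
    rw [mem_typicalSet, not_le, ← hH] at hk
    rw [Real.one_le_exp_iff]
    refine mul_nonneg (div_nonneg hz.1 hr.le) ?_
    have h1 := Real.log_lt_log (Finset.prod_pos fun i _ => h0 i) hk
    rw [Real.log_exp, Real.log_prod fun i _ => (h0 i).ne'] at h1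
    rw [Finset.sum_sub_distrib, Finset.sum_neg_distrib, Finset.sum_const, Finset.card_univ,
      Fintype.card_fin, nsmul_eq_mul]
    linarith
  have hone : ∑ a, p a * Real.exp (z / r * (-Real.log (p a) - c))
      ≤ Real.exp (-(H / r * (δ * z - z ^ 2))) := by
    have h1 : ∀ a, p a * Real.exp (z / r * (-Real.log (p a) - c))
        ≤ Real.exp (-(z / r * c)) * (p a + (Real.exp z - 1) / r * Real.negMulLog (p a)) := by
      intro a
      rcases (hp.1 a).eq_or_lt with h | h
      · rw [← h]; simp
      have hx0 : 0 ≤ -Real.log (p a) := by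
        have := Real.log_nonpos (hp.1 a) (le_one_of_mem_stdSimplex hp a)
        linarith
      have hx1 := hpr a h
      set x := -Real.log (p a) with hx
      -- The self-information lies in `[0, r]`, so the exponential is below its chord there and its
      -- mean involves only the entropy.
      have hcv := convexOn_exp.2 (Set.mem_univ (0 : ℝ)) (Set.mem_univ z)
        (by rw [sub_nonneg]; exact div_le_one_of_le₀ hx1 hr.le : (0 : ℝ) ≤ 1 - x / r)
        (div_nonneg hx0 hr.le) (by ring)
      simp only [smul_eq_mul, mul_zero, zero_add, Real.exp_zero, mul_one] at hcv
      have h2 : Real.exp (z / r * (x - c)) = Real.exp (-(z / r * c)) * Real.exp (x / r * z) := by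
        rw [← Real.exp_add]; congr 1; ring
      have h3 : Real.negMulLog (p a) = p a * x := by rw [Real.negMulLog, hx]; ring
      rw [h2, h3]
      have h4 : p a * (Real.exp (-(z / r * c)) * Real.exp (x / r * z))
          ≤ p a * (Real.exp (-(z / r * c)) * (1 - x / r + x / r * Real.exp z)) := by gcongr
      refine h4.trans_eq ?_
      ring
    have h5 : Real.exp z - 1 ≤ z + z ^ 2 := by
      have := (abs_le.mp (Real.abs_exp_sub_one_sub_id_le (x := z)
        (by rw [abs_of_nonneg hz.1]; exact hz.2))).2
      linarith
    calc ∑ a, p a * Real.exp (z / r * (-Real.log (p a) - c))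
        ≤ ∑ a, Real.exp (-(z / r * c)) * (p a + (Real.exp z - 1) / r * Real.negMulLog (p a)) :=
          Finset.sum_le_sum fun a _ => h1 a
      _ = Real.exp (-(z / r * c)) * ((Real.exp z - 1) * (H / r) + 1) := by
          rw [← Finset.mul_sum, Finset.sum_add_distrib, hp.2, ← Finset.mul_sum, ← hH]
          ring
      _ ≤ Real.exp (-(z / r * c)) * ((z + z ^ 2) * (H / r) + 1) := by gcongr
      _ ≤ Real.exp (-(z / r * c)) * Real.exp ((z + z ^ 2) * (H / r)) := by
          gcongr
          exact Real.add_one_le_exp _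
      _ = _ := by
          rw [← Real.exp_add, hc]
          congr 1
          ring
  calc ∑ k : Fin L → K, (∏ i, p (k i)) * ind (k ∉ typicalSet p δ L)
      ≤ ∑ k : Fin L → K, ∏ i, p (k i) * Real.exp (z / r * (-Real.log (p (k i)) - c)) :=
        Finset.sum_le_sum fun k _ => hpt k
    _ = (∑ a, p a * Real.exp (z / r * (-Real.log (p a) - c))) ^ L := by
        rw [sum_fun_prod fun _ a => p a * Real.exp (z / r * (-Real.log (p a) - c))]
        simp
    _ ≤ (Real.exp (-(H / r * (δ * z - z ^ 2)))) ^ L := by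
        refine pow_le_pow_left₀ (Finset.sum_nonneg fun a _ =>
          mul_nonneg (hp.1 _) (Real.exp_pos _).le) hone L
    _ = _ := by rw [← Real.exp_nat_mul]; congr 1; ring

/-- The atypical sequences of length at least `4 l` have probability at most
`exp (-2 δ² p_K(a*)² l)`. -/
lemma prob_not_typical_le {p : K → ℝ} (hp : p ∈ stdSimplex ℝ K) {δ : ℝ} (hδ : 0 < δ) {L l : ℕ}
    (hL : 4 * l ≤ L) :
    ∑ k : Fin L → K, (∏ i, p (k i)) * ind (k ∉ typicalSet p δ L)
      ≤ Real.exp (-2 * δ ^ 2 * minPosProb p ^ 2 * l) := by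
  set μ := minPosProb p with hμ
  have hμ0 : 0 < μ := minPosProb_pos hp
  set H := ∑ a, Real.negMulLog (p a) with hH
  have hHμ : μ * -Real.log μ ≤ H := minPosProb_mul_log_le hp
  have hHr : ∀ a, 0 < p a → -Real.log (p a) ≤ -Real.log μ := fun a ha =>
    neg_le_neg (Real.log_le_log hμ0 (minPosProb_le ha))
  -- If even the rarest letter has self-information at most `(1 + δ) H`, every sequence of positive
  -- probability is typical.
  have htriv : -Real.log μ ≤ (1 + δ) * H →
      ∑ k : Fin L → K, (∏ i, p (k i)) * ind (k ∉ typicalSet p δ L) ≤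
        Real.exp (-2 * δ ^ 2 * μ ^ 2 * l) := by
    intro hle
    refine le_trans (le_of_eq ?_) (Real.exp_pos _).le
    refine Finset.sum_eq_zero fun k _ => ?_
    by_cases h0 : ∀ i, 0 < p (k i)
    swap
    · push Not at h0
      obtain ⟨i, hi⟩ := h0
      rw [Finset.prod_eq_zero (Finset.mem_univ i) (le_antisymm hi (hp.1 _)), zero_mul]
    rw [ind_not, mul_zero]
    rw [not_not, mem_typicalSet, ← Real.le_log_iff_exp_le (Finset.prod_pos fun i _ => h0 i),
      Real.log_prod fun i _ => (h0 i).ne']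
    calc -((L : ℝ) * ((1 + δ) * H)) = ∑ i : Fin L, -((1 + δ) * H) := by simp
      _ ≤ _ := Finset.sum_le_sum fun i _ => by linarith [hHr _ (h0 i)]
  by_cases hle : -Real.log μ ≤ (1 + δ) * H
  · exact htriv hle
  push Not at hle
  have hL' : (4 : ℝ) * l ≤ L := by exact_mod_cast hL
  have hH0 : 0 ≤ H := Finset.sum_nonneg fun a _ =>
    Real.negMulLog_nonneg (hp.1 a) (le_one_of_mem_stdSimplex hp a)
  set r := -Real.log μ with hr
  have hr0 : 0 < r := lt_of_le_of_lt (by positivity) hle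
  have hμ2 : μ ≤ 1 / 2 := by
    rcases minPosProb_eq_one_or_le_half hp with h | h
    · rw [hr, hμ, h, Real.log_one, neg_zero] at hr0
      exact absurd hr0 (lt_irrefl _)
    · exact h
  have hμh : μ ≤ H / r := by rw [le_div_iff₀ hr0]; exact hHμ
  have hδμ : (1 + δ) * μ < 1 := by
    have : (1 + δ) * μ * r < 1 * r := by nlinarith
    exact lt_of_mul_lt_mul_right this hr0.le
  -- The parabola `δ z - z²` peaks at `δ / 2`; when that exceeds `1` the endpoint is used. The two
  -- cases rest on `μ ≤ 1 / 2` and on `δ μ < 1` respectively.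
  have hz : ∃ z ∈ Set.Icc (0 : ℝ) 1, δ ^ 2 * μ ^ 2 / 2 ≤ μ * (δ * z - z ^ 2) ∧
      0 ≤ δ * z - z ^ 2 := by
    rcases le_or_gt δ 2 with h | h
    · refine ⟨δ / 2, ⟨by positivity, by linarith⟩, ?_, by nlinarith⟩
      have : δ ^ 2 * μ * μ ≤ δ ^ 2 * μ * (1 / 2) := mul_le_mul_of_nonneg_left hμ2 (by positivity)
      nlinarith
    · refine ⟨1, ⟨by norm_num, le_rfl⟩, ?_, by linarith⟩
      have h1 : δ * μ * (δ * μ) ≤ δ * μ * 1 := mul_le_mul_of_nonneg_left (by nlinarith)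
        (by positivity)
      nlinarith
  obtain ⟨z, hz, h1, h2⟩ := hz
  refine (prob_not_typical_le_exp hp δ L hr0 hHr hz).trans ?_
  rw [Real.exp_le_exp]
  have h3 : δ ^ 2 * μ ^ 2 / 2 ≤ H / r * (δ * z - z ^ 2) :=
    h1.trans (mul_le_mul_of_nonneg_right hμh h2)
  -- The per-letter exponent is only `δ² μ² / 2`; four sub-blocks raise it to the required `2 δ² μ²
  -- l`.
  have h4 : (4 * l : ℝ) * (δ ^ 2 * μ ^ 2 / 2) ≤ L * (H / r * (δ * z - z ^ 2)) :=
    mul_le_mul hL' h3 (by positivity) (by positivity)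
  linarith

end Typicality

/-! ### Disagreement of the two common parts. -/

section Disagreement

variable {S₁ S₂ K : Type*} [Fintype S₁] [Fintype S₂] [Fintype K]

/-- The letters agree independently, so agreement of the whole block is a power. -/
lemma blockDisagreement_eq {pS : S₁ × S₂ → ℝ} (hpS : pS ∈ stdSimplex ℝ (S₁ × S₂))
    (f₁ : S₁ → K) (f₂ : S₂ → K) (L : ℕ) :
    blockDisagreement pS f₁ f₂ L = 1 - (∑ s, pS s * ind (f₁ s.1 = f₂ s.2)) ^ L := by
  have h1 : ∀ s : Fin L → S₁ × S₂,
      Set.indicator {s | (fun i => f₁ (s i).1) ≠ fun i => f₂ (s i).2} (iid pS L) s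
      = (∏ i, pS (s i)) - ∏ i, pS (s i) * ind (f₁ (s i).1 = f₂ (s i).2) := by
    intro s
    by_cases h : ∀ i, f₁ (s i).1 = f₂ (s i).2
    · rw [Set.indicator_of_notMem (by simpa [funext_iff] using h)]
      simp [h, ind]
    · rw [Set.indicator_of_mem (by simpa [funext_iff] using h)]
      push Not at h
      obtain ⟨i, hi⟩ := h
      rw [Finset.prod_eq_zero (f := fun i => pS (s i) * ind (f₁ (s i).1 = f₂ (s i).2))
        (Finset.mem_univ i) (by rw [ind_not hi, mul_zero])]
      simp [iid]
  unfold blockDisagreement prob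
  simp_rw [h1]
  rw [Finset.sum_sub_distrib, sum_fun_prod_eq_one (fun _ => pS) fun _ => hpS.2,
    sum_fun_prod fun _ s => pS s * ind (f₁ s.1 = f₂ s.2)]
  simp

/-- Bernoulli's inequality for `(x ^ l) ^ t`, that is, the union bound over `t` sub-blocks. -/
lemma blockDisagreement_mul_le {pS : S₁ × S₂ → ℝ} (hpS : pS ∈ stdSimplex ℝ (S₁ × S₂))
    (f₁ : S₁ → K) (f₂ : S₂ → K) (t l : ℕ) :
    blockDisagreement pS f₁ f₂ (t * l) ≤ t * blockDisagreement pS f₁ f₂ l := by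
  rw [blockDisagreement_eq hpS, blockDisagreement_eq hpS]
  set x := ∑ s, pS s * ind (f₁ s.1 = f₂ s.2)
  have hx : 0 ≤ x := Finset.sum_nonneg fun s _ => mul_nonneg (hpS.1 s) (ind_nonneg _)
  have h := one_add_mul_le_pow (a := x ^ l - 1) (by linarith [pow_nonneg hx l]) t
  rw [add_sub_cancel, ← pow_mul, mul_comm l t] at h
  linarith

lemma blockDisagreement_nonneg {pS : S₁ × S₂ → ℝ} (hpS : pS ∈ stdSimplex ℝ (S₁ × S₂))
    (f₁ : S₁ → K) (f₂ : S₂ → K) (l : ℕ) : 0 ≤ blockDisagreement pS f₁ f₂ l :=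
  Finset.sum_nonneg fun s _ => Set.indicator_nonneg
    (fun _ _ => Finset.prod_nonneg fun _ _ => hpS.1 _) s

end Disagreement

/-- A finite set can be partitioned into bins of size at most `n`. -/
lemma exists_binning {α : Type*} (T : Finset α) {n : ℕ} (hn : 0 < n) :
    ∃ b : α → Fin (T.card / n + 1), ∀ m, (T.filter fun k => b k = m).card ≤ n := by
  have hlt : ∀ k : T, (T.equivFin k : ℕ) / n < T.card / n + 1 := fun k =>
    Nat.lt_succ_of_le (Nat.div_le_div_right (T.equivFin k).2.le)
  -- Members of `T` are numbered: the quotient by `n` is the bin, and the remainder separates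
  -- members of one bin. Sequences outside `T` go to bin `0`, so they too have a codeword.
  refine ⟨fun k => if h : k ∈ T then ⟨(T.equivFin ⟨k, h⟩ : ℕ) / n, hlt _⟩ else 0, fun m => ?_⟩
  have := Finset.card_le_card_of_injOn (s := T.filter fun k =>
      (if h : k ∈ T then (⟨(T.equivFin ⟨k, h⟩ : ℕ) / n, hlt _⟩ : Fin (T.card / n + 1)) else 0) = m)
    (t := Finset.range n)
    (fun k => if h : k ∈ T then (T.equivFin ⟨k, h⟩ : ℕ) % n else 0) ?_ ?_
  · simpa using this
  · intro k hk
    have hkT : k ∈ T := (Finset.mem_filter.mp hk).1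
    simp only [hkT, dif_pos, Finset.coe_range, Set.mem_Iio]
    exact Nat.mod_lt _ hn
  · intro k hk k' hk' h
    obtain ⟨hkT, hkm⟩ := Finset.mem_filter.mp hk
    obtain ⟨hkT', hkm'⟩ := Finset.mem_filter.mp hk'
    simp only [hkT, hkT', dif_pos] at h hkm hkm'
    have h1 : (T.equivFin ⟨k, hkT⟩ : ℕ) / n = (T.equivFin ⟨k', hkT'⟩ : ℕ) / n := by
      have := hkm.trans hkm'.symm
      simpa using this
    have h2 : (T.equivFin ⟨k, hkT⟩ : ℕ) = (T.equivFin ⟨k', hkT'⟩ : ℕ) := by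
      rw [← Nat.div_add_mod (T.equivFin ⟨k, hkT⟩ : ℕ) n, h1, h,
        Nat.div_add_mod]
    have h3 := T.equivFin.injective (Fin.ext h2)
    simpa using h3

/-! ### The channel factor of the decoding metric. -/

section ChannelMetric

variable {U V Y : Type*} [Fintype U] [Fintype V] [Fintype Y] {L : ℕ}

/-- The density of the pmf `Q` on `V × Y` with respect to the product of its marginals. -/
def infoDensity (Q : V × Y → ℝ) (v : V) (y : Y) : ℝ :=
  Q (v, y) / (law Q Prod.fst v * law Q Prod.snd y)

/-- Blockwise information density, regularised so as to be bounded below by `ψ`. -/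
def channelMetric (Q : V × Y → ℝ) (ψ : ℝ) (v : Fin L → V) (y : Fin L → Y) : ℝ :=
  (1 - ψ) * (∏ i, infoDensity Q (v i) (y i)) + ψ

lemma infoDensity_nonneg {Q : V × Y → ℝ} (hQ : ∀ x, 0 ≤ Q x) (v : V) (y : Y) :
    0 ≤ infoDensity Q v y :=
  div_nonneg (hQ _) (mul_nonneg (law_nonneg hQ _ _) (law_nonneg hQ _ _))

lemma infoDensity_pos {Q : V × Y → ℝ} (hQ : ∀ x, 0 ≤ Q x) {v : V} {y : Y} (h : 0 < Q (v, y)) :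
    0 < infoDensity Q v y :=
  div_pos h (mul_pos (law_pos hQ Prod.fst (ω := (v, y)) h) (law_pos hQ Prod.snd (ω := (v, y)) h))

lemma law_snd (Q : V × Y → ℝ) (y : Y) : law Q Prod.snd y = ∑ v, Q (v, y) := by
  rw [law_eq, Fintype.sum_prod_type_right]
  refine (Finset.sum_eq_single y ?_ (by simp)).trans ?_
  · intro v' _ h
    exact Finset.sum_eq_zero fun y _ => by rw [ind_not h, mul_zero]
  · simp [ind]

lemma mutualInfo_eq_sum_infoDensity {Q : V × Y → ℝ} (hQ : ∀ x, 0 ≤ Q x) :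
    mutualInfo Q Prod.fst Prod.snd = ∑ v, ∑ y, Q (v, y) * Real.log (infoDensity Q v y) := by
  rw [mutualInfo_eq_sum hQ, Fintype.sum_prod_type]
  refine Finset.sum_congr rfl fun v _ => Finset.sum_congr rfl fun y _ => ?_
  have : law Q (fun ω => (ω.1, ω.2)) (v, y) = Q (v, y) := by
    rw [law_eq]
    refine (Finset.sum_eq_single (v, y) ?_ (by simp)).trans (by simp [ind])
    intro x _ h
    rw [ind_not (by simpa using h), mul_zero]
  simp only [this, infoDensity]

lemma le_channelMetric {Q : V × Y → ℝ} (hQ : ∀ x, 0 ≤ Q x) {ψ : ℝ} (hψ : ψ ≤ 1)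
    (v : Fin L → V) (y : Fin L → Y) : ψ ≤ channelMetric Q ψ v y :=
  le_add_of_nonneg_left (mul_nonneg (by linarith)
    (Finset.prod_nonneg fun _ _ => infoDensity_nonneg hQ _ _))

/-- Each component of the mixture has mean at most one under the input pmf: the product density
letter by letter, the constant trivially. -/
lemma sum_channelMetric_le {Q : V × Y → ℝ} (hQ : Q ∈ stdSimplex ℝ (V × Y)) {ψ : ℝ}
    (hψ : ψ ≤ 1) (y : Fin L → Y) :
    ∑ v : Fin L → V, (∏ i, law Q Prod.fst (v i)) * channelMetric Q ψ v y ≤ 1 := by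
  have hl := law_mem_stdSimplex hQ (Prod.fst : V × Y → V)
  have h1 : ∀ y, ∑ v, law Q Prod.fst v * infoDensity Q v y ≤ 1 := by
    intro y
    have h2 : ∀ v, law Q Prod.fst v * infoDensity Q v y ≤ Q (v, y) / law Q Prod.snd y := by
      intro v
      unfold infoDensity
      rcases (hl.1 v).eq_or_lt with h | h
      · rw [← h, zero_mul]; exact div_nonneg (hQ.1 _) (law_nonneg hQ.1 _ _)
      · rw [← mul_div_assoc, mul_div_mul_left _ _ h.ne']
    refine (Finset.sum_le_sum fun v _ => h2 v).trans ?_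
    rw [← Finset.sum_div, ← law_snd]
    exact div_self_le_one _
  have h3 : ∀ v : Fin L → V, (∏ i, law Q Prod.fst (v i)) * channelMetric Q ψ v y
      = (1 - ψ) * (∏ i, law Q Prod.fst (v i) * infoDensity Q (v i) (y i))
        + ψ * ∏ i, law Q Prod.fst (v i) := by
    intro v
    rw [channelMetric, Finset.prod_mul_distrib]; ring
  simp_rw [h3]
  rw [Finset.sum_add_distrib, ← Finset.mul_sum, ← Finset.mul_sum,
    sum_fun_prod_eq_one (fun _ => law Q Prod.fst) (fun _ => hl.2),
    sum_fun_prod fun i v => law Q Prod.fst v * infoDensity Q v (y i)]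
  have h4 : ∏ i, ∑ v, law Q Prod.fst v * infoDensity Q v (y i) ≤ 1 :=
    Finset.prod_le_one (fun i _ => Finset.sum_nonneg fun v _ =>
      mul_nonneg (hl.1 v) (infoDensity_nonneg hQ.1 _ _)) fun i _ => h1 (y i)
  nlinarith

/-- Summing a function of one pair of coordinates against a product pmf. -/
lemma sum_sum_prod_mul_sum {w : Fin L → V → Y → ℝ} (hw : ∀ i, ∑ v, ∑ y, w i v y = 1)
    (g : V → Y → ℝ) :
    ∑ v : Fin L → V, ∑ y : Fin L → Y, (∏ i, w i (v i) (y i)) * ∑ i, g (v i) (y i)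
      = ∑ i, ∑ v, ∑ y, w i v y * g v y := by
  have h1 : ∑ v : Fin L → V, ∑ y : Fin L → Y, (∏ i, w i (v i) (y i)) * ∑ i, g (v i) (y i)
      = ∑ x : Fin L → V × Y, (∏ i, w i (x i).1 (x i).2) * ∑ i, g (x i).1 (x i).2 := by
    rw [← Fintype.sum_prod_type']
    exact Fintype.sum_equiv (Equiv.arrowProdEquivProdArrow _ _ _).symm _ _ fun x => rfl
  rw [h1]
  simp_rw [Finset.mul_sum]
  rw [Finset.sum_comm]
  refine Finset.sum_congr rfl fun i _ => ?_
  rw [sum_fun_prod_mul (fun i (x : V × Y) => w i x.1 x.2)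
    (fun i => by rw [Fintype.sum_prod_type]; exact hw i) i fun x => g x.1 x.2,
    Fintype.sum_prod_type]

lemma sum_sum_prod_eq_one {w : Fin L → V → Y → ℝ} (hw : ∀ i, ∑ v, ∑ y, w i v y = 1) :
    ∑ v : Fin L → V, ∑ y : Fin L → Y, ∏ i, w i (v i) (y i) = 1 := by
  have h1 : ∑ v : Fin L → V, ∑ y : Fin L → Y, ∏ i, w i (v i) (y i)
      = ∑ x : Fin L → V × Y, ∏ i, w i (x i).1 (x i).2 := by
    rw [← Fintype.sum_prod_type']
    exact Fintype.sum_equiv (Equiv.arrowProdEquivProdArrow _ _ _).symm _ _ fun x => rfl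
  rw [h1]
  exact sum_fun_prod_eq_one (fun i (x : V × Y) => w i x.1 x.2)
    fun i => by rw [Fintype.sum_prod_type]; exact hw i

/-- On a codeword of type `p`, the regularised metric collects `L · I(V; Y)`. -/
lemma le_sum_log_channelMetric (hL : 0 < L) {f c : Fin L → U} {p : U → ℝ}
    (hp : ∀ u, p u = occurrences f u / L) (hc : c ∈ typeClass f)
    {Γ : U → V → Y → ℝ} (hΓ0 : ∀ u v y, 0 ≤ Γ u v y) (hΓ1 : ∀ u, ∑ v, ∑ y, Γ u v y = 1)
    {Q : V × Y → ℝ} (hQ : ∀ v y, Q (v, y) = ∑ u, p u * Γ u v y)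
    {ψ : ℝ} (hψ0 : 0 < ψ) (hψ1 : ψ < 1) :
    Real.log (1 - ψ) + L * mutualInfo Q Prod.fst Prod.snd
      ≤ ∑ v : Fin L → V, ∑ y : Fin L → Y, (∏ i, Γ (c i) (v i) (y i)) *
        Real.log (channelMetric Q ψ v y) := by
  have hp0 : ∀ u, 0 ≤ p u := fun u => by rw [hp]; positivity
  have hQ0 : ∀ x, 0 ≤ Q x := fun x => by
    rw [← Prod.mk.eta (p := x), hQ]
    exact Finset.sum_nonneg fun u _ => mul_nonneg (hp0 u) (hΓ0 _ _ _)
  have hpt : ∀ (v : Fin L → V) (y : Fin L → Y), (∏ i, Γ (c i) (v i) (y i)) *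
      (Real.log (1 - ψ) + ∑ i, Real.log (infoDensity Q (v i) (y i)))
      ≤ (∏ i, Γ (c i) (v i) (y i)) * Real.log (channelMetric Q ψ v y) := by
    intro v y
    by_cases h0 : ∀ i, 0 < Γ (c i) (v i) (y i)
    swap
    · push Not at h0
      obtain ⟨i, hi⟩ := h0
      rw [Finset.prod_eq_zero (Finset.mem_univ i) (le_antisymm hi (hΓ0 _ _ _)), zero_mul, zero_mul]
    refine mul_le_mul_of_nonneg_left ?_ (Finset.prod_nonneg fun i _ => hΓ0 _ _ _)
    have hr : ∀ i, 0 < infoDensity Q (v i) (y i) := by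
      intro i
      refine infoDensity_pos hQ0 ?_
      rw [hQ]
      have h1 := Finset.single_le_sum (f := fun u => p u * Γ u (v i) (y i))
        (fun u _ => mul_nonneg (hp0 u) (hΓ0 _ _ _)) (Finset.mem_univ (c i))
      exact lt_of_lt_of_le (mul_pos (pos_of_mem_typeClass hp hc i) (h0 i)) h1
    rw [← Real.log_prod fun i _ => (hr i).ne',
      ← Real.log_mul (by linarith) (Finset.prod_pos fun i _ => hr i).ne']
    refine Real.log_le_log (mul_pos (by linarith) (Finset.prod_pos fun i _ => hr i)) ?_
    unfold channelMetric
    linarith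
  refine le_trans (le_of_eq ?_) (Finset.sum_le_sum fun v _ => Finset.sum_le_sum fun y _ => hpt v y)
  simp_rw [mul_add, Finset.sum_add_distrib]
  rw [sum_sum_prod_mul_sum (w := fun i => Γ (c i)) (fun i => hΓ1 _)
    fun v y => Real.log (infoDensity Q v y)]
  simp_rw [← Finset.sum_mul]
  -- The log-density is additive over letters and the codeword has type `p`, so its mean is `L`
  -- times a mean under the mixture `Q`. The information obtained is thus that of `Q`, without
  -- conditioning on the codeword.
  rw [sum_sum_prod_eq_one (w := fun i => Γ (c i)) (fun i => hΓ1 _), one_mul,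
    sum_of_mem_typeClass hL hp hc fun u => ∑ v, ∑ y, Γ u v y * Real.log (infoDensity Q v y),
    mutualInfo_eq_sum_infoDensity hQ0]
  congr 2
  simp_rw [hQ, Finset.sum_mul, Finset.mul_sum]
  symm
  rw [Finset.sum_comm]
  refine Finset.sum_congr rfl fun v _ => ?_
  rw [Finset.sum_comm]
  exact Finset.sum_congr rfl fun u _ => Finset.sum_congr rfl fun y _ => by ring

end ChannelMetric

/-! ### The source factor of the decoding metric. -/

section SourceMetric

variable {S K Msg : Type*} [Fintype S] [Fintype K] [Fintype Msg] {L : ℕ}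

/-- A regularised conditional probability of the source block `s` given that `m` was decoded:
the common part is uniform on the bin `m` of `T`. -/
def sourceMetric (T : Finset (Fin L → K)) (b : (Fin L → K) → Msg) (n : ℕ) (P : K → S → ℝ)
    (φ ψ : ℝ) (m : Msg) (s : Fin L → S) : ℝ :=
  φ / (Fintype.card S : ℝ) ^ L + (1 - φ) *
    ∑ k ∈ T, ((1 - ψ) * ind (b k = m) + ψ / Fintype.card Msg) / n * ∏ i, P (k i) (s i)

variable {T : Finset (Fin L → K)} {b : (Fin L → K) → Msg} {n : ℕ} {P : K → S → ℝ} {φ ψ : ℝ}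

/-- Three sub-probabilities are mixed: uniform on source blocks, uniform on the bin `m`, and uniform
on all of `T`, the last two followed by the kernel `P`. The bin size and the bound `|T| ≤ |Msg| n`
limit the masses of the last two. -/
lemma sum_sourceMetric_le (hn : 0 < n) (hb : ∀ m, (T.filter fun k => b k = m).card ≤ n)
    (hT : T.card ≤ Fintype.card Msg * n) (hP0 : ∀ k s, 0 ≤ P k s) (hP1 : ∀ k, ∑ s, P k s ≤ 1)
    (hφ0 : 0 ≤ φ) (hφ1 : φ ≤ 1) (hψ0 : 0 ≤ ψ) (hψ1 : ψ ≤ 1) (m : Msg) :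
    ∑ s, sourceMetric T b n P φ ψ m s ≤ 1 := by
  have hn' : (0 : ℝ) < n := by exact_mod_cast hn
  have hM : (0 : ℝ) < Fintype.card Msg := by exact_mod_cast Fintype.card_pos_iff.mpr ⟨m⟩
  have hPk : ∀ k : Fin L → K, ∑ s : Fin L → S, ∏ i, P (k i) (s i) ≤ 1 := by
    intro k
    rw [sum_fun_prod fun i s => P (k i) s]
    exact Finset.prod_le_one (fun i _ => Finset.sum_nonneg fun s _ => hP0 _ _) fun i _ => hP1 _
  have hcoef : ∀ k, 0 ≤ ((1 - ψ) * ind (b k = m) + ψ / Fintype.card Msg) / n := fun k =>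
    div_nonneg (add_nonneg (mul_nonneg (by linarith) (ind_nonneg _)) (div_nonneg hψ0 hM.le)) hn'.le
  have h1 : ∑ s : Fin L → S, φ / (Fintype.card S : ℝ) ^ L ≤ φ := by
    rw [Finset.sum_const, Finset.card_univ, nsmul_eq_mul, Fintype.card_fun, Fintype.card_fin,
      Nat.cast_pow, ← mul_div_assoc, mul_comm, mul_div_assoc]
    exact mul_le_of_le_one_right hφ0 (div_self_le_one _)
  have h2 : ∑ k ∈ T, ((1 - ψ) * ind (b k = m) + ψ / Fintype.card Msg) / n ≤ 1 := by
    rw [← Finset.sum_div, div_le_one hn', Finset.sum_add_distrib, ← Finset.mul_sum,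
      Finset.sum_const, nsmul_eq_mul]
    have h3 : ∑ k ∈ T, ind (b k = m) ≤ n := by
      unfold ind
      rw [Finset.sum_boole]
      exact_mod_cast hb m
    have h4 : (T.card : ℝ) * (ψ / Fintype.card Msg) ≤ ψ * n := by
      rw [← mul_div_assoc, div_le_iff₀ hM]
      have : (T.card : ℝ) ≤ Fintype.card Msg * n := by exact_mod_cast hT
      nlinarith
    nlinarith
  calc ∑ s, sourceMetric T b n P φ ψ m s
      = (∑ s : Fin L → S, φ / (Fintype.card S : ℝ) ^ L) + (1 - φ) *
        ∑ k ∈ T, ((1 - ψ) * ind (b k = m) + ψ / Fintype.card Msg) / n *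
          ∑ s : Fin L → S, ∏ i, P (k i) (s i) := by
        unfold sourceMetric
        rw [Finset.sum_add_distrib, ← Finset.mul_sum, Finset.sum_comm]
        simp_rw [Finset.mul_sum]
    _ ≤ φ + (1 - φ) * ∑ k ∈ T, ((1 - ψ) * ind (b k = m) + ψ / Fintype.card Msg) / n * 1 := by
        refine add_le_add h1 (mul_le_mul_of_nonneg_left ?_ (by linarith))
        exact Finset.sum_le_sum fun k _ => mul_le_mul_of_nonneg_left (hPk k) (hcoef k)
    _ ≤ 1 := by simp_rw [mul_one]; nlinarith

lemma sourceMetric_aux_nonneg (hP0 : ∀ k s, 0 ≤ P k s) (hψ0 : 0 ≤ ψ) (hψ1 : ψ ≤ 1) (m : Msg)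
    (s : Fin L → S) (k : Fin L → K) :
    0 ≤ ((1 - ψ) * ind (b k = m) + ψ / Fintype.card Msg) / n * ∏ i, P (k i) (s i) := by
  have : 0 ≤ 1 - ψ := by linarith
  have := ind_nonneg (b k = m)
  have := Finset.prod_nonneg fun (i : Fin L) (_ : i ∈ Finset.univ) => hP0 (k i) (s i)
  positivity

lemma le_sourceMetric (hP0 : ∀ k s, 0 ≤ P k s) (hφ1 : φ ≤ 1) (hψ0 : 0 ≤ ψ) (hψ1 : ψ ≤ 1)
    (m : Msg) (s : Fin L → S) :
    φ / (Fintype.card S : ℝ) ^ L ≤ sourceMetric T b n P φ ψ m s :=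
  le_add_of_nonneg_right (mul_nonneg (by linarith)
    (Finset.sum_nonneg fun k _ => sourceMetric_aux_nonneg hP0 hψ0 hψ1 m s k))

lemma sourceMetric_pos [Nonempty S] (hP0 : ∀ k s, 0 ≤ P k s) (hφ0 : 0 < φ) (hφ1 : φ ≤ 1)
    (hψ0 : 0 ≤ ψ) (hψ1 : ψ ≤ 1) (m : Msg) (s : Fin L → S) :
    0 < sourceMetric T b n P φ ψ m s := by
  have hS : (0 : ℝ) < Fintype.card S := by exact_mod_cast Fintype.card_pos
  exact lt_of_lt_of_le (by positivity) (le_sourceMetric hP0 hφ1 hψ0 hψ1 m s)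

/-- Pointwise lower bound on the logarithm of the source metric. -/
lemma le_log_sourceMetric [Nonempty S] (hn : 0 < n) (hP0 : ∀ k s, 0 ≤ P k s)
    (hP1 : ∀ k s, P k s ≤ 1)
    (hφ0 : 0 < φ) (hφ1 : φ < 1) (hψ0 : 0 < ψ) (hψ1 : ψ < 1) (m : Msg) (s : Fin L → S)
    {k : Fin L → K} (hk : ∀ i, 0 < P (k i) (s i)) :
    Real.log (1 - φ) + Real.log (1 - ψ) + (∑ i, Real.log (P (k i) (s i))) - Real.log n
      + ind (k ∈ T) * ind (m ≠ b k) * Real.log (ψ / Fintype.card Msg)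
      + ind (k ∉ T) * (Real.log φ - L * Real.log (Fintype.card S))
      ≤ Real.log (sourceMetric T b n P φ ψ m s) := by
  have hn' : (1 : ℝ) ≤ n := by exact_mod_cast hn
  have hM : (1 : ℝ) ≤ Fintype.card Msg := by exact_mod_cast Fintype.card_pos_iff.mpr ⟨m⟩
  have hS : (0 : ℝ) < Fintype.card S := by exact_mod_cast Fintype.card_pos
  have hlφ : Real.log (1 - φ) ≤ 0 := Real.log_nonpos (by linarith) (by linarith)
  have hlψ : Real.log (1 - ψ) ≤ 0 := Real.log_nonpos (by linarith) (by linarith)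
  have hln : 0 ≤ Real.log n := Real.log_nonneg hn'
  have hlP : ∑ i, Real.log (P (k i) (s i)) ≤ 0 :=
    Finset.sum_nonpos fun i _ => Real.log_nonpos (hP0 _ _) (hP1 _ _)
  by_cases hkT : k ∈ T
  swap
  -- For an atypical common part only the uniform floor is available; the remaining terms on the
  -- left are nonpositive.
  · rw [ind_not hkT, ind_of hkT, zero_mul, zero_mul, one_mul]
    have h1 : Real.log φ - L * Real.log (Fintype.card S)
        = Real.log (φ / (Fintype.card S : ℝ) ^ L) := by
      rw [Real.log_div hφ0.ne' (by positivity), Real.log_pow]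
    have h2 := Real.log_le_log (by positivity) (le_sourceMetric (T := T) (b := b) (n := n)
      hP0 hφ1.le hψ0.le hψ1.le m s)
    linarith
  have hprod : 0 < ∏ i, P (k i) (s i) := Finset.prod_pos fun i _ => hk i
  have hsingle : (1 - φ) * (((1 - ψ) * ind (b k = m) + ψ / Fintype.card Msg) / n *
      ∏ i, P (k i) (s i)) ≤ sourceMetric T b n P φ ψ m s := by
    have h1 := Finset.single_le_sum (f := fun k => ((1 - ψ) * ind (b k = m) + ψ /
      Fintype.card Msg) / n * ∏ i, P (k i) (s i))
      (fun k _ => sourceMetric_aux_nonneg hP0 hψ0.le hψ1.le m s k) hkT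
    have h2 := mul_le_mul_of_nonneg_left h1 (by linarith : 0 ≤ 1 - φ)
    have h3 : 0 ≤ φ / (Fintype.card S : ℝ) ^ L := by positivity
    unfold sourceMetric
    linarith
  rw [ind_of hkT, ind_not (not_not.mpr hkT), one_mul, zero_mul, add_zero]
  -- Here `x` bounds the bin weight from below: `1 - ψ` if the bin is correct, `ψ / |Msg|` if it is
  -- wrong.
  have hlog : ∀ x : ℝ, 0 < x → x ≤ (1 - ψ) * ind (b k = m) + ψ / Fintype.card Msg →
      Real.log (1 - φ) + Real.log x + (∑ i, Real.log (P (k i) (s i))) - Real.log n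
        ≤ Real.log (sourceMetric T b n P φ ψ m s) := by
    intro x hx hle
    have h1 : Real.log ((1 - φ) * (x / n * ∏ i, P (k i) (s i))) = 
        Real.log (1 - φ) + Real.log x + (∑ i, Real.log (P (k i) (s i))) - Real.log n := by
      rw [Real.log_mul (by linarith) (by positivity), Real.log_mul (by positivity) hprod.ne',
        Real.log_div hx.ne' (by positivity), Real.log_prod fun i _ => (hk i).ne']
      ring
    rw [← h1]
    have h2 : 0 < 1 - φ := by linarith
    refine Real.log_le_log (by positivity) (le_trans ?_ hsingle)
    gcongr
  by_cases hm : b k = m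
  · rw [ind_not (not_not.mpr hm.symm), zero_mul, add_zero]
    refine hlog _ (by linarith) ?_
    rw [ind_of hm, mul_one]
    exact le_add_of_nonneg_right (by positivity)
  · rw [ind_of (Ne.symm hm), one_mul]
    have := hlog (ψ / Fintype.card Msg) (by positivity) (by rw [ind_not hm]; simp)
    linarith

end SourceMetric

/-! ### Mean of the log-metric at one receiver. -/

section Drift

variable {Ω U V Y S K Msg : Type*} [Fintype Ω] [Fintype U] [Fintype V] [Fintype Y] [Fintype S]
  [Fintype K] [Fintype Msg] {L : ℕ}

/-- Lower bound on the expected log-metric of one receiver. -/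
lemma le_drift [Nonempty S] (hL : 0 < L) {f : Fin L → U} {p : U → ℝ}
    (hp : ∀ u, p u = occurrences f u / L) {c : Msg → Fin L → U} (hc : ∀ m, c m ∈ typeClass f)
    {Γ : U → U → V → Y → ℝ} (hΓ0 : ∀ u u' v y, 0 ≤ Γ u u' v y)
    (hΓ1 : ∀ u u', ∑ v, ∑ y, Γ u u' v y = 1)
    {Q : V × Y → ℝ} (hQ : ∀ v y, Q (v, y) = ∑ u, p u * Γ u u v y)
    (hI : 0 ≤ mutualInfo Q Prod.fst Prod.snd)
    {φ ψ : ℝ} (hφ0 : 0 < φ) (hφ1 : φ < 1) (hψ0 : 0 < ψ) (hψ1 : ψ < 1)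
    {T : Finset (Fin L → K)} {b : (Fin L → K) → Msg} {n : ℕ} (hn : 0 < n) {P : K → S → ℝ}
    (hP0 : ∀ k s, 0 ≤ P k s) (hP1 : ∀ k s, P k s ≤ 1)
    {μ : Ω → ℝ} (hμ : μ ∈ stdSimplex ℝ Ω) (m₁ m₂ : Ω → Msg) (k : Ω → Fin L → K)
    (s : Ω → Fin L → S) (dec : (Fin L → Y) → Msg)
    (hPk : ∀ ω, μ ω ≠ 0 → ∀ i, 0 < P (k ω i) (s ω i))
    (hE₁ : ∑ ω, μ ω * ind (m₁ ω ≠ m₂ ω) ≤ ψ)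
    (hE₂ : ∑ ω, μ ω * ∑ v : Fin L → V, ∑ y : Fin L → Y,
      (∏ i, Γ (c (m₁ ω) i) (c (m₂ ω) i) (v i) (y i)) * (ind (k ω ∈ T) * ind (dec y ≠ b (k ω))) ≤ ψ)
    (hE₃ : ∑ ω, μ ω * ind (k ω ∉ T) ≤ φ) :
    (Real.log (1 - ψ) + L * mutualInfo Q Prod.fst Prod.snd
      - ψ * (L * mutualInfo Q Prod.fst Prod.snd - Real.log ψ))
      + (Real.log (1 - φ) + Real.log (1 - ψ)
        + (∑ ω, μ ω * ∑ i, Real.log (P (k ω i) (s ω i))) - Real.log n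
        + ψ * Real.log (ψ / Fintype.card Msg) + φ * (Real.log φ - L * Real.log (Fintype.card S)))
      ≤ ∑ ω, μ ω * ∑ v : Fin L → V, ∑ y : Fin L → Y,
        (∏ i, Γ (c (m₁ ω) i) (c (m₂ ω) i) (v i) (y i)) *
          Real.log (channelMetric Q ψ v y * sourceMetric T b n P φ ψ (dec y) (s ω)) := by
  set I := mutualInfo Q Prod.fst Prod.snd with hIdef
  have hp0 : ∀ u, 0 ≤ p u := fun u => by rw [hp]; positivity
  have hQ0 : ∀ x, 0 ≤ Q x := fun x => by
    rw [← Prod.mk.eta (p := x), hQ]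
    exact Finset.sum_nonneg fun u _ => mul_nonneg (hp0 u) (hΓ0 _ _ _ _)
  set w : Ω → (Fin L → V) → (Fin L → Y) → ℝ := fun ω v y =>
    ∏ i, Γ (c (m₁ ω) i) (c (m₂ ω) i) (v i) (y i) with hw
  have hw0 : ∀ ω v y, 0 ≤ w ω v y := fun ω v y => Finset.prod_nonneg fun i _ => hΓ0 _ _ _ _
  have hw1 : ∀ ω, ∑ v, ∑ y, w ω v y = 1 := fun ω =>
    sum_sum_prod_eq_one (w := fun i => Γ (c (m₁ ω) i) (c (m₂ ω) i)) fun i => hΓ1 _ _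
  have hwc : ∀ ω (x : ℝ), ∑ v, ∑ y, w ω v y * x = x := fun ω x => by
    simp_rw [← Finset.sum_mul]; rw [hw1, one_mul]
  have hlψ : Real.log (1 - ψ) ≤ 0 := Real.log_nonpos (by linarith) (by linarith)
  have hlψ' : Real.log ψ ≤ 0 := Real.log_nonpos hψ0.le hψ1.le
  have hLI : 0 ≤ L * I := by positivity
  -- When the users select different bins nothing is assumed about the channel law; the floor `ψ` of
  -- the metric bounds the damage.
  have hV : ∀ ω, (Real.log (1 - ψ) + L * I) + ind (m₁ ω ≠ m₂ ω) * (Real.log ψ - L * I)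
      ≤ ∑ v, ∑ y, w ω v y * Real.log (channelMetric Q ψ v y) := by
    intro ω
    by_cases h : m₁ ω = m₂ ω
    · rw [ind_not (not_not.mpr h), zero_mul, add_zero]
      have h1 := le_sum_log_channelMetric (V := V) (Y := Y) hL hp (hc (m₁ ω))
        (Γ := fun u => Γ u u) (fun u => hΓ0 u u) (fun u => hΓ1 u u) hQ hψ0 hψ1
      simpa only [hw, ← h] using h1
    · rw [ind_of h, one_mul]
      calc _ ≤ Real.log ψ := by linarith
        _ = ∑ v, ∑ y, w ω v y * Real.log ψ := (hwc ω _).symm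
        _ ≤ _ := Finset.sum_le_sum fun v _ => Finset.sum_le_sum fun y _ =>
          mul_le_mul_of_nonneg_left (Real.log_le_log hψ0 (le_channelMetric hQ0 hψ1.le v y))
            (hw0 ω v y)
  set M : ℝ := (Fintype.card Msg : ℝ) with hM
  set N := Real.log φ - L * Real.log (Fintype.card S) with hN
  have hS : ∀ ω, μ ω ≠ 0 → Real.log (1 - φ) + Real.log (1 - ψ)
      + (∑ i, Real.log (P (k ω i) (s ω i))) - Real.log n
      + (∑ v, ∑ y, w ω v y * (ind (k ω ∈ T) * ind (dec y ≠ b (k ω)))) * Real.log (ψ / M)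
      + ind (k ω ∉ T) * N
      ≤ ∑ v, ∑ y, w ω v y * Real.log (sourceMetric T b n P φ ψ (dec y) (s ω)) := by
    intro ω hω
    have hpt : ∀ v y, w ω v y * ((Real.log (1 - φ) + Real.log (1 - ψ)
        + (∑ i, Real.log (P (k ω i) (s ω i))) - Real.log n + ind (k ω ∉ T) * N)
        + ind (k ω ∈ T) * ind (dec y ≠ b (k ω)) * Real.log (ψ / M))
        ≤ w ω v y * Real.log (sourceMetric T b n P φ ψ (dec y) (s ω)) := by
      intro v y
      refine mul_le_mul_of_nonneg_left ?_ (hw0 ω v y)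
      have := le_log_sourceMetric (T := T) (b := b) hn hP0 hP1 hφ0 hφ1 hψ0 hψ1 (dec y) (s ω)
        (hPk ω hω)
      linarith
    refine le_trans (le_of_eq ?_) (Finset.sum_le_sum fun v _ => Finset.sum_le_sum fun y _ => hpt v y)
    simp_rw [mul_add (w ω _ _), Finset.sum_add_distrib, ← mul_assoc (w ω _ _), ← Finset.sum_mul]
    rw [hw1]
    ring
  have hsplit : ∀ ω, ∑ v, ∑ y, w ω v y *
      Real.log (channelMetric Q ψ v y * sourceMetric T b n P φ ψ (dec y) (s ω))
      = (∑ v, ∑ y, w ω v y * Real.log (channelMetric Q ψ v y))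
        + ∑ v, ∑ y, w ω v y * Real.log (sourceMetric T b n P φ ψ (dec y) (s ω)) := by
    intro ω
    simp_rw [← Finset.sum_add_distrib]
    refine Finset.sum_congr rfl fun v _ => Finset.sum_congr rfl fun y _ => ?_
    rw [Real.log_mul (lt_of_lt_of_le hψ0 (le_channelMetric hQ0 hψ1.le v y)).ne'
      (sourceMetric_pos hP0 hφ0 hφ1.le hψ0.le hψ1.le _ _).ne', mul_add]
  have hM1 : ∀ ω : Ω, (1 : ℝ) ≤ M := fun ω => by
    rw [hM]; exact_mod_cast Fintype.card_pos_iff.mpr ⟨m₁ ω⟩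
  have hlM : Real.log (ψ / M) ≤ 0 := by
    have : 0 ≤ M := by positivity
    refine Real.log_nonpos (by positivity) ?_
    rcases isEmpty_or_nonempty Ω with h | ⟨⟨ω⟩⟩
    · have := hμ.2
      simp at this
    · exact div_le_one_of_le₀ (hψ1.le.trans (hM1 ω)) this
  have hcardS : (1 : ℝ) ≤ Fintype.card S := by exact_mod_cast Fintype.card_pos
  have hN0 : N ≤ 0 := by
    have h1 := Real.log_nonpos hφ0.le hφ1.le
    have h2 := Real.log_nonneg hcardS
    have : 0 ≤ (L : ℝ) * Real.log (Fintype.card S) := by positivity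
    linarith
  refine le_of_le_of_eq ?_ (Finset.sum_congr rfl fun ω _ => congrArg (μ ω * ·) (hsplit ω)).symm
  have hfin : ∑ ω, μ ω * (((Real.log (1 - ψ) + L * I)
        + ind (m₁ ω ≠ m₂ ω) * (Real.log ψ - L * I))
      + (Real.log (1 - φ) + Real.log (1 - ψ)
      + (∑ i, Real.log (P (k ω i) (s ω i))) - Real.log n
      + (∑ v, ∑ y, w ω v y * (ind (k ω ∈ T) * ind (dec y ≠ b (k ω)))) * Real.log (ψ / M)
      + ind (k ω ∉ T) * N))
      ≤ ∑ ω, μ ω * ((∑ v, ∑ y, w ω v y * Real.log (channelMetric Q ψ v y))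
        + ∑ v, ∑ y, w ω v y * Real.log (sourceMetric T b n P φ ψ (dec y) (s ω))) := by
    refine Finset.sum_le_sum fun ω _ => ?_
    by_cases hω : μ ω = 0
    · rw [hω, zero_mul, zero_mul]
    · exact mul_le_mul_of_nonneg_left (add_le_add (hV ω) (hS ω hω)) (hμ.1 ω)
  refine le_trans ?_ hfin
  have hexp : ∑ ω, μ ω * (((Real.log (1 - ψ) + L * I)
        + ind (m₁ ω ≠ m₂ ω) * (Real.log ψ - L * I))
      + (Real.log (1 - φ) + Real.log (1 - ψ)
      + (∑ i, Real.log (P (k ω i) (s ω i))) - Real.log n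
      + (∑ v, ∑ y, w ω v y * (ind (k ω ∈ T) * ind (dec y ≠ b (k ω)))) * Real.log (ψ / M)
      + ind (k ω ∉ T) * N))
      = (Real.log (1 - ψ) + L * I + Real.log (1 - φ) + Real.log (1 - ψ) - Real.log n)
        + (∑ ω, μ ω * ind (m₁ ω ≠ m₂ ω)) * (Real.log ψ - L * I)
        + (∑ ω, μ ω * ∑ i, Real.log (P (k ω i) (s ω i)))
        + (∑ ω, μ ω * ∑ v, ∑ y, w ω v y * (ind (k ω ∈ T) * ind (dec y ≠ b (k ω))))
          * Real.log (ψ / M)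
        + (∑ ω, μ ω * ind (k ω ∉ T)) * N := by
    rw [← one_mul (Real.log (1 - ψ) + L * I + Real.log (1 - φ) + Real.log (1 - ψ) - Real.log n),
      ← hμ.2, Finset.sum_mul, Finset.sum_mul, Finset.sum_mul, Finset.sum_mul,
      ← Finset.sum_add_distrib, ← Finset.sum_add_distrib, ← Finset.sum_add_distrib,
      ← Finset.sum_add_distrib]
    exact Finset.sum_congr rfl fun ω _ => by ring
  rw [hexp]
  -- Each bad event is multiplied by a nonpositive logarithm, so an upper bound on its probability
  -- gives a lower bound on the drift.
  have g1 := mul_le_mul_of_nonpos_right hE₁ (by linarith : Real.log ψ - L * I ≤ 0)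
  have g2 := mul_le_mul_of_nonpos_right hE₂ hlM
  have g3 := mul_le_mul_of_nonpos_right hE₃ hN0
  linarith

end Drift

/-! ### Numerical estimates and the budget of losses. -/

section Estimates

/-- The tangent to `log` at `e` has slope `1 / e < 0.368`. -/
lemma log_le_mul {y : ℝ} (hy : 0 < y) : Real.log y ≤ 0.368 * y := by
  have h1 := Real.log_le_sub_one_of_pos (mul_pos hy (Real.exp_pos (-1)))
  rw [Real.log_mul hy.ne' (Real.exp_pos _).ne', Real.log_exp] at h1
  have h2 := Real.exp_neg_one_lt_d9
  nlinarith

lemma neg_two_mul_le_log_one_sub {x : ℝ} (hx0 : 0 ≤ x) (hx : x ≤ 1 / 2) :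
    -(2 * x) ≤ Real.log (1 - x) := by
  have h1 := Real.one_sub_inv_le_log_of_pos (by linarith : 0 < 1 - x)
  have h2 : (1 - x)⁻¹ ≤ 1 + 2 * x := by
    rw [inv_le_iff_one_le_mul₀ (by linarith)]
    nlinarith
  linarith

/-- The lower bound turns `5 / 2 ≤ -log φ` into `φ ≤ 1 / 10`; the upper one is used in
`five_halves_le_neg_log`. -/
lemma exp_five_halves_bounds : 10 < Real.exp (5 / 2) ∧ Real.exp (5 / 2) < 13.5 := by
  have h1 : Real.exp (5 / 2) ^ 2 = Real.exp 1 ^ 5 := by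
    rw [← Real.exp_nat_mul, ← Real.exp_nat_mul]; norm_num
  have h2 := Real.exp_one_gt_d9
  have h3 := Real.exp_one_lt_d9
  have h4 : (2.7182818283 : ℝ) ^ 5 < Real.exp 1 ^ 5 := by gcongr
  have h5 : Real.exp 1 ^ 5 < (2.7182818286 : ℝ) ^ 5 := by gcongr
  have h6 := Real.exp_pos (5 / 2)
  constructor
  · by_contra h
    push Not at h
    have : Real.exp (5 / 2) ^ 2 ≤ 10 ^ 2 := by gcongr
    have : (100 : ℝ) < 2.7182818283 ^ 5 := by norm_num
    linarith
  · by_contra h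
    push Not at h
    have : (13.5 : ℝ) ^ 2 ≤ Real.exp (5 / 2) ^ 2 := by gcongr
    have : (2.7182818286 : ℝ) ^ 5 < 13.5 ^ 2 := by norm_num
    linarith

/-- A small value of `φ log (1 / φ)` forces `φ` itself to be small. -/
lemma five_halves_le_neg_log {φ : ℝ} (hφ0 : 0 < φ) (hφ : φ < 1 / 2)
    (h : φ * -Real.log φ ≤ 0.184) : 5 / 2 ≤ -Real.log φ := by
  by_contra hlt
  push Not at hlt
  set lam := -Real.log φ with hlam
  have he : Real.exp lam = φ⁻¹ := by rw [hlam, Real.exp_neg, Real.exp_log hφ0]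
  have hlo : 0.69 ≤ lam := by
    have h1 := Real.log_lt_log hφ0 hφ
    rw [one_div, Real.log_inv] at h1
    have := Real.log_two_gt_d9
    linarith
  have h1 : lam ≤ 0.184 * Real.exp lam := by
    rw [he, ← div_eq_mul_inv, le_div_iff₀ hφ0]
    linarith
  have h2 : Real.exp 0.69 ≤ 2 := by
    have := Real.log_two_gt_d9
    calc Real.exp 0.69 ≤ Real.exp (Real.log 2) := by gcongr; linarith
      _ = 2 := Real.exp_log (by norm_num)
  have h3 := exp_five_halves_bounds.2
  -- On `[0.69, 5/2]` the exponential lies below its chord, with end values at most `2` and `13.5`.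
  -- As `0.184 * 2 < 0.69` and `0.184 * 13.5 < 5/2`, this contradicts `lam ≤ 0.184 exp lam`.
  have hcv := convexOn_exp.2 (Set.mem_univ (0.69 : ℝ)) (Set.mem_univ (5 / 2 : ℝ))
    (by rw [sub_nonneg]; exact div_le_one_of_le₀ (by linarith) (by norm_num) :
      (0 : ℝ) ≤ 1 - (lam - 0.69) / (5 / 2 - 0.69))
    (div_nonneg (by linarith) (by norm_num) : (0 : ℝ) ≤ (lam - 0.69) / (5 / 2 - 0.69)) (by ring)
  simp only [smul_eq_mul] at hcv
  have h4 : (1 - (lam - 0.69) / (5 / 2 - 0.69)) * 0.69 + (lam - 0.69) / (5 / 2 - 0.69) * (5 / 2)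
      = lam := by ring
  rw [h4] at hcv
  set w := (lam - 0.69) / (5 / 2 - 0.69) with hw
  have hw0 : 0 ≤ w := div_nonneg (by linarith) (by norm_num)
  have hw1 : w ≤ 1 := div_le_one_of_le₀ (by linarith) (by norm_num)
  have hl : lam = 0.69 + w * 1.81 := by rw [hw]; ring
  nlinarith

lemma le_tenth_of_five_halves_le {φ : ℝ} (hφ0 : 0 < φ) (h : 5 / 2 ≤ -Real.log φ) :
    φ ≤ 1 / 10 := by
  have h1 := exp_five_halves_bounds.1
  have h2 : Real.exp (5 / 2) ≤ φ⁻¹ := by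
    calc Real.exp (5 / 2) ≤ Real.exp (-Real.log φ) := by gcongr
      _ = φ⁻¹ := by rw [Real.exp_neg, Real.exp_log hφ0]
  have h3 : 10 ≤ φ⁻¹ := by linarith
  rw [le_inv_comm₀ (by norm_num) hφ0] at h3
  linarith

/-- The polynomial factor of the type class is absorbed by the rate reduction. -/
lemma log_two_add_mul_log_le {φ a y L : ℝ} (hφ0 : 0 < φ) (hlam : 5 / 2 ≤ -Real.log φ)
    (ha : 0 ≤ a) (hy : 2 ≤ y) (hL : 1 ≤ L) :
    Real.log 2 + a * Real.log (L + 1)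
      ≤ L * (1 / 8 * (a * y * φ * -Real.log φ)) + (a + 1) * -Real.log φ := by
  set lam := -Real.log φ with hlamdef
  have hφ := le_tenth_of_five_halves_le hφ0 hlam
  have hl2 : Real.log 2 ≤ lam := by linarith [Real.log_two_lt_d9]
  have hbase : 0 ≤ L * (1 / 8 * (a * y * φ * lam)) := by positivity
  -- For short blocks `log (L + 1)` is at most `-log φ`. For long ones the excess is logarithmic in
  -- `φ (L + 1)`, hence covered by the term linear in `φ L`.
  rcases le_or_gt (φ * (L + 1)) 1 with h | h
  · have h1 : Real.log (L + 1) ≤ lam := by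
      have h2 := Real.log_nonpos (by positivity) h
      rw [Real.log_mul hφ0.ne' (by positivity)] at h2
      linarith
    have := mul_le_mul_of_nonneg_left h1 ha
    linarith
  · set x := φ * (L + 1) with hx
    have h1 : Real.log (L + 1) = lam + Real.log x := by
      rw [hx, Real.log_mul hφ0.ne' (by positivity)]
      linarith
    have h2 : Real.log x ≤ 0.368 * x := log_le_mul (by linarith)
    have h3 : φ * L = x - φ := by rw [hx]; ring
    have h4 : Real.log x ≤ 5 / 8 * (φ * L) := by linarith
    have h5 : 5 / 8 * (φ * L) ≤ 1 / 8 * (y * lam) * (φ * L) := by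
      have : (5 : ℝ) ≤ y * lam := by nlinarith
      exact mul_le_mul_of_nonneg_right (by linarith) (by positivity)
    have h6 := mul_le_mul_of_nonneg_left (h4.trans h5) ha
    rw [h1]
    nlinarith

/-- The loss terms of the theorem dominate all the losses of the block scheme. -/
lemma budget_pos {φ ψ a y t l L A B I H hb logS logn logM β : ℝ} (hφ0 : 0 < φ)
    (hlam : 5 / 2 ≤ -Real.log φ) (ha : 2 ≤ a) (hy : 2 ≤ y) (ht : t = a + 2) (hl : 1 ≤ l)
    (hL : L = t * l) (hψ : ψ = t * φ) (hψ1 : ψ ≤ 1 / 2) (hly : -Real.log φ ≤ l * Real.log y)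
    (hAy : A ≤ Real.log y) (hIy : I ≤ Real.log y)
    (hβ : β ≤ 1 / 8 * (a * y * φ * -Real.log φ)) (hlogn : logn ≤ L * (B + β))
    (hlogM : logM ≤ L * A + 1.1) (hhb : φ * -Real.log φ ≤ hb)
    (h : B + H + (hb / l + φ * logS) < I - (hb + φ * Real.log a + y * a * φ * -Real.log φ)) :
    0 < (Real.log (1 - ψ) + L * I - ψ * (L * I - Real.log ψ))
      + (Real.log (1 - φ) + Real.log (1 - ψ) - L * H - logn + ψ * (Real.log ψ - logM)
        + φ * (Real.log φ - L * logS)) := by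
  set lam := -Real.log φ with hlamdef
  have hφl : Real.log φ = -lam := by rw [hlamdef]; ring
  have hφ := le_tenth_of_five_halves_le hφ0 hlam
  have ht0 : 4 ≤ t := by linarith
  have hL0 : 0 < L := by rw [hL]; positivity
  have hψ0 : 0 < ψ := by rw [hψ]; positivity
  have e1 := neg_two_mul_le_log_one_sub hψ0.le hψ1
  have e2 := neg_two_mul_le_log_one_sub hφ0.le (by linarith)
  have e3 : -lam ≤ Real.log ψ := by
    rw [← hφl]
    exact Real.log_le_log hφ0 (by rw [hψ]; nlinarith)
  have hla : 0 ≤ Real.log a := Real.log_nonneg (by linarith)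
  have hyl := log_le_mul (by linarith : 0 < y)
  -- The source loss is worth `t h_b` over the block and the channel loss `L h_b`; as `l ≥ 1`,
  -- together they cover both occurrences of `ψ log ψ`.
  have k1 : L * (hb / l) = t * hb := by rw [hL]; field_simp
  have k2 := mul_lt_mul_of_pos_left h hL0
  have k3 : t * (φ * lam) ≤ t * hb := mul_le_mul_of_nonneg_left hhb (by linarith)
  have k4 : L * (φ * lam) ≤ L * hb := mul_le_mul_of_nonneg_left hhb hL0.le
  have k5 : 0 ≤ L * (φ * Real.log a) := by positivity
  have k6 : L * β ≤ L * (1 / 8 * (a * y * φ * lam)) := mul_le_mul_of_nonneg_left hβ hL0.le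
  have k7 : ψ * -lam ≤ ψ * Real.log ψ := mul_le_mul_of_nonneg_left e3 hψ0.le
  have k8 : ψ * (-lam - (L * A + 1.1)) ≤ ψ * (Real.log ψ - logM) :=
    mul_le_mul_of_nonneg_left (by linarith) hψ0.le
  -- the remaining inequality after division by `φ`
  have hX : 2 * (l * y) ≤ l * y * a := by
    have := mul_le_mul_of_nonneg_left ha (by positivity : 0 ≤ l * y)
    linarith
  have hlyy : lam ≤ 0.368 * (l * y) := by
    have := mul_le_mul_of_nonneg_left hyl (by linarith : 0 ≤ l)
    linarith
  -- The cost `ψ L (I + A)` is measured in units of `l y a`, through `t ≤ 2 a` and `log y ≤ 0.368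
  -- y`, to be set against the loss `y a φ log (1/φ)`.
  have hIA : t * (l * (I + A)) ≤ 1.472 * (l * y * a) := by
    have h1 : l * (I + A) ≤ l * (0.736 * y) := mul_le_mul_of_nonneg_left (by linarith) (by linarith)
    have h2 : t * (l * (I + A)) ≤ t * (l * (0.736 * y)) :=
      mul_le_mul_of_nonneg_left h1 (by linarith)
    have h3 : t * (l * (0.736 * y)) ≤ (2 * a) * (l * (0.736 * y)) :=
      mul_le_mul_of_nonneg_right (by linarith) (by positivity)
    linarith
  -- One eighth of the last channel loss went to `β`; at `lam = 5 / 2` the remaining `7/8` leaves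
  -- `2.1875 - 1.472`.
  have hlin : 0.7155 * (l * y * a) ≤ 7 / 8 * (l * y * a) * lam - 1.472 * (l * y * a) := by
    have h1 : 0 ≤ l * y * a * (lam - 5 / 2) :=
      mul_nonneg (by positivity) (by linarith)
    linarith
  have hin : 3.88 * lam - 5.1 ≤ (l * lam - lam) + 7 / 8 * (l * y * a) * lam - 5.1
      - t * (l * (I + A)) := by
    have : 0 ≤ l * lam - lam := by
      have := mul_le_mul_of_nonneg_right hl (by linarith : 0 ≤ lam)
      linarith
    linarith
  have hbr : 0 ≤ t * ((l * lam - lam) + 7 / 8 * (l * y * a) * lam - 5.1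
      - t * (l * (I + A))) - 2 - lam := by
    have h1 := mul_le_mul_of_nonneg_left hin (by linarith : 0 ≤ t)
    have h2 : 4 * (3.88 * lam - 5.1) ≤ t * (3.88 * lam - 5.1) :=
      mul_le_mul_of_nonneg_right ht0 (by linarith)
    linarith
  have hbr' := mul_nonneg hφ0.le hbr
  have hexp : φ * (t * ((l * lam - lam) + 7 / 8 * (l * y * a) * lam - 5.1
      - t * (l * (I + A))) - 2 - lam) = t * (φ * lam) + L * (φ * lam)
      + L * (y * a * φ * lam) - L * (1 / 8 * (a * y * φ * lam)) - 4 * ψ - 2 * φ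
      - ψ * (L * I + lam) + ψ * (-lam - (L * A + 1.1)) - φ * lam := by
    rw [hψ, hL]; ring
  rw [hφl]
  linarith

lemma mul_neg_log_le_binEntropy {φ : ℝ} (hφ0 : 0 < φ) (hφ : φ < 1) :
    φ * -Real.log φ ≤ Real.binEntropy φ := by
  have h1 := Real.log_nonpos (by linarith : 0 ≤ 1 - φ) (by linarith)
  rw [Real.binEntropy, Real.log_inv, Real.log_inv]
  nlinarith

/-- Number of bins needed for `N ≤ exp (L (A + B))` sequences with bins of size
`⌊exp (L (B + β))⌋`. -/
lemma bin_count_le {L A B β : ℝ} {N n : ℕ} (hL : 0 ≤ L) (hA : 0 ≤ A) (hB : 0 ≤ B) (hβ : 0 ≤ β)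
    (hN : (N : ℝ) ≤ Real.exp (L * (A + B))) (hn : n = ⌊Real.exp (L * (B + β))⌋₊) :
    0 < n ∧ Real.log n ≤ L * (B + β) ∧ ((N / n : ℕ) : ℝ) ≤ 2 * Real.exp (L * (A - β)) ∧
      Real.log ((N / n + 1 : ℕ) : ℝ) ≤ L * A + 1.1 := by
  have h1 : 1 ≤ Real.exp (L * (B + β)) := Real.one_le_exp (by positivity)
  have hn0 : 0 < n := by rw [hn]; exact Nat.floor_pos.mpr h1
  have hn1 : (1 : ℝ) ≤ n := by exact_mod_cast hn0
  have hle : (n : ℝ) ≤ Real.exp (L * (B + β)) := by rw [hn]; exact Nat.floor_le (by positivity)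
  -- Rounding down a number that is at least `1` loses at most a factor `2`.
  have hge : Real.exp (L * (B + β)) / 2 ≤ n := by
    have := Nat.lt_floor_add_one (Real.exp (L * (B + β)))
    rw [← hn] at this
    linarith
  have hdiv : ((N / n : ℕ) : ℝ) ≤ 2 * Real.exp (L * (A - β)) := by
    refine Nat.cast_div_le.trans ?_
    rw [div_le_iff₀ (by linarith)]
    refine hN.trans ?_
    have : Real.exp (L * (A + B)) = 2 * Real.exp (L * (A - β)) * (Real.exp (L * (B + β)) / 2) := by
      rw [show L * (A + B) = L * (A - β) + L * (B + β) by ring, Real.exp_add]; ring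
    rw [this]
    gcongr
  refine ⟨hn0, ?_, hdiv, ?_⟩
  · rw [Real.log_le_iff_le_exp (by linarith)]
    exact hle
  · rw [Real.log_le_iff_le_exp (by positivity)]
    push_cast
    have h2 : Real.exp (L * (A - β)) ≤ Real.exp (L * A) := by
      gcongr; linarith
    have h3 : 1 ≤ Real.exp (L * A) := Real.one_le_exp (by positivity)
    -- The number of bins is at most `2 exp (L A) + 1 ≤ 3 exp (L A)`, hence the constant `1.1`.
    have h4 : (3 : ℝ) ≤ Real.exp 1.1 := by
      have h5 : Real.exp 1.1 = Real.exp 1 * Real.exp 0.1 := by rw [← Real.exp_add]; norm_num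
      have h6 := Real.add_one_le_exp (0.1 : ℝ)
      have h7 := Real.quadratic_le_exp_of_nonneg (by norm_num : (0 : ℝ) ≤ 0.1)
      have h8 := Real.exp_one_gt_d9
      rw [h5]
      norm_num at h7 ⊢
      nlinarith
    rw [Real.exp_add]
    nlinarith

end Estimates

/-! ### Marginals, conditional pmfs and iid blocks. -/

section Marginals

variable {Ω α β γ : Type*} [Fintype Ω] [Fintype α] [Fintype β] [Fintype γ]

lemma law_law (p : Ω → ℝ) (X : Ω → α) (g : α → β) :
    law (law p X) g = law p fun ω => g (X ω) := by
  funext b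
  rw [law_eq, law_eq, sum_law p X fun a => ind (g a = b)]

lemma mutualInfo_law_pair (p : Ω → ℝ) (X : Ω → α) (Z : Ω → β) :
    mutualInfo (law p fun ω => (X ω, Z ω)) Prod.fst Prod.snd = mutualInfo p X Z := by
  unfold mutualInfo entropy
  simp_rw [law_law]

lemma mutualInfo_nonneg {p : Ω → ℝ} (hp : p ∈ stdSimplex ℝ Ω) (X : Ω → α) (Z : Ω → β) :
    0 ≤ mutualInfo p X Z := by
  rw [← mutualInfo_law_pair]
  have hQ := law_mem_stdSimplex hp fun ω => (X ω, Z ω)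
  set Q := law p fun ω => (X ω, Z ω) with hQdef
  have h1 := law_mem_stdSimplex hQ (Prod.fst : α × β → α)
  have h2 := law_mem_stdSimplex hQ (Prod.snd : α × β → β)
  rw [mutualInfo_eq_sum_infoDensity hQ.1]
  have hpt : ∀ a b, Q (a, b) - law Q Prod.fst a * law Q Prod.snd b
      ≤ Q (a, b) * Real.log (infoDensity Q a b) := by
    intro a b
    refine sub_le_mul_log_div (hQ.1 _) (mul_nonneg (h1.1 a) (h2.1 b)) fun h => ?_
    by_contra hne
    have hpos : 0 < Q (a, b) := lt_of_le_of_ne (hQ.1 _) (Ne.symm hne)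
    exact (mul_pos (law_pos hQ.1 Prod.fst hpos) (law_pos hQ.1 Prod.snd hpos)).ne' h
  refine le_trans (le_of_eq ?_) (Finset.sum_le_sum fun a _ => Finset.sum_le_sum fun b _ => hpt a b)
  simp_rw [Finset.sum_sub_distrib, ← Finset.mul_sum]
  rw [← Finset.sum_mul, h1.2, h2.2, ← Fintype.sum_prod_type, hQ.2]
  ring

/-- Marginalising a product pmf coordinatewise. -/
lemma sum_prod_mul_comp {L : ℕ} (w : Fin L → Ω → ℝ) (g : Ω → β) (F : (Fin L → β) → ℝ) :
    ∑ ω : Fin L → Ω, (∏ i, w i (ω i)) * F (fun i => g (ω i))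
      = ∑ b : Fin L → β, (∏ i, law (w i) g (b i)) * F b := by
  have h1 : ∀ b : Fin L → β, ∏ i, law (w i) g (b i)
      = law (fun ω : Fin L → Ω => ∏ i, w i (ω i)) (fun ω i => g (ω i)) b := by
    intro b
    simp_rw [law_eq]
    rw [← sum_fun_prod fun i ω => w i ω * ind (g ω = b i)]
    refine Finset.sum_congr rfl fun ω _ => ?_
    rw [Finset.prod_mul_distrib]
    congr 1
    by_cases h : (fun i => g (ω i)) = b
    · rw [ind_of h]
      exact Finset.prod_eq_one fun i _ => ind_of (congrFun h i)
    · rw [ind_not h]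
      obtain ⟨i, hi⟩ := Function.ne_iff.mp h
      exact Finset.prod_eq_zero (Finset.mem_univ i) (ind_not hi)
  simp_rw [h1]
  rw [sum_law]

/-- The conditional pmf of `X` given `Z`. -/
def condPmf (p : Ω → ℝ) (X : Ω → α) (Z : Ω → β) (z : β) (x : α) : ℝ :=
  law p (fun ω => (X ω, Z ω)) (x, z) / law p Z z

lemma law_pair_le_right {p : Ω → ℝ} (hp : ∀ ω, 0 ≤ p ω) (X : Ω → α) (Z : Ω → β) (a : α) (b : β) :
    law p (fun ω => (X ω, Z ω)) (a, b) ≤ law p Z b := by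
  rw [law_eq, law_eq]
  refine Finset.sum_le_sum fun ω _ => mul_le_mul_of_nonneg_left ?_ (hp ω)
  by_cases h : Z ω = b
  · rw [ind_of h]; exact ind_le_one _
  · rw [ind_not h, ind_not]
    simp [h]

lemma condPmf_nonneg {p : Ω → ℝ} (hp : ∀ ω, 0 ≤ p ω) (X : Ω → α) (Z : Ω → β) (z : β) (x : α) :
    0 ≤ condPmf p X Z z x := div_nonneg (law_nonneg hp _ _) (law_nonneg hp _ _)

lemma condPmf_le_one {p : Ω → ℝ} (hp : ∀ ω, 0 ≤ p ω) (X : Ω → α) (Z : Ω → β) (z : β) (x : α) :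
    condPmf p X Z z x ≤ 1 :=
  div_le_one_of_le₀ (law_pair_le_right hp X Z x z) (law_nonneg hp _ _)

lemma condPmf_pos {p : Ω → ℝ} (hp : ∀ ω, 0 ≤ p ω) (X : Ω → α) (Z : Ω → β) {ω : Ω} (h : 0 < p ω) :
    0 < condPmf p X Z (Z ω) (X ω) :=
  div_pos (law_pos hp (fun ω => (X ω, Z ω)) h) (law_pos hp Z h)

/-- Equality fails where `Z` has probability zero, since the quotients are then `0`; a
sub-probability is all the metric requires. -/
lemma sum_condPmf_le_one (p : Ω → ℝ) (X : Ω → α) (Z : Ω → β) (z : β) :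
    ∑ x, condPmf p X Z z x ≤ 1 := by
  unfold condPmf
  rw [← Finset.sum_div]
  have : ∑ x, law p (fun ω => (X ω, Z ω)) (x, z) = law p Z z := by
    rw [← law_snd, law_law]
  rw [this]
  exact div_self_le_one _

lemma sum_mul_log_condPmf {p : Ω → ℝ} (hp : ∀ ω, 0 ≤ p ω) (X : Ω → α) (Z : Ω → β) :
    ∑ ω, p ω * Real.log (condPmf p X Z (Z ω) (X ω)) = -condEntropy p X Z := by
  rw [condEntropy, entropy_eq_sum, entropy_eq_sum, ← Finset.sum_sub_distrib,
    ← Finset.sum_neg_distrib]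
  refine Finset.sum_congr rfl fun ω _ => ?_
  rcases (hp ω).eq_or_lt with h | h
  · simp [← h]
  · rw [condPmf, Real.log_div (law_pos hp (fun ω => (X ω, Z ω)) h).ne' (law_pos hp Z h).ne']
    ring

lemma condEntropy_nonneg {p : Ω → ℝ} (hp : ∀ ω, 0 ≤ p ω) (X : Ω → α) (Z : Ω → β) :
    0 ≤ condEntropy p X Z := by
  rw [← neg_nonpos, ← sum_mul_log_condPmf hp]
  exact Finset.sum_nonpos fun ω _ => mul_nonpos_of_nonneg_of_nonpos (hp ω)
    (Real.log_nonpos (condPmf_nonneg hp _ _ _ _) (condPmf_le_one hp _ _ _ _))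

/-- Expectation of an additive functional of an iid block. -/
lemma sum_iid_mul_sum {p : Ω → ℝ} (hp : p ∈ stdSimplex ℝ Ω) (L : ℕ) (g : Ω → ℝ) :
    ∑ ω : Fin L → Ω, iid p L ω * ∑ i, g (ω i) = L * ∑ ω, p ω * g ω := by
  unfold iid
  simp_rw [Finset.mul_sum]
  rw [Finset.sum_comm]
  simp_rw [fun i => sum_fun_prod_mul (fun _ : Fin L => p) (fun _ => hp.2) i g]
  rw [Finset.sum_const, Finset.card_univ, Fintype.card_fin, nsmul_eq_mul, Finset.mul_sum]

lemma iid_mem_stdSimplex {p : Ω → ℝ} (hp : p ∈ stdSimplex ℝ Ω) (L : ℕ) :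
    iid p L ∈ stdSimplex ℝ (Fin L → Ω) := prod_mem_stdSimplex (fun _ => p) fun _ => hp

end Marginals

/-! ### Laws mixed over the codeword letter, and sizes of alphabets. -/

section Mixture

variable {U Ω α : Type*} [Fintype U] [Fintype Ω] [Fintype α]

lemma law_mixture (p : U → ℝ) (J : U → Ω → ℝ) (X : Ω → α) (a : α) :
    law (fun ω : U × Ω => p ω.1 * J ω.1 ω.2) (fun ω => X ω.2) a = ∑ u, p u * law (J u) X a := by
  rw [law_eq, Fintype.sum_prod_type]
  refine Finset.sum_congr rfl fun u _ => ?_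
  rw [law_eq, Finset.mul_sum]
  exact Finset.sum_congr rfl fun ω _ => by ring

lemma law_mixture_index (p : U → ℝ) {J : U → Ω → ℝ} (hJ : ∀ u, ∑ ω, J u ω = 1) (u : U) :
    law (fun ω : U × Ω => p ω.1 * J ω.1 ω.2) (fun ω => ω.1) u = p u := by
  rw [law_eq, Fintype.sum_prod_type]
  refine (Finset.sum_eq_single u ?_ (by simp)).trans ?_
  · intro v _ h
    exact Finset.sum_eq_zero fun ω _ => by rw [ind_not h, mul_zero]
  · simp only [ind_of, mul_one]
    rw [← Finset.mul_sum, hJ, mul_one]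

lemma condLaw_mixture {p : U → ℝ} {J : U → Ω → ℝ} (hJ : ∀ u, ∑ ω, J u ω = 1) (X : Ω → α) {u : U}
    (hu : 0 < p u) :
    condLaw (fun ω : U × Ω => p ω.1 * J ω.1 ω.2) (fun ω => X ω.2) (fun ω => ω.1) u
      = law (J u) X := by
  funext a
  rw [condLaw, law_mixture_index p hJ, div_eq_iff hu.ne', law_eq, Fintype.sum_prod_type,
    law_eq, Finset.sum_mul]
  refine (Finset.sum_eq_single u ?_ (by simp)).trans ?_
  · intro v _ h
    exact Finset.sum_eq_zero fun ω _ => by rw [ind_not (by simp [h]), mul_zero]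
  · refine Finset.sum_congr rfl fun ω _ => ?_
    have : ind ((u, X ω) = (u, a)) = ind (X ω = a) := by simp
    rw [this]; ring

lemma mixture_mem_stdSimplex {p : U → ℝ} (hp : p ∈ stdSimplex ℝ U) {J : U → Ω → ℝ}
    (hJ : ∀ u, J u ∈ stdSimplex ℝ Ω) :
    (fun ω : U × Ω => p ω.1 * J ω.1 ω.2) ∈ stdSimplex ℝ (U × Ω) := by
  refine ⟨fun ω => mul_nonneg (hp.1 _) ((hJ _).1 _), ?_⟩
  rw [Fintype.sum_prod_type]
  simp_rw [← Finset.mul_sum, (hJ _).2, mul_one]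
  exact hp.2

/-- If the exponential error bound is below `1` at rate margin `ρ`, then the rate is below the
logarithm of the output alphabet, with an explicit gap. -/
lemma le_mul_log_card_of_exp_le {Y : Type*} [Fintype Y] {p : U → ℝ} (hp : p ∈ stdSimplex ℝ U)
    {W : U → Y → ℝ} (hW : ∀ u, W u ∈ stdSimplex ℝ Y) {A ρ φ l : ℝ} (hl : 0 < l) (hρ : 0 < ρ)
    (hφ0 : 0 < φ) (hφ1 : φ < 1)
    (h : Real.exp (-l * (randomCodingExponent (A + ρ) p W - ρ)) ≤ φ) :
    -Real.log φ ≤ l * (Real.log (Fintype.card Y) - A) := by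
  have h1 := randomCodingExponent_le_max (R := A + ρ) hp hW
  have hI := mutualInfo_le_log_card (mixture_mem_stdSimplex hp hW) (Prod.fst : U × Y → U) Prod.snd
  set E := randomCodingExponent (A + ρ) p W
  have h2 : -l * (E - ρ) ≤ Real.log φ := by rwa [Real.le_log_iff_exp_le hφ0]
  have h3 : Real.log φ < 0 := Real.log_neg hφ0 hφ1
  have hE : 0 < E := by
    have : 0 < l * (E - ρ) := by linarith
    have := pos_of_mul_pos_right this hl.le
    linarith
  -- As `E` is positive, the maximum bounding it must be attained by its information branch.
  have h4 : E ≤ Real.log (Fintype.card Y) - (A + ρ) := by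
    rcases le_max_iff.mp h1 with h | h <;> linarith
  have h5 := mul_le_mul_of_nonneg_left (by linarith : E - ρ ≤ Real.log (Fintype.card Y) - A) hl.le
  linarith

/-- A one-letter input alphabet carries no information. -/
lemma two_le_card_of_exp_le {Y : Type*} [Fintype Y] {p : U → ℝ} (hp : p ∈ stdSimplex ℝ U)
    {W : U → Y → ℝ} (hW : ∀ u, W u ∈ stdSimplex ℝ Y) {A ρ φ l : ℝ} (hl : 0 < l) (hA : 0 ≤ A)
    (hρ : 0 < ρ) (hφ0 : 0 < φ) (hφ1 : φ < 1)
    (h : Real.exp (-l * (randomCodingExponent (A + ρ) p W - ρ)) ≤ φ) :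
    2 ≤ Fintype.card U := by
  have h1 := randomCodingExponent_le_max (R := A + ρ) hp hW
  have hq := mixture_mem_stdSimplex hp hW
  have hI := mutualInfo_le_log_card hq (Prod.snd : U × Y → Y) Prod.fst
  rw [mutualInfo_comm hq.1] at hI
  set E := randomCodingExponent (A + ρ) p W
  have h2 : -l * (E - ρ) ≤ Real.log φ := by rwa [Real.le_log_iff_exp_le hφ0]
  have h3 : Real.log φ < 0 := Real.log_neg hφ0 hφ1
  have hE : 0 < E := by
    have : 0 < l * (E - ρ) := by linarith
    have := pos_of_mul_pos_right this hl.le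
    linarith
  by_contra hcard
  have h5 : Real.log (Fintype.card U) ≤ 0 := by
    refine Real.log_nonpos (by positivity) ?_
    exact_mod_cast (by omega : Fintype.card U ≤ 1)
  rcases le_max_iff.mp h1 with h | h <;> linarith

end Mixture

/-! ### Channel uses with auxiliary inputs, letter by letter and in blocks. -/

section ChannelBlock

variable {V₁ V₂ X₁ X₂ Y₁ Y₂ : Type*} [Fintype V₁] [Fintype V₂] [Fintype X₁] [Fintype X₂]
  [Fintype Y₁] [Fintype Y₂]

/-- One use of the channel with the two users' auxiliary inputs. -/
def useLaw (pV₁ : V₁ → ℝ) (pV₂ : V₂ → ℝ) (k₁ : V₁ → X₁ → ℝ) (k₂ : V₂ → X₂ → ℝ)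
    (W : X₁ → X₂ → Y₁ × Y₂ → ℝ) (ω : (V₁ × V₂) × (X₁ × X₂) × (Y₁ × Y₂)) : ℝ :=
  pV₁ ω.1.1 * pV₂ ω.1.2 * k₁ ω.1.1 ω.2.1.1 * k₂ ω.1.2 ω.2.1.2 * W ω.2.1.1 ω.2.1.2 ω.2.2

lemma useLaw_mem_stdSimplex {pV₁ : V₁ → ℝ} (hpV₁ : pV₁ ∈ stdSimplex ℝ V₁)
    {pV₂ : V₂ → ℝ} (hpV₂ : pV₂ ∈ stdSimplex ℝ V₂)
    {k₁ : V₁ → X₁ → ℝ} (hk₁ : ∀ v, k₁ v ∈ stdSimplex ℝ X₁)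
    {k₂ : V₂ → X₂ → ℝ} (hk₂ : ∀ v, k₂ v ∈ stdSimplex ℝ X₂)
    {W : X₁ → X₂ → Y₁ × Y₂ → ℝ} (hW : ∀ x₁ x₂, W x₁ x₂ ∈ stdSimplex ℝ (Y₁ × Y₂)) :
    useLaw pV₁ pV₂ k₁ k₂ W ∈ stdSimplex ℝ _ := by
  refine ⟨fun ω => mul_nonneg (mul_nonneg (mul_nonneg (mul_nonneg (hpV₁.1 _) (hpV₂.1 _))
    ((hk₁ _).1 _)) ((hk₂ _).1 _)) ((hW _ _).1 _), ?_⟩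
  unfold useLaw
  rw [Fintype.sum_prod_type, Fintype.sum_prod_type]
  simp_rw [fun v₁ v₂ => Fintype.sum_prod_type (fun x : (X₁ × X₂) × (Y₁ × Y₂) =>
    pV₁ v₁ * pV₂ v₂ * k₁ v₁ x.1.1 * k₂ v₂ x.1.2 * W x.1.1 x.1.2 x.2), ← Finset.mul_sum,
    (hW _ _).2, mul_one]
  simp_rw [fun v₁ v₂ => Fintype.sum_prod_type (fun x : X₁ × X₂ =>
    pV₁ v₁ * pV₂ v₂ * k₁ v₁ x.1 * k₂ v₂ x.2), ← Finset.mul_sum, (hk₂ _).2, mul_one,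
    ← Finset.mul_sum, (hk₁ _).2, mul_one, ← Finset.mul_sum, hpV₂.2, mul_one]
  exact hpV₁.2

/-- Rearranging a block of channel uses user by user. -/
def blockEquiv (L : ℕ) : (Fin L → (V₁ × V₂) × (X₁ × X₂) × (Y₁ × Y₂)) ≃
    ((Fin L → V₁) × (Fin L → X₁)) × ((Fin L → V₂) × (Fin L → X₂)) ×
      ((Fin L → Y₁) × (Fin L → Y₂)) where
  toFun ω := ((fun i => (ω i).1.1, fun i => (ω i).2.1.1),
    (fun i => (ω i).1.2, fun i => (ω i).2.1.2), (fun i => (ω i).2.2.1, fun i => (ω i).2.2.2))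
  invFun x i := ((x.1.1 i, x.2.1.1 i), (x.1.2 i, x.2.1.2 i), (x.2.2.1 i, x.2.2.2 i))
  left_inv _ := rfl
  right_inv _ := rfl

lemma sum_block_eq {L : ℕ} (w : Fin L → (V₁ × V₂) × (X₁ × X₂) × (Y₁ × Y₂) → ℝ)
    (F : ((Fin L → V₁) × (Fin L → X₁)) → ((Fin L → V₂) × (Fin L → X₂)) →
      ((Fin L → Y₁) × (Fin L → Y₂)) → ℝ) :
    ∑ a₁, ∑ a₂, ∑ z, (∏ i, w i ((a₁.1 i, a₂.1 i), (a₁.2 i, a₂.2 i), (z.1 i, z.2 i))) * F a₁ a₂ z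
      = ∑ ω : Fin L → (V₁ × V₂) × (X₁ × X₂) × (Y₁ × Y₂), (∏ i, w i (ω i)) *
        F (fun i => (ω i).1.1, fun i => (ω i).2.1.1) (fun i => (ω i).1.2, fun i => (ω i).2.1.2)
          (fun i => (ω i).2.2.1, fun i => (ω i).2.2.2) := by
  refine Eq.trans ?_ (Fintype.sum_equiv (blockEquiv L) _ (fun x => (∏ i, w i ((x.1.1 i, x.2.1.1 i),
    (x.1.2 i, x.2.1.2 i), (x.2.2.1 i, x.2.2.2 i))) * F x.1 x.2.1 x.2.2) fun ω => rfl).symm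
  symm
  rw [Fintype.sum_prod_type]
  refine Finset.sum_congr rfl fun a₁ _ => ?_
  rw [Fintype.sum_prod_type]

end ChannelBlock

/-! ### Positive drift at each receiver. -/

section Receiver

variable {S₁ S₂ S K U V Y R Msg : Type*} [Fintype S₁] [Fintype S₂] [Fintype S] [Fintype K]
  [Fintype U] [Fintype V] [Fintype Y] [Fintype R] [Fintype Msg]

/-- A receiver misses the bin of the first user's common part only if the two users disagree or the
inner code fails. -/
lemma bin_error_le {L : ℕ} {pS : S₁ × S₂ → ℝ} (hpS : pS ∈ stdSimplex ℝ (S₁ × S₂))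
    (f₁ : S₁ → K) (f₂ : S₂ → K) (b : (Fin L → K) → Msg) (T : Finset (Fin L → K))
    (c : Msg → Fin L → U) {Γ : U → U → V → Y → ℝ} (hΓ0 : ∀ u u' v y, 0 ≤ Γ u u' v y)
    (hΓ1 : ∀ u u', ∑ v, ∑ y, Γ u u' v y = 1) (dec : (Fin L → Y) → Msg) :
    ∑ ω : Fin L → S₁ × S₂, iid pS L ω * ∑ v : Fin L → V, ∑ y : Fin L → Y,
      (∏ i, Γ (c (b fun i => f₁ (ω i).1) i) (c (b fun i => f₂ (ω i).2) i) (v i) (y i)) *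
        (ind ((fun i => f₁ (ω i).1) ∈ T) * ind (dec y ≠ b fun i => f₁ (ω i).1))
      ≤ blockDisagreement pS f₁ f₂ L
        + ∑ m, law (iid pS L) (fun ω => b fun i => f₁ (ω i).1) m *
          ∑ y : Fin L → Y, (∏ i, ∑ v, Γ (c m i) (c m i) v (y i)) * ind (dec y ≠ m) := by
  have hiid := iid_mem_stdSimplex hpS L
  rw [sum_law (iid pS L) (fun ω => b fun i => f₁ (ω i).1) fun m =>
    ∑ y : Fin L → Y, (∏ i, ∑ v, Γ (c m i) (c m i) v (y i)) * ind (dec y ≠ m)]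
  have hd : blockDisagreement pS f₁ f₂ L
      = ∑ ω : Fin L → S₁ × S₂, iid pS L ω *
        ind ((fun i => f₁ (ω i).1) ≠ fun i => f₂ (ω i).2) := by
    unfold blockDisagreement prob ind
    refine Finset.sum_congr rfl fun ω _ => ?_
    by_cases h : (fun i => f₁ (ω i).1) = fun i => f₂ (ω i).2 <;> simp [Set.indicator, h]
  rw [hd, ← Finset.sum_add_distrib]
  refine Finset.sum_le_sum fun ω _ => ?_
  rw [← mul_add]
  refine mul_le_mul_of_nonneg_left ?_ (hiid.1 ω)
  set k₁ := fun i => f₁ (ω i).1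
  set k₂ := fun i => f₂ (ω i).2
  have hpt : ∀ y, ind (k₁ ∈ T) * ind (dec y ≠ b k₁) ≤ ind (dec y ≠ b k₁) := fun y =>
    mul_le_of_le_one_left (ind_nonneg _) (ind_le_one _)
  have hw0 : ∀ u u' : Fin L → U, ∀ (v : Fin L → V) (y : Fin L → Y),
      0 ≤ ∏ i, Γ (u i) (u' i) (v i) (y i) :=
    fun u u' v y => Finset.prod_nonneg fun i _ => hΓ0 _ _ _ _
  by_cases h : k₁ = k₂
  · have h0 : ind (k₁ ≠ k₁) = 0 := ind_not (not_not.mpr rfl)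
    rw [← h, h0, zero_add]
    calc _ ≤ ∑ v : Fin L → V, ∑ y : Fin L → Y,
          (∏ i, Γ (c (b k₁) i) (c (b k₁) i) (v i) (y i)) * ind (dec y ≠ b k₁) :=
          Finset.sum_le_sum fun v _ => Finset.sum_le_sum fun y _ =>
            mul_le_mul_of_nonneg_left (hpt y) (hw0 _ _ v y)
      _ = _ := by
          rw [Finset.sum_comm]
          refine Finset.sum_congr rfl fun y _ => ?_
          rw [← Finset.sum_mul, sum_fun_prod fun i v => Γ (c (b k₁) i) (c (b k₁) i) v (y i)]
  · rw [ind_of h]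
    have h1 : 0 ≤ ∑ y : Fin L → Y, (∏ i, ∑ v, Γ (c (b k₁) i) (c (b k₁) i) v (y i)) *
        ind (dec y ≠ b k₁) :=
      Finset.sum_nonneg fun y _ => mul_nonneg (Finset.prod_nonneg fun i _ =>
        Finset.sum_nonneg fun v _ => hΓ0 _ _ _ _) (ind_nonneg _)
    have h2 : ∑ v : Fin L → V, ∑ y : Fin L → Y,
        (∏ i, Γ (c (b k₁) i) (c (b k₂) i) (v i) (y i)) *
          (ind (k₁ ∈ T) * ind (dec y ≠ b k₁)) ≤ 1 := by
      rw [← sum_sum_prod_eq_one (w := fun i => Γ (c (b k₁) i) (c (b k₂) i)) fun i => hΓ1 _ _]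
      exact Finset.sum_le_sum fun v _ => Finset.sum_le_sum fun y _ =>
        mul_le_of_le_one_right (hw0 _ _ v y) ((hpt y).trans (ind_le_one _))
    linarith

/-- Under the hypothesis of the theorem the log-metric of a receiver has positive mean. -/
lemma receiver_drift_pos {l L n : ℕ} (hl : 1 ≤ l) (hLl : L = (Fintype.card U + 2) * l)
    {pS : S₁ × S₂ → ℝ} (hpS : pS ∈ stdSimplex ℝ (S₁ × S₂))
    (f₁ : S₁ → K) (f₂ : S₂ → K) (σ : S₁ × S₂ → S) {fU : Fin L → U} {pU : U → ℝ}
    (hpU : pU ∈ stdSimplex ℝ U) (hp : ∀ u, pU u = occurrences fU u / L)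
    {c : Msg → Fin L → U} (hc : ∀ m, c m ∈ typeClass fU)
    {r : U → U → R → ℝ} (hr : ∀ u u', r u u' ∈ stdSimplex ℝ R) (VV : R → V) (YY : R → Y)
    {Q : V × Y → ℝ} (hQ : ∀ v y, Q (v, y) = ∑ u, pU u * law (r u u) (fun ω => (VV ω, YY ω)) (v, y))
    {φ ψ A B β : ℝ} (hφ0 : 0 < φ) (hlam : 5 / 2 ≤ -Real.log φ)
    (hU : 2 ≤ Fintype.card U) (hY : 2 ≤ Fintype.card Y)
    (hψ : ψ = ((Fintype.card U : ℝ) + 2) * φ) (hψ1 : ψ ≤ 1 / 2)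
    (hly : -Real.log φ ≤ l * Real.log (Fintype.card Y)) (hAy : A ≤ Real.log (Fintype.card Y))
    (hβ : β ≤ 1 / 8 * (Fintype.card U * Fintype.card Y * φ * -Real.log φ))
    (hn : 0 < n) (hlogn : Real.log n ≤ L * (B + β))
    (hlogM : Real.log (Fintype.card Msg) ≤ L * A + 1.1)
    (h : B + condEntropy pS σ (fun s => f₁ s.1) + sourceLoss l φ (Fintype.card S)
      < mutualInfo Q Prod.fst Prod.snd - channelLoss (Fintype.card Y) φ (Fintype.card U))
    (T : Finset (Fin L → K)) (b : (Fin L → K) → Msg) (dec : (Fin L → Y) → Msg)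
    (hT : ∑ k : Fin L → K, (∏ i, law pS (fun s => f₁ s.1) (k i)) * ind (k ∉ T) ≤ φ)
    (herr : blockDisagreement pS f₁ f₂ L
        + ∑ m, law (iid pS L) (fun ω => b fun i => f₁ (ω i).1) m *
          ∑ y : Fin L → Y, (∏ i, law (r (c m i) (c m i)) YY (y i)) * ind (dec y ≠ m) ≤ ψ) :
    0 < ∑ ω : Fin L → S₁ × S₂, iid pS L ω * ∑ x : Fin L → R,
      (∏ i, r (c (b fun i => f₁ (ω i).1) i) (c (b fun i => f₂ (ω i).2) i) (x i)) *
        Real.log (channelMetric Q ψ (fun i => VV (x i)) (fun i => YY (x i)) *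
          sourceMetric T b n (condPmf pS σ fun s => f₁ s.1) φ ψ (dec fun i => YY (x i))
            (fun i => σ (ω i))) := by
  have hiid := iid_mem_stdSimplex hpS L
  have hL : 0 < L := by rw [hLl]; positivity
  have hφ := le_tenth_of_five_halves_le hφ0 hlam
  have hψ0 : 0 < ψ := by rw [hψ]; positivity
  have hneS : Nonempty S := by
    rcases isEmpty_or_nonempty (S₁ × S₂) with he | ⟨⟨s⟩⟩
    · have := hpS.2
      simp at this
    · exact ⟨σ s⟩
  -- Two codeword letters are kept because the users may have chosen different codewords; `Q`
  -- involves only the diagonal.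
  set Γ : U → U → V → Y → ℝ := fun u u' v y => law (r u u') (fun ω => (VV ω, YY ω)) (v, y) with hΓ
  have hΓ0 : ∀ u u' v y, 0 ≤ Γ u u' v y := fun u u' v y => law_nonneg (hr u u').1 _ _
  have hΓ1 : ∀ u u', ∑ v, ∑ y, Γ u u' v y = 1 := fun u u' => by
    rw [← (law_mem_stdSimplex (hr u u') fun ω => (VV ω, YY ω)).2, Fintype.sum_prod_type]
  have hΓv : ∀ u u' y, ∑ v, Γ u u' v y = law (r u u') YY y := fun u u' y => by
    simp only [hΓ]
    rw [← law_snd, law_law]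
  have hQs : Q ∈ stdSimplex ℝ (V × Y) := by
    refine ⟨fun x => ?_, ?_⟩
    · rw [← Prod.mk.eta (p := x), hQ]
      exact Finset.sum_nonneg fun u _ => mul_nonneg (hpU.1 u) (hΓ0 u u _ _)
    · rw [Fintype.sum_prod_type]
      simp_rw [hQ]
      have : ∀ v : V, ∑ y : Y, ∑ u, pU u * law (r u u) (fun ω => (VV ω, YY ω)) (v, y)
          = ∑ u, pU u * ∑ y, Γ u u v y := fun v => by
        rw [Finset.sum_comm]; simp_rw [Finset.mul_sum]; rfl
      simp_rw [this]
      rw [Finset.sum_comm]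
      simp_rw [← Finset.mul_sum, hΓ1, mul_one]
      exact hpU.2
  have hI0 : 0 ≤ mutualInfo Q Prod.fst Prod.snd := mutualInfo_nonneg hQs _ _
  have hIy := mutualInfo_le_log_card hQs (Prod.fst : V × Y → V) Prod.snd
  have hE₁ : ∑ ω : Fin L → S₁ × S₂, iid pS L ω *
      ind ((b fun i => f₁ (ω i).1) ≠ b fun i => f₂ (ω i).2) ≤ ψ := by
    refine le_trans ?_ herr
    refine le_add_of_le_of_nonneg ?_ ?_
    · rw [blockDisagreement, prob]
      refine Finset.sum_le_sum fun ω _ => ?_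
      by_cases hk : (fun i => f₁ (ω i).1) = fun i => f₂ (ω i).2
      · rw [ind_not (by rw [hk]; simp), mul_zero]
        exact Set.indicator_nonneg (fun x _ => hiid.1 x) ω
      · rw [Set.indicator_of_mem (by exact hk)]
        exact mul_le_of_le_one_right (hiid.1 ω) (ind_le_one _)
    · exact Finset.sum_nonneg fun m _ => mul_nonneg (law_nonneg hiid.1 _ _)
        (Finset.sum_nonneg fun y _ => mul_nonneg (Finset.prod_nonneg fun i _ =>
          law_nonneg (hr _ _).1 _ _) (ind_nonneg _))
  have hE₂ := bin_error_le hpS f₁ f₂ b T c hΓ0 hΓ1 dec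
  simp_rw [hΓv] at hE₂
  have hE₂' := hE₂.trans herr
  have hE₃ : ∑ ω : Fin L → S₁ × S₂, iid pS L ω * ind ((fun i => f₁ (ω i).1) ∉ T) ≤ φ := by
    refine le_trans (le_of_eq ?_) hT
    exact sum_prod_mul_comp (fun _ : Fin L => pS) (fun s => f₁ s.1) fun k => ind (k ∉ T)
  have hPk : ∀ ω : Fin L → S₁ × S₂, iid pS L ω ≠ 0 → ∀ i,
      0 < condPmf pS σ (fun s => f₁ s.1) (f₁ (ω i).1) (σ (ω i)) := by
    intro ω hω i
    have h0 : pS (ω i) ≠ 0 := Finset.prod_ne_zero_iff.mp hω i (Finset.mem_univ i)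
    exact condPmf_pos hpS.1 σ (fun s => f₁ s.1) (lt_of_le_of_ne (hpS.1 _) (Ne.symm h0))
  have hdrift := le_drift (Ω := Fin L → S₁ × S₂) hL hp hc hΓ0 hΓ1 hQ hI0 hφ0 (by linarith) hψ0
    (by linarith) (T := T) (b := b) hn (P := condPmf pS σ fun s => f₁ s.1)
    (fun k s => condPmf_nonneg hpS.1 _ _ _ _) (fun k s => condPmf_le_one hpS.1 _ _ _ _) hiid
    (fun ω => b fun i => f₁ (ω i).1) (fun ω => b fun i => f₂ (ω i).2) (fun ω i => f₁ (ω i).1)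
    (fun ω i => σ (ω i)) dec hPk hE₁ hE₂' hE₃
  have hmarg : ∀ (ω : Fin L → S₁ × S₂), ∑ v : Fin L → V, ∑ y : Fin L → Y,
      (∏ i, Γ (c (b fun i => f₁ (ω i).1) i) (c (b fun i => f₂ (ω i).2) i) (v i) (y i)) *
        Real.log (channelMetric Q ψ v y *
          sourceMetric T b n (condPmf pS σ fun s => f₁ s.1) φ ψ (dec y) (fun i => σ (ω i)))
      = ∑ x : Fin L → R,
      (∏ i, r (c (b fun i => f₁ (ω i).1) i) (c (b fun i => f₂ (ω i).2) i) (x i)) *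
        Real.log (channelMetric Q ψ (fun i => VV (x i)) (fun i => YY (x i)) *
          sourceMetric T b n (condPmf pS σ fun s => f₁ s.1) φ ψ (dec fun i => YY (x i))
            (fun i => σ (ω i))) := by
    intro ω
    rw [sum_prod_mul_comp (fun i => r (c (b fun i => f₁ (ω i).1) i)
        (c (b fun i => f₂ (ω i).2) i)) (fun x => (VV x, YY x))
      (fun vy => Real.log (channelMetric Q ψ (fun i => (vy i).1) (fun i => (vy i).2) *
          sourceMetric T b n (condPmf pS σ fun s => f₁ s.1) φ ψ (dec fun i => (vy i).2)
            (fun i => σ (ω i)))), ← Fintype.sum_prod_type']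
    exact Fintype.sum_equiv (Equiv.arrowProdEquivProdArrow _ _ _).symm _ _ fun x => rfl
  simp_rw [hmarg] at hdrift
  refine lt_of_lt_of_le ?_ hdrift
  -- The mean of the log-conditional probability of the source block given its common part is `-L
  -- H(S_j | K₁)`.
  rw [sum_iid_mul_sum hpS L fun s => Real.log (condPmf pS σ (fun s => f₁ s.1) (f₁ s.1) (σ s)),
    sum_mul_log_condPmf hpS.1 σ fun s => f₁ s.1]
  have hM0 : (Fintype.card Msg : ℝ) ≠ 0 := by
    have : Nonempty Msg := ⟨dec fun _ => (Fintype.card_pos_iff.mp (by omega)).some⟩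
    exact_mod_cast Fintype.card_pos.ne'
  rw [Real.log_div hψ0.ne' hM0]
  have hbud := budget_pos (L := L) (l := l) (t := (Fintype.card U : ℝ) + 2)
    (logS := Real.log (Fintype.card S)) (H := condEntropy pS σ fun s => f₁ s.1)
    (hb := Real.binEntropy φ) hφ0 hlam
    (by exact_mod_cast hU) (by exact_mod_cast hY) rfl (by exact_mod_cast hl)
    (by rw [hLl]; push_cast; ring) hψ hψ1 hly hAy hIy hβ hlogn hlogM
    (mul_neg_log_le_binEntropy hφ0 (by linarith)) (by
      unfold sourceLoss channelLoss at h
      rwa [one_div, Real.log_inv] at h)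
  linarith

end Receiver

/-! ### Super-letter source, encoders and channel. -/

section BlockPieces

variable {S₁ S₂ S K U V₁ V₂ V X₁ X₂ X Y₁ Y₂ Y Msg : Type*} [Fintype S₁] [Fintype S₂] [Fintype S]
  [Fintype K] [Fintype U] [Fintype V₁] [Fintype V₂] [Fintype V] [Fintype X₁] [Fintype X₂]
  [Fintype X] [Fintype Y₁] [Fintype Y₂] [Fintype Y] [Fintype Msg]

/-- A type of length `l` is also a type of length `t * l`. -/
lemma exists_repeat_type {p : U → ℝ} {l : ℕ} (h : IsTypeOfLength p l) {t : ℕ} (ht : 0 < t) :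
    ∃ f : Fin (t * l) → U, ∀ u, p u = occurrences f u / (t * l : ℕ) := by
  obtain ⟨g, hg⟩ := h
  refine ⟨fun i => g (finProdFinEquiv.symm i).2, fun u => ?_⟩
  have h1 : occurrences (fun i : Fin (t * l) => g (finProdFinEquiv.symm i).2) u
      = t * Nat.card {i // g i = u} := by
    have e : {i : Fin (t * l) // g (finProdFinEquiv.symm i).2 = u} ≃ Fin t × {i // g i = u} :=
      { toFun := fun i => ((finProdFinEquiv.symm i.1).1, ⟨(finProdFinEquiv.symm i.1).2, i.2⟩)
        invFun := fun x => ⟨finProdFinEquiv (x.1, x.2.1), by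
          rw [Equiv.symm_apply_apply]; exact x.2.2⟩
        left_inv := fun i => Subtype.ext (Equiv.apply_symm_apply finProdFinEquiv i.1)
        right_inv := fun x => by
          refine Prod.ext ?_ (Subtype.ext ?_) <;> simp only [Equiv.symm_apply_apply] }
    rw [occurrences, Nat.card_congr e]
    rw [Nat.card_prod, Nat.card_eq_fintype_card, Fintype.card_fin]
  rw [h1, hg]
  push_cast
  have : (t : ℝ) ≠ 0 := by positivity
  rw [mul_div_mul_left _ _ this]

/-- The random inputs of one user over a block, given the codeword `u`. -/
def userKernel {L : ℕ} (pV : V → ℝ) (pX : U → V → X → ℝ) (u : Fin L → U)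
    (a : (Fin L → V) × (Fin L → X)) : ℝ := ∏ i, pV (a.1 i) * pX (u i) (a.1 i) (a.2 i)

/-- Only `X` depends on the codeword; `V` has the same law for every source block. This lets the
metric be normalised without knowing which codeword was sent. -/
lemma sum_userKernel {L : ℕ} (pV : V → ℝ) {pX : U → V → X → ℝ} (hpX : ∀ u v, pX u v ∈ stdSimplex ℝ X)
    (u : Fin L → U) (v : Fin L → V) : ∑ x, userKernel pV pX u (v, x) = ∏ i, pV (v i) := by
  unfold userKernel
  simp only
  rw [sum_fun_prod fun i x => pV (v i) * pX (u i) (v i) x]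
  simp_rw [← Finset.mul_sum, (hpX _ _).2, mul_one]

lemma userKernel_mem_stdSimplex {L : ℕ} {pV : V → ℝ} (hpV : pV ∈ stdSimplex ℝ V)
    {pX : U → V → X → ℝ} (hpX : ∀ u v, pX u v ∈ stdSimplex ℝ X) (u : Fin L → U) :
    userKernel pV pX u ∈ stdSimplex ℝ ((Fin L → V) × (Fin L → X)) := by
  refine ⟨fun a => Finset.prod_nonneg fun i _ => mul_nonneg (hpV.1 _) ((hpX _ _).1 _), ?_⟩
  rw [Fintype.sum_prod_type]
  simp_rw [sum_userKernel pV hpX]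
  exact sum_fun_prod_eq_one (fun _ => pV) fun _ => hpV.2

/-- The channel over a block, with outputs collected receiver by receiver. -/
def blockChannel (W : X₁ → X₂ → Y₁ × Y₂ → ℝ) {L : ℕ} (x₁ : Fin L → X₁) (x₂ : Fin L → X₂)
    (z : (Fin L → Y₁) × (Fin L → Y₂)) : ℝ := ∏ i, W (x₁ i) (x₂ i) (z.1 i, z.2 i)

lemma blockChannel_mem_stdSimplex {W : X₁ → X₂ → Y₁ × Y₂ → ℝ}
    (hW : ∀ x₁ x₂, W x₁ x₂ ∈ stdSimplex ℝ (Y₁ × Y₂)) {L : ℕ} (x₁ : Fin L → X₁) (x₂ : Fin L → X₂) :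
    blockChannel W x₁ x₂ ∈ stdSimplex ℝ ((Fin L → Y₁) × (Fin L → Y₂)) := by
  refine ⟨fun z => Finset.prod_nonneg fun i _ => (hW _ _).1 _, ?_⟩
  rw [← sum_fun_prod_eq_one (fun i => W (x₁ i) (x₂ i)) fun i => (hW _ _).2]
  exact Fintype.sum_equiv (Equiv.arrowProdEquivProdArrow _ _ _).symm _ _ fun z => rfl

/-- The joint source pmf of a block, with letters collected user by user. -/
def blockSource (pS : S₁ × S₂ → ℝ) {L : ℕ} (s₁ : Fin L → S₁) (s₂ : Fin L → S₂) : ℝ :=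
  ∏ i, pS (s₁ i, s₂ i)

lemma blockSource_nonneg {pS : S₁ × S₂ → ℝ} (hpS : pS ∈ stdSimplex ℝ (S₁ × S₂)) {L : ℕ}
    (s₁ : Fin L → S₁) (s₂ : Fin L → S₂) : 0 ≤ blockSource pS s₁ s₂ :=
  Finset.prod_nonneg fun _ _ => hpS.1 _

lemma sum_blockSource_mul (pS : S₁ × S₂ → ℝ) {L : ℕ} (F : (Fin L → S₁) → (Fin L → S₂) → ℝ) :
    ∑ s₁ : Fin L → S₁, ∑ s₂ : Fin L → S₂, blockSource pS s₁ s₂ * F s₁ s₂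
      = ∑ ω : Fin L → S₁ × S₂, iid pS L ω * F (fun i => (ω i).1) (fun i => (ω i).2) := by
  rw [← Fintype.sum_prod_type']
  exact Fintype.sum_equiv (Equiv.arrowProdEquivProdArrow _ _ _).symm _ _ fun z => rfl

lemma sum_blockSource {pS : S₁ × S₂ → ℝ} (hpS : pS ∈ stdSimplex ℝ (S₁ × S₂)) (L : ℕ) :
    ∑ s₁ : Fin L → S₁, ∑ s₂ : Fin L → S₂, blockSource pS s₁ s₂ = 1 := by
  have := sum_blockSource_mul pS (L := L) fun _ _ => 1
  simp_rw [mul_one] at this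
  rw [this]
  exact (iid_mem_stdSimplex hpS L).2

/-- The expectation over a block in terms of single channel uses. -/
lemma sum_block_expectation {L : ℕ} (pS : S₁ × S₂ → ℝ) (pV₁ : V₁ → ℝ) (pV₂ : V₂ → ℝ)
    (pX₁ : U → V₁ → X₁ → ℝ) (pX₂ : U → V₂ → X₂ → ℝ) (W : X₁ → X₂ → Y₁ × Y₂ → ℝ)
    (u₁ : (Fin L → S₁) → Fin L → U) (u₂ : (Fin L → S₂) → Fin L → U)
    (F : (Fin L → S₁) → (Fin L → S₂) → ((Fin L → V₁) × (Fin L → X₁)) →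
      ((Fin L → V₂) × (Fin L → X₂)) → ((Fin L → Y₁) × (Fin L → Y₂)) → ℝ) :
    ∑ s₁, ∑ s₂, ∑ a₁, ∑ a₂, ∑ z, blockSource pS s₁ s₂ * userKernel pV₁ pX₁ (u₁ s₁) a₁ *
        userKernel pV₂ pX₂ (u₂ s₂) a₂ * blockChannel W a₁.2 a₂.2 z * F s₁ s₂ a₁ a₂ z
      = ∑ ω : Fin L → S₁ × S₂, iid pS L ω *
        ∑ x : Fin L → (V₁ × V₂) × (X₁ × X₂) × (Y₁ × Y₂),
          (∏ i, useLaw pV₁ pV₂ (pX₁ (u₁ (fun i => (ω i).1) i)) (pX₂ (u₂ (fun i => (ω i).2) i))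
            W (x i)) *
          F (fun i => (ω i).1) (fun i => (ω i).2)
            (fun i => (x i).1.1, fun i => (x i).2.1.1) (fun i => (x i).1.2, fun i => (x i).2.1.2)
            (fun i => (x i).2.2.1, fun i => (x i).2.2.2) := by
  rw [← sum_blockSource_mul pS fun s₁ s₂ => ∑ x : Fin L → (V₁ × V₂) × (X₁ × X₂) × (Y₁ × Y₂),
    (∏ i, useLaw pV₁ pV₂ (pX₁ (u₁ s₁ i)) (pX₂ (u₂ s₂ i)) W (x i)) *
      F s₁ s₂ (fun i => (x i).1.1, fun i => (x i).2.1.1) (fun i => (x i).1.2, fun i => (x i).2.1.2)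
        (fun i => (x i).2.2.1, fun i => (x i).2.2.2)]
  refine Finset.sum_congr rfl fun s₁ _ => Finset.sum_congr rfl fun s₂ _ => ?_
  rw [← sum_block_eq (fun i => useLaw pV₁ pV₂ (pX₁ (u₁ s₁ i)) (pX₂ (u₂ s₂ i)) W) (F s₁ s₂)]
  simp_rw [Finset.mul_sum]
  refine Finset.sum_congr rfl fun a₁ _ => Finset.sum_congr rfl fun a₂ _ =>
    Finset.sum_congr rfl fun z _ => ?_
  have h1 : userKernel pV₁ pX₁ (u₁ s₁) a₁ * userKernel pV₂ pX₂ (u₂ s₂) a₂ *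
      blockChannel W a₁.2 a₂.2 z = ∏ i, useLaw pV₁ pV₂ (pX₁ (u₁ s₁ i)) (pX₂ (u₂ s₂ i)) W
        ((a₁.1 i, a₂.1 i), (a₁.2 i, a₂.2 i), (z.1 i, z.2 i)) := by
    unfold userKernel blockChannel
    rw [← Finset.prod_mul_distrib, ← Finset.prod_mul_distrib]
    refine Finset.prod_congr rfl fun i _ => ?_
    simp only [useLaw]
    ring
  rw [← h1]
  ring

/-- The decoding metric of a receiver is a sub-probability density. -/
lemma sum_metric_le {L n : ℕ} {Q : V × Y → ℝ} (hQ : Q ∈ stdSimplex ℝ (V × Y)) {pV : V → ℝ}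
    (hQV : law Q Prod.fst = pV) {φ ψ : ℝ} (hφ0 : 0 ≤ φ) (hφ1 : φ ≤ 1) (hψ0 : 0 ≤ ψ) (hψ1 : ψ ≤ 1)
    {T : Finset (Fin L → K)} {b : (Fin L → K) → Msg} (hn : 0 < n)
    (hb : ∀ m, (T.filter fun k => b k = m).card ≤ n) (hT : T.card ≤ Fintype.card Msg * n)
    {P : K → S → ℝ} (hP0 : ∀ k s, 0 ≤ P k s) (hP1 : ∀ k, ∑ s, P k s ≤ 1)
    (dec : (Fin L → Y) → Msg) (y : Fin L → Y) :
    ∑ s : Fin L → S, ∑ v : Fin L → V, (∏ i, pV (v i)) *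
      (channelMetric Q ψ v y * sourceMetric T b n P φ ψ (dec y) s) ≤ 1 := by
  have h1 := sum_channelMetric_le hQ hψ1 y
  have h2 := sum_sourceMetric_le hn hb hT hP0 hP1 hφ0 hφ1 hψ0 hψ1 (dec y)
  rw [hQV] at h1
  have h0 : 0 ≤ ∑ s : Fin L → S, sourceMetric T b n P φ ψ (dec y) s :=
    Finset.sum_nonneg fun s _ => le_trans (by positivity) (le_sourceMetric hP0 hφ1 hψ0 hψ1 _ s)
  calc _ = (∑ v : Fin L → V, (∏ i, pV (v i)) * channelMetric Q ψ v y) *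
        ∑ s : Fin L → S, sourceMetric T b n P φ ψ (dec y) s := by
        rw [Finset.sum_mul_sum, Finset.sum_comm]
        exact Finset.sum_congr rfl fun v _ => Finset.sum_congr rfl fun s _ => by ring
    _ ≤ 1 * 1 := mul_le_mul h1 h2 h0 zero_le_one
    _ = 1 := one_mul 1

lemma jointPmf_eq (pU : U → ℝ) (pV₁ : V₁ → ℝ) (pV₂ : V₂ → ℝ) (pX₁ : U → V₁ → X₁ → ℝ)
    (pX₂ : U → V₂ → X₂ → ℝ) (W : X₁ → X₂ → Y₁ × Y₂ → ℝ) :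
    jointPmf pU pV₁ pV₂ pX₁ pX₂ W
      = fun ω => pU ω.1 * useLaw pV₁ pV₂ (pX₁ ω.1) (pX₂ ω.1) W ω.2 := by
  funext ω
  simp only [jointPmf, useLaw]
  ring

lemma law_useLaw_left {pV₁ : V₁ → ℝ} {pV₂ : V₂ → ℝ} (hpV₂ : pV₂ ∈ stdSimplex ℝ V₂)
    {k₁ : V₁ → X₁ → ℝ} (hk₁ : ∀ v, k₁ v ∈ stdSimplex ℝ X₁)
    {k₂ : V₂ → X₂ → ℝ} (hk₂ : ∀ v, k₂ v ∈ stdSimplex ℝ X₂)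
    {W : X₁ → X₂ → Y₁ × Y₂ → ℝ} (hW : ∀ x₁ x₂, W x₁ x₂ ∈ stdSimplex ℝ (Y₁ × Y₂)) (v : V₁) :
    law (useLaw pV₁ pV₂ k₁ k₂ W) (fun ω => ω.1.1) v = pV₁ v := by
  rw [law_eq, Fintype.sum_prod_type, Fintype.sum_prod_type]
  unfold useLaw
  simp only
  have h1 : ∀ v₁ v₂, ∑ x : (X₁ × X₂) × (Y₁ × Y₂),
      pV₁ v₁ * pV₂ v₂ * k₁ v₁ x.1.1 * k₂ v₂ x.1.2 * W x.1.1 x.1.2 x.2 * ind (v₁ = v)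
      = pV₁ v₁ * pV₂ v₂ * ind (v₁ = v) := by
    intro v₁ v₂
    rw [Fintype.sum_prod_type]
    simp only
    simp_rw [← Finset.sum_mul, ← Finset.mul_sum, (hW _ _).2, mul_one]
    rw [Fintype.sum_prod_type]
    simp only
    simp_rw [← Finset.mul_sum, (hk₂ _).2, mul_one, ← Finset.mul_sum, (hk₁ _).2, mul_one]
  simp_rw [h1, ← Finset.sum_mul, ← Finset.mul_sum, hpV₂.2, mul_one]
  refine (Finset.sum_eq_single v ?_ (by simp)).trans (by simp [ind])
  intro v' _ h
  rw [ind_not h, mul_zero]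

lemma law_useLaw_right {pV₁ : V₁ → ℝ} (hpV₁ : pV₁ ∈ stdSimplex ℝ V₁) {pV₂ : V₂ → ℝ}
    {k₁ : V₁ → X₁ → ℝ} (hk₁ : ∀ v, k₁ v ∈ stdSimplex ℝ X₁)
    {k₂ : V₂ → X₂ → ℝ} (hk₂ : ∀ v, k₂ v ∈ stdSimplex ℝ X₂)
    {W : X₁ → X₂ → Y₁ × Y₂ → ℝ} (hW : ∀ x₁ x₂, W x₁ x₂ ∈ stdSimplex ℝ (Y₁ × Y₂)) (v : V₂) :
    law (useLaw pV₁ pV₂ k₁ k₂ W) (fun ω => ω.1.2) v = pV₂ v := by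
  rw [law_eq, Fintype.sum_prod_type, Fintype.sum_prod_type]
  unfold useLaw
  simp only
  have h1 : ∀ v₁ v₂, ∑ x : (X₁ × X₂) × (Y₁ × Y₂),
      pV₁ v₁ * pV₂ v₂ * k₁ v₁ x.1.1 * k₂ v₂ x.1.2 * W x.1.1 x.1.2 x.2 * ind (v₂ = v)
      = pV₁ v₁ * (pV₂ v₂ * ind (v₂ = v)) := by
    intro v₁ v₂
    rw [Fintype.sum_prod_type]
    simp only
    simp_rw [← Finset.sum_mul, ← Finset.mul_sum, (hW _ _).2, mul_one]
    rw [Fintype.sum_prod_type]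
    simp only
    simp_rw [← Finset.mul_sum, (hk₂ _).2, mul_one, ← Finset.mul_sum, (hk₁ _).2, mul_one]
    ring
  simp_rw [h1, ← Finset.mul_sum]
  rw [← Finset.sum_mul, hpV₁.2, one_mul]
  refine (Finset.sum_eq_single v ?_ (by simp)).trans (by simp [ind])
  intro v' _ h
  rw [ind_not h, mul_zero]

end BlockPieces

/-! ### Consequences of the hypotheses for the parameters. -/

section Parameters

/-- Since `log y ≤ 0.368 y`, the loss term alone forces `a φ log (1/φ) < 0.368`, and then `φ log
(1/φ) < 0.184` because `a ≥ 2`. -/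
lemma small_of_loss_lt {φ a y : ℝ} (hφ0 : 0 < φ) (hφ : φ < 1 / 2) (ha : 2 ≤ a) (hy : 0 < y)
    (h : y * a * φ * -Real.log φ < Real.log y) :
    5 / 2 ≤ -Real.log φ ∧ (a + 2) * φ ≤ 1 / 2 := by
  set lam := -Real.log φ with hlamdef
  have hlam0 : 0 < lam := by
    rw [hlamdef, neg_pos]
    exact Real.log_neg hφ0 (by linarith)
  have h1 : a * (φ * lam) < 0.368 := by
    have h2 := h.trans_le (log_le_mul hy)
    have h3 : y * (a * (φ * lam)) < y * 0.368 := by linarith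
    exact lt_of_mul_lt_mul_left h3 hy.le
  have h2 : 2 * (φ * lam) ≤ a * (φ * lam) := mul_le_mul_of_nonneg_right ha (by positivity)
  have h3 : 5 / 2 ≤ lam := five_halves_le_neg_log hφ0 hφ (by linarith)
  refine ⟨h3, ?_⟩
  have h4 : a * φ * (5 / 2) ≤ a * φ * lam := mul_le_mul_of_nonneg_left h3 (by positivity)
  nlinarith

/-- As `log (1/φ) ≤ l (E - ρ)`, the allowance for the polynomial factor uses up at most `a + 1` of
the `a + 2` sub-blocks. This fixes the choice of `L`. -/
lemma inner_error_le {E ρ φ a l L : ℝ} (ha : 0 ≤ a) (hl : 0 < l) (hρ : 0 < ρ) (hφ0 : 0 < φ)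
    (hL : L = (a + 2) * l) (h : Real.exp (-l * (E - ρ)) ≤ φ) :
    Real.exp ((a + 1) * -Real.log φ - L * E) ≤ Real.exp (-l * (E - ρ)) := by
  rw [← Real.le_log_iff_exp_le hφ0] at h
  rw [Real.exp_le_exp, hL]
  have h1 : (a + 1) * -Real.log φ ≤ (a + 1) * (l * (E - ρ)) :=
    mul_le_mul_of_nonneg_left (by linarith) (by linarith)
  have h2 : 0 ≤ a * (l * ρ) := by positivity
  have h3 : 0 ≤ l * ρ := by positivity
  nlinarith

/-- The factor `2` from rounding the bin size and the polynomial number of types are absorbed by the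
rate reduction `β` together with the allowance `(a + 1) log (1/φ)`. -/
lemma message_count_le {M φ y A ρ L β : ℝ} {a : ℕ} (hφ0 : 0 < φ) (hlam : 5 / 2 ≤ -Real.log φ)
    (hy : 2 ≤ y) (hL : 1 ≤ L) (hρ : 0 < ρ) (hβ : β = 1 / 8 * (a * y * φ * -Real.log φ))
    (hM : M ≤ 2 * Real.exp (L * (A - β))) :
    M * (L + 1) ^ a ≤ Real.exp (L * (A + ρ) + ((a : ℝ) + 1) * -Real.log φ) := by
  have h1 := log_two_add_mul_log_le hφ0 hlam (Nat.cast_nonneg a) hy hL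
  have hL1 : 0 < L + 1 := by linarith
  have h2 : (L + 1) ^ a = Real.exp (a * Real.log (L + 1)) := by
    rw [mul_comm, Real.exp_mul, Real.exp_log hL1, Real.rpow_natCast]
  calc M * (L + 1) ^ a ≤ 2 * Real.exp (L * (A - β)) * (L + 1) ^ a := by gcongr
    _ = Real.exp (Real.log 2 + L * (A - β) + a * Real.log (L + 1)) := by
        rw [h2, Real.exp_add, Real.exp_add, Real.exp_log (by norm_num)]
    _ ≤ _ := by
        rw [Real.exp_le_exp]
        have h3 : 0 ≤ L * ρ := by positivity
        rw [← hβ] at h1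
        linarith

/-- All other terms of the hypothesis are nonnegative and the information is at most the logarithm
of the output alphabet. The outcome is the input of `small_of_loss_lt`. -/
lemma loss_lt_log_card {Ω α β γ δ : Type*} [Fintype Ω] [Fintype α] [Fintype β] [Fintype γ]
    [Fintype δ] {p : Ω → ℝ} (hp : ∀ ω, 0 ≤ p ω) (X : Ω → α) (Z : Ω → β) {Q : γ × δ → ℝ}
    (hQ : Q ∈ stdSimplex ℝ (γ × δ)) {B φ : ℝ} (hB : 0 ≤ B) (hφ0 : 0 < φ) (hφ1 : φ < 1) {l s u : ℕ}
    (h : B + condEntropy p X Z + sourceLoss l φ s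
      < mutualInfo Q Prod.fst Prod.snd - channelLoss (Fintype.card δ) φ u) :
    (Fintype.card δ : ℝ) * u * φ * -Real.log φ < Real.log (Fintype.card δ) := by
  have h1 := condEntropy_nonneg hp X Z
  have h2 := mutualInfo_le_log_card hQ (Prod.fst : γ × δ → γ) Prod.snd
  have h3 := Real.binEntropy_nonneg hφ0.le hφ1.le
  have h4 : 0 ≤ φ * Real.log s := mul_nonneg hφ0.le (Real.log_natCast_nonneg s)
  have h5 : 0 ≤ φ * Real.log u := mul_nonneg hφ0.le (Real.log_natCast_nonneg u)
  have h6 : 0 ≤ Real.binEntropy φ / l := by positivity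
  unfold sourceLoss channelLoss at h
  rw [one_div, Real.log_inv] at h
  linarith

lemma two_le_card_of_log_pos {α : Type*} [Fintype α] (h : 0 < Real.log (Fintype.card α)) :
    2 ≤ Fintype.card α := by
  by_contra hc
  have : (Fintype.card α : ℝ) ≤ 1 := by exact_mod_cast (by omega : Fintype.card α ≤ 1)
  exact absurd h (not_lt.mpr (Real.log_nonpos (by positivity) this))

end Parameters

/-! ### Construction of the super-letter code. -/

section BlockCode

variable {S₁ S₂ X₁ X₂ Y₁ Y₂ K U V₁ V₂ : Type*}
    [Fintype S₁] [Fintype S₂] [Fintype X₁] [Fintype X₂] [Fintype Y₁] [Fintype Y₂]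
    [Fintype K] [Fintype U] [Fintype V₁] [Fintype V₂]

set_option maxHeartbeats 1600000 in
/-- The hypotheses of the theorem give reliable codes over super-letters of some fixed length
`L`, each carrying `r` additional source letters per codeword. -/
theorem exists_block_code
    (pS : S₁ × S₂ → ℝ) (hpS : pS ∈ stdSimplex ℝ (S₁ × S₂))
    (W : X₁ → X₂ → Y₁ × Y₂ → ℝ) (hW : ∀ x₁ x₂, W x₁ x₂ ∈ stdSimplex ℝ (Y₁ × Y₂))
    (f₁ : S₁ → K) (f₂ : S₂ → K)
    (l : ℕ) (hl : 1 ≤ l) (δ : ℝ) (hδ : 0 < δ)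
    (pU : U → ℝ) (hpU : pU ∈ stdSimplex ℝ U) (hpU_type : IsTypeOfLength pU l)
    (pV₁ : V₁ → ℝ) (hpV₁ : pV₁ ∈ stdSimplex ℝ V₁)
    (pV₂ : V₂ → ℝ) (hpV₂ : pV₂ ∈ stdSimplex ℝ V₂)
    (pX₁ : U → V₁ → X₁ → ℝ) (hpX₁ : ∀ u v, pX₁ u v ∈ stdSimplex ℝ X₁)
    (pX₂ : U → V₂ → X₂ → ℝ) (hpX₂ : ∀ u v, pX₂ u v ∈ stdSimplex ℝ X₂)
    (A B ρ : ℝ) (hA : 0 ≤ A) (hB : 0 ≤ B) (hρ : 0 < ρ)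
    (q : U × (V₁ × V₂) × (X₁ × X₂) × (Y₁ × Y₂) → ℝ)
    (hq : q = jointPmf pU pV₁ pV₂ pX₁ pX₂ W)
    (φ : ℝ)
    (hφ_def : φ = innerCodeError q A ρ l + blockDisagreement pS f₁ f₂ l
      + atypicalityBound (law pS fun s => f₁ s.1) l δ)
    (hφ : φ < 1 / 2)
    (hAB : (1 + δ) * entropy pS (fun s => f₁ s.1) ≤ A + B)
    (h₁ : B + condEntropy pS (fun s => s.1) (fun s => f₁ s.1)
        + sourceLoss l φ (Fintype.card S₁)
      < mutualInfo q (fun ω => ω.2.1.1) (fun ω => ω.2.2.2.1)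
        - channelLoss (Fintype.card Y₁) φ (Fintype.card U))
    (h₂ : B + condEntropy pS (fun s => s.2) (fun s => f₁ s.1)
        + sourceLoss l φ (Fintype.card S₂)
      < mutualInfo q (fun ω => ω.2.1.2) (fun ω => ω.2.2.2.2)
        - channelLoss (Fintype.card Y₂) φ (Fintype.card U)) :
    ∃ L : ℕ, 0 < L ∧ ∀ (r : ℕ) (ε : ℝ), 0 < ε → ∃ m₀ : ℕ, ∀ m ≥ m₀,
      ∃ (e₁ : (Fin m → Fin L → S₁) × (Fin r → S₁) → Fin m → Fin L → X₁)
        (e₂ : (Fin m → Fin L → S₂) × (Fin r → S₂) → Fin m → Fin L → X₂)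
        (d₁ : (Fin m → Fin L → Y₁) → (Fin m → Fin L → S₁) × (Fin r → S₁))
        (d₂ : (Fin m → Fin L → Y₂) → (Fin m → Fin L → S₂) × (Fin r → S₂)),
        ∑ w₁, ∑ w₂, ∑ z : Fin m → (Fin L → Y₁) × (Fin L → Y₂),
          (∏ i, blockSource pS (w₁.1 i) (w₂.1 i)) * blockSource pS w₁.2 w₂.2 *
            (∏ i, blockChannel W (e₁ w₁ i) (e₂ w₂ i) (z i)) *
          ind (d₁ (fun i => (z i).1) ≠ w₁ ∨ d₂ (fun i => (z i).2) ≠ w₂) ≤ ε := by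
  have hl0 : (0 : ℝ) < l := by exact_mod_cast hl
  set J : U → U → (V₁ × V₂) × (X₁ × X₂) × (Y₁ × Y₂) → ℝ := fun u u' =>
    useLaw pV₁ pV₂ (pX₁ u) (pX₂ u') W with hJdef
  have hJ : ∀ u u', J u u' ∈ stdSimplex ℝ _ := fun u u' =>
    useLaw_mem_stdSimplex hpV₁ hpV₂ (hpX₁ u) (hpX₂ u') hW
  have hqJ : q = fun ω => pU ω.1 * J ω.1 ω.1 ω.2 := by rw [hq, jointPmf_eq]
  have hJ1 : ∀ u, ∑ ω, J u u ω = 1 := fun u => (hJ u u).2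
  have hqs : q ∈ stdSimplex ℝ _ := by
    rw [hqJ]; exact mixture_mem_stdSimplex hpU fun u => hJ u u
  set W₁ : U → Y₁ → ℝ := fun u => law (J u u) fun ω => ω.2.2.1 with hW₁def
  set W₂ : U → Y₂ → ℝ := fun u => law (J u u) fun ω => ω.2.2.2 with hW₂def
  have hW₁ : ∀ u, W₁ u ∈ stdSimplex ℝ Y₁ := fun u => law_mem_stdSimplex (hJ u u) _
  have hW₂ : ∀ u, W₂ u ∈ stdSimplex ℝ Y₂ := fun u => law_mem_stdSimplex (hJ u u) _
  -- the inner code exponents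
  set E₁ := randomCodingExponent (A + ρ) pU W₁ with hE₁def
  set E₂ := randomCodingExponent (A + ρ) pU W₂ with hE₂def
  have hlawU : law q (fun ω => ω.1) = pU := by
    rw [hqJ]; funext u; exact law_mixture_index pU hJ1 u
  have hE₁ : randomCodingExponent (A + ρ) (law q fun ω => ω.1)
      (condLaw q (fun ω => ω.2.2.2.1) fun ω => ω.1) = E₁ := by
    rw [hlawU]
    refine randomCodingExponent_congr (A + ρ) hpU.1 fun u hu => ?_
    rw [hqJ]
    exact condLaw_mixture hJ1 (fun ω => ω.2.2.1) hu
  have hE₂ : randomCodingExponent (A + ρ) (law q fun ω => ω.1)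
      (condLaw q (fun ω => ω.2.2.2.2) fun ω => ω.1) = E₂ := by
    rw [hlawU]
    refine randomCodingExponent_congr (A + ρ) hpU.1 fun u hu => ?_
    rw [hqJ]
    exact condLaw_mixture hJ1 (fun ω => ω.2.2.2) hu
  rw [innerCodeError, hE₁, hE₂] at hφ_def
  set ξ := blockDisagreement pS f₁ f₂ l with hξ
  have hξ0 : 0 ≤ ξ := blockDisagreement_nonneg hpS f₁ f₂ l
  have hpK := law_mem_stdSimplex hpS fun s => f₁ s.1
  set pK := law pS fun s => f₁ s.1 with hpKdef
  have hKne : Nonempty K := by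
    obtain ⟨k, _⟩ := exists_eq_minPosProb hpK
    exact ⟨k⟩
  have hτ : Real.exp (-2 * δ ^ 2 * minPosProb pK ^ 2 * l) ≤ atypicalityBound pK l δ := by
    unfold atypicalityBound
    have : (1 : ℝ) ≤ Fintype.card K := by exact_mod_cast Fintype.card_pos
    refine le_mul_of_one_le_left (Real.exp_pos _).le (by linarith)
  have hτ0 : 0 < atypicalityBound pK l δ := (Real.exp_pos _).trans_le hτ
  have hx₁ := Real.exp_pos (-(l : ℝ) * (E₁ - ρ))
  have hx₂ := Real.exp_pos (-(l : ℝ) * (E₂ - ρ))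
  have hφ0 : 0 < φ := by linarith
  have hle₁ : Real.exp (-(l : ℝ) * (E₁ - ρ)) ≤ φ := by linarith
  have hle₂ : Real.exp (-(l : ℝ) * (E₂ - ρ)) ≤ φ := by linarith
  have hφ1 : φ < 1 := by linarith
  have hlog0 : 0 < -Real.log φ := by rw [neg_pos]; exact Real.log_neg hφ0 hφ1
  -- alphabet sizes and smallness
  have hU := two_le_card_of_exp_le hpU hW₁ hl0 hA hρ hφ0 hφ1 hle₁
  have hU' : (2 : ℝ) ≤ Fintype.card U := by exact_mod_cast hU
  have hgap₁ := le_mul_log_card_of_exp_le hpU hW₁ hl0 hρ hφ0 hφ1 hle₁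
  have hgap₂ := le_mul_log_card_of_exp_le hpU hW₂ hl0 hρ hφ0 hφ1 hle₂
  have hlA : 0 ≤ (l : ℝ) * A := by positivity
  have hAy₁ : A < Real.log (Fintype.card Y₁) := by
    have := pos_of_mul_pos_right (hlog0.trans_le hgap₁) hl0.le
    linarith
  have hAy₂ : A < Real.log (Fintype.card Y₂) := by
    have := pos_of_mul_pos_right (hlog0.trans_le hgap₂) hl0.le
    linarith
  have hY₁ := two_le_card_of_log_pos (hA.trans_lt hAy₁)
  have hY₂ := two_le_card_of_log_pos (hA.trans_lt hAy₂)
  have hY₁' : (2 : ℝ) ≤ Fintype.card Y₁ := by exact_mod_cast hY₁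
  have hY₂' : (2 : ℝ) ≤ Fintype.card Y₂ := by exact_mod_cast hY₂
  -- joint laws of the two receivers
  set Q₁ := law q fun ω => (ω.2.1.1, ω.2.2.2.1) with hQ₁def
  set Q₂ := law q fun ω => (ω.2.1.2, ω.2.2.2.2) with hQ₂def
  have hQ₁s : Q₁ ∈ stdSimplex ℝ _ := law_mem_stdSimplex hqs _
  have hQ₂s : Q₂ ∈ stdSimplex ℝ _ := law_mem_stdSimplex hqs _
  have hQ₁ : ∀ v y, Q₁ (v, y) = ∑ u, pU u * law (J u u) (fun ω => (ω.1.1, ω.2.2.1)) (v, y) := by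
    intro v y
    rw [hQ₁def, hqJ]
    exact law_mixture pU (fun u => J u u) (fun ω => (ω.1.1, ω.2.2.1)) (v, y)
  have hQ₂ : ∀ v y, Q₂ (v, y) = ∑ u, pU u * law (J u u) (fun ω => (ω.1.2, ω.2.2.2)) (v, y) := by
    intro v y
    rw [hQ₂def, hqJ]
    exact law_mixture pU (fun u => J u u) (fun ω => (ω.1.2, ω.2.2.2)) (v, y)
  have hQV₁ : law Q₁ Prod.fst = pV₁ := by
    funext v
    rw [hQ₁def, law_law, hqJ]
    refine (law_mixture pU (fun u => J u u) (fun ω => ω.1.1) v).trans ?_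
    simp_rw [hJdef, law_useLaw_left hpV₂ (hpX₁ _) (hpX₂ _) hW]
    rw [← Finset.sum_mul, hpU.2, one_mul]
  have hQV₂ : law Q₂ Prod.fst = pV₂ := by
    funext v
    rw [hQ₂def, law_law, hqJ]
    refine (law_mixture pU (fun u => J u u) (fun ω => ω.1.2) v).trans ?_
    simp_rw [hJdef, law_useLaw_right hpV₁ (hpX₁ _) (hpX₂ _) hW]
    rw [← Finset.sum_mul, hpU.2, one_mul]
  rw [← mutualInfo_law_pair, ← hQ₁def] at h₁
  rw [← mutualInfo_law_pair, ← hQ₂def] at h₂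
  have hloss := loss_lt_log_card hpS.1 _ _ hQ₁s hB hφ0 hφ1 h₁
  obtain ⟨hlam, hψ1⟩ := small_of_loss_lt hφ0 hφ hU' (by linarith) hloss
  -- block length, bins
  set t := Fintype.card U + 2 with ht
  obtain ⟨fU, hfU⟩ := exists_repeat_type hpU_type (by omega : 0 < t)
  set L := t * l with hLdef
  have hL0 : 0 < L := by positivity
  have hL1 : (1 : ℝ) ≤ L := by exact_mod_cast hL0
  have hLr : (L : ℝ) = ((Fintype.card U : ℝ) + 2) * l := by rw [hLdef, ht]; push_cast; ring
  set ψ := ((Fintype.card U : ℝ) + 2) * φ with hψdef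
  have hψ0 : 0 < ψ := by positivity
  set ymin : ℝ := min (Fintype.card Y₁ : ℝ) (Fintype.card Y₂ : ℝ) with hymin
  have hymin2 : 2 ≤ ymin := le_min hY₁' hY₂'
  -- Bins are enlarged by `exp (L β)` so that fewer messages remain for the inner code. The smaller
  -- output alphabet is used because both receivers must afford this.
  set β := 1 / 8 * (Fintype.card U * ymin * φ * -Real.log φ) with hβdef
  have hβ0 : 0 ≤ β := by positivity
  have hβ₁ : β ≤ 1 / 8 * (Fintype.card U * Fintype.card Y₁ * φ * -Real.log φ) := by
    rw [hβdef]; gcongr; exact min_le_left _ _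
  have hβ₂ : β ≤ 1 / 8 * (Fintype.card U * Fintype.card Y₂ * φ * -Real.log φ) := by
    rw [hβdef]; gcongr; exact min_le_right _ _
  set T := typicalSet pK δ L with hTdef
  have hTcard : (T.card : ℝ) ≤ Real.exp (L * (A + B)) := by
    refine (card_typicalSet_le hpK δ L).trans ?_
    rw [Real.exp_le_exp]
    exact mul_le_mul_of_nonneg_left hAB (by positivity)
  obtain ⟨n, hn⟩ : ∃ n, n = ⌊Real.exp (L * (B + β))⌋₊ := ⟨_, rfl⟩
  obtain ⟨hn0, hlogn, hdiv, hlogM⟩ := bin_count_le (by positivity : (0 : ℝ) ≤ L) hA hB hβ0 hTcard hn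
  obtain ⟨M, hMdef⟩ : ∃ M, M = T.card / n + 1 := ⟨_, rfl⟩
  have hMne : NeZero M := ⟨by rw [hMdef]; exact Nat.succ_ne_zero _⟩
  obtain ⟨b, hb⟩ : ∃ b : (Fin L → K) → Fin M, ∀ m, (T.filter fun k => b k = m).card ≤ n := by
    subst hMdef
    exact exists_binning T hn0
  have hMn : T.card ≤ Fintype.card (Fin M) * n := by
    rw [Fintype.card_fin, hMdef, mul_comm]
    exact (Nat.lt_mul_div_succ _ hn0).le
  have hlogM' : Real.log (Fintype.card (Fin M)) ≤ L * A + 1.1 := by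
    rw [Fintype.card_fin, hMdef]; exact hlogM
  have hcard : ((Fintype.card (Fin M) : ℝ) - 1) * ((L : ℝ) + 1) ^ Fintype.card U
      ≤ Real.exp (L * (A + ρ) + ((Fintype.card U : ℝ) + 1) * -Real.log φ) := by
    refine message_count_le hφ0 hlam hymin2 hL1 hρ hβdef ?_
    rw [Fintype.card_fin, hMdef]
    push_cast
    rw [add_sub_cancel_right]
    exact hdiv
  -- inner code
  have hiid := iid_mem_stdSimplex hpS L
  have hpM := law_mem_stdSimplex hiid fun ω => b fun i => f₁ (ω i).1
  set pM := law (iid pS L) fun ω => b fun i => f₁ (ω i).1 with hpMdef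
  -- The inner code is built for the actual pmf of the first user's bin index, so its average error
  -- is the quantity in the budget.
  obtain ⟨c, dec₁, dec₂, hc, hPe⟩ := exists_constant_composition_code hL0 hpU hfU hW₁ hW₂ (A + ρ)
    (((Fintype.card U : ℝ) + 1) * -Real.log φ) (by positivity) hcard pM hpM
  have hin₁ := inner_error_le (Nat.cast_nonneg (Fintype.card U)) hl0 hρ hφ0 hLr hle₁
  have hin₂ := inner_error_le (Nat.cast_nonneg (Fintype.card U)) hl0 hρ hφ0 hLr hle₂
  have hPe₁0 : 0 ≤ ∑ m, pM m * ∑ y : Fin L → Y₁, (∏ i, W₁ (c m i) (y i)) * ind (dec₁ y ≠ m) :=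
    Finset.sum_nonneg fun m _ => mul_nonneg (hpM.1 m) (Finset.sum_nonneg fun y _ =>
      mul_nonneg (Finset.prod_nonneg fun i _ => (hW₁ _).1 _) (ind_nonneg _))
  have hPe₂0 : 0 ≤ ∑ m, pM m * ∑ y : Fin L → Y₂, (∏ i, W₂ (c m i) (y i)) * ind (dec₂ y ≠ m) :=
    Finset.sum_nonneg fun m _ => mul_nonneg (hpM.1 m) (Finset.sum_nonneg fun y _ =>
      mul_nonneg (Finset.prod_nonneg fun i _ => (hW₂ _).1 _) (ind_nonneg _))
  have hξL : blockDisagreement pS f₁ f₂ L ≤ ((Fintype.card U : ℝ) + 2) * ξ := by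
    have := blockDisagreement_mul_le hpS f₁ f₂ t l
    rw [ht] at this
    push_cast at this
    exact this
  -- `ψ` is `|U| + 2` times `φ`, but only the disagreement term needs this factor; the two inner
  -- code errors enter once.
  have hψge : ((Fintype.card U : ℝ) + 2) * ξ + (Real.exp (-(l : ℝ) * (E₁ - ρ))
      + Real.exp (-(l : ℝ) * (E₂ - ρ))) ≤ ψ := by
    have g1 : 0 ≤ ((Fintype.card U : ℝ) + 1) * (Real.exp (-(l : ℝ) * (E₁ - ρ))
      + Real.exp (-(l : ℝ) * (E₂ - ρ))) := by positivity
    have g2 : 0 ≤ ((Fintype.card U : ℝ) + 2) * atypicalityBound pK l δ := by positivity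
    rw [hψdef, hφ_def]
    linarith
  have herr₁ : blockDisagreement pS f₁ f₂ L
      + ∑ m, pM m * ∑ y : Fin L → Y₁, (∏ i, W₁ (c m i) (y i)) * ind (dec₁ y ≠ m) ≤ ψ := by
    linarith
  have herr₂ : blockDisagreement pS f₁ f₂ L
      + ∑ m, pM m * ∑ y : Fin L → Y₂, (∏ i, W₂ (c m i) (y i)) * ind (dec₂ y ≠ m) ≤ ψ := by
    linarith
  have hT : ∑ k : Fin L → K, (∏ i, pK (k i)) * ind (k ∉ T) ≤ φ := by
    -- This uses `|U| ≥ 2`, which holds because a single letter could not give a positive exponent.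
    have h4 : 4 * l ≤ L := by rw [hLdef, ht]; gcongr; omega
    have := prob_not_typical_le hpK hδ h4
    linarith
  -- drift of the two metrics
  set P₁ := condPmf pS (fun s => s.1) (fun s => f₁ s.1) with hP₁
  set P₂ := condPmf pS (fun s => s.2) (fun s => f₁ s.1) with hP₂
  have hdr₁ := receiver_drift_pos hl hLdef hpS f₁ f₂ (fun s => s.1) hpU hfU hc hJ
    (fun ω => ω.1.1) (fun ω => ω.2.2.1) hQ₁ hφ0 hlam hU hY₁ hψdef hψ1
    (by linarith) hAy₁.le hβ₁ hn0 hlogn hlogM' h₁ T b dec₁ hT herr₁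
  have hdr₂ := receiver_drift_pos hl hLdef hpS f₁ f₂ (fun s => s.2) hpU hfU hc hJ
    (fun ω => ω.1.2) (fun ω => ω.2.2.2) hQ₂ hφ0 hlam hU hY₂ hψdef hψ1
    (by linarith) hAy₂.le hβ₂ hn0 hlogn hlogM' h₂ T b dec₂ hT herr₂
  have hS : Nonempty S₁ ∧ Nonempty S₂ := by
    rcases isEmpty_or_nonempty (S₁ × S₂) with he | ⟨⟨s⟩⟩
    · have := hpS.2
      simp at this
    · exact ⟨⟨s.1⟩, ⟨s.2⟩⟩
  obtain ⟨hS₁, hS₂⟩ := hS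
  set θ₁ : (Fin L → S₁) → (Fin L → V₁) → (Fin L → Y₁) → ℝ := fun s v y =>
    channelMetric Q₁ ψ v y * sourceMetric T b n P₁ φ ψ (dec₁ y) s with hθ₁
  set θ₂ : (Fin L → S₂) → (Fin L → V₂) → (Fin L → Y₂) → ℝ := fun s v y =>
    channelMetric Q₂ ψ v y * sourceMetric T b n P₂ φ ψ (dec₂ y) s with hθ₂
  have hP₁0 : ∀ k s, 0 ≤ P₁ k s := fun k s => condPmf_nonneg hpS.1 _ _ _ _
  have hP₂0 : ∀ k s, 0 ≤ P₂ k s := fun k s => condPmf_nonneg hpS.1 _ _ _ _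
  have hψle : ψ ≤ 1 := by linarith
  have hθ₁pos : ∀ s v y, 0 < θ₁ s v y := fun s v y =>
    mul_pos (hψ0.trans_le (le_channelMetric hQ₁s.1 hψle v y))
      (sourceMetric_pos hP₁0 hφ0 hφ1.le hψ0.le hψle _ _)
  have hθ₂pos : ∀ s v y, 0 < θ₂ s v y := fun s v y =>
    mul_pos (hψ0.trans_le (le_channelMetric hQ₂s.1 hψle v y))
      (sourceMetric_pos hP₂0 hφ0 hφ1.le hψ0.le hψle _ _)
  have hθ₁sum : ∀ y, ∑ s, ∑ v : Fin L → V₁, (∏ i, pV₁ (v i)) * θ₁ s v y ≤ 1 :=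
    sum_metric_le hQ₁s hQV₁ hφ0.le hφ1.le hψ0.le hψle hn0 (fun m => by convert hb m) hMn hP₁0
      (sum_condPmf_le_one pS _ _) dec₁
  have hθ₂sum : ∀ y, ∑ s, ∑ v : Fin L → V₂, (∏ i, pV₂ (v i)) * θ₂ s v y ≤ 1 :=
    sum_metric_le hQ₂s hQV₂ hφ0.le hφ1.le hψ0.le hψle hn0 (fun m => by convert hb m) hMn hP₂0
      (sum_condPmf_le_one pS _ _) dec₂
  -- Both users apply the same binning and the same codebook to their own version of the common
  -- part.
  set u₁ : (Fin L → S₁) → Fin L → U := fun s => c (b fun i => f₁ (s i)) with hu₁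
  set u₂ : (Fin L → S₂) → Fin L → U := fun s => c (b fun i => f₂ (s i)) with hu₂
  have hd₁ : 0 < ∑ s₁, ∑ s₂, ∑ a₁, ∑ a₂, ∑ z, blockSource pS s₁ s₂ *
      userKernel pV₁ pX₁ (u₁ s₁) a₁ * userKernel pV₂ pX₂ (u₂ s₂) a₂ *
      blockChannel W a₁.2 a₂.2 z * Real.log (θ₁ s₁ a₁.1 z.1) := by
    rw [sum_block_expectation pS pV₁ pV₂ pX₁ pX₂ W u₁ u₂
      fun s₁ _ a₁ _ z => Real.log (θ₁ s₁ a₁.1 z.1)]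
    exact hdr₁
  have hd₂ : 0 < ∑ s₁, ∑ s₂, ∑ a₁, ∑ a₂, ∑ z, blockSource pS s₁ s₂ *
      userKernel pV₁ pX₁ (u₁ s₁) a₁ * userKernel pV₂ pX₂ (u₂ s₂) a₂ *
      blockChannel W a₁.2 a₂.2 z * Real.log (θ₂ s₂ a₂.1 z.2) := by
    rw [sum_block_expectation pS pV₁ pV₂ pX₁ pX₂ W u₁ u₂
      fun _ s₂ _ a₂ z => Real.log (θ₂ s₂ a₂.1 z.2)]
    exact hdr₂
  refine ⟨L, hL0, fun r ε hε => ?_⟩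
  exact exists_code_of_pos_drift (fun s₁ s₂ => blockSource pS s₁ s₂)
    (blockSource_nonneg hpS) (sum_blockSource hpS L)
    (fun s => userKernel pV₁ pX₁ (u₁ s)) (fun s => userKernel_mem_stdSimplex hpV₁ hpX₁ _)
    (fun s => userKernel pV₂ pX₂ (u₂ s)) (fun s => userKernel_mem_stdSimplex hpV₂ hpX₂ _)
    (fun v => ∏ i, pV₁ (v i)) (fun s v => sum_userKernel pV₁ hpX₁ _ v)
    (fun v => ∏ i, pV₂ (v i)) (fun s v => sum_userKernel pV₂ hpX₂ _ v)
    (blockChannel W) (blockChannel_mem_stdSimplex hW)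
    θ₁ hθ₁pos hθ₁sum θ₂ hθ₂pos hθ₂sum hd₁ hd₂
    (fun t₁ t₂ => blockSource pS t₁ t₂) (blockSource_nonneg hpS) (sum_blockSource hpS r) ε hε

end BlockCode

/-! ### From super-letters to arbitrary block lengths. -/

section Assembly

variable {n m L r : ℕ} {α S₁ S₂ X₁ X₂ Y₁ Y₂ : Type*} [Fintype S₁] [Fintype S₂]
  [Fintype Y₁] [Fintype Y₂]

/-- Cutting a sequence into `m` blocks of length `L` and a remainder. -/
def splitEquiv (E : Fin n ≃ (Fin m × Fin L) ⊕ Fin r) (α : Type*) :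
    (Fin n → α) ≃ (Fin m → Fin L → α) × (Fin r → α) where
  toFun s := (fun i j => s (E.symm (Sum.inl (i, j))), fun k => s (E.symm (Sum.inr k)))
  invFun w i := Sum.elim (fun x => w.1 x.1 x.2) w.2 (E i)
  left_inv s := by
    funext i
    obtain ⟨x, rfl⟩ := E.symm.surjective i
    rcases x with ⟨x, y⟩ | x <;> simp
  right_inv w := by simp

@[simp] lemma splitEquiv_symm_inl (E : Fin n ≃ (Fin m × Fin L) ⊕ Fin r)
    (w : (Fin m → Fin L → α) × (Fin r → α)) (i : Fin m) (j : Fin L) :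
    (splitEquiv E α).symm w (E.symm (Sum.inl (i, j))) = w.1 i j := by
  simp [splitEquiv]

@[simp] lemma splitEquiv_symm_inr (E : Fin n ≃ (Fin m × Fin L) ⊕ Fin r)
    (w : (Fin m → Fin L → α) × (Fin r → α)) (k : Fin r) :
    (splitEquiv E α).symm w (E.symm (Sum.inr k)) = w.2 k := by
  simp [splitEquiv]

/-- Cutting an output sequence into blocks, collected receiver by receiver, and a remainder. -/
def splitOutputEquiv (E : Fin n ≃ (Fin m × Fin L) ⊕ Fin r) :
    (Fin n → Y₁ × Y₂) ≃ (Fin m → (Fin L → Y₁) × (Fin L → Y₂)) × (Fin r → Y₁ × Y₂) :=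
  (splitEquiv E (Y₁ × Y₂)).trans
    (Equiv.prodCongr (Equiv.piCongrRight fun _ => Equiv.arrowProdEquivProdArrow _ _ _)
      (Equiv.refl _))

lemma splitOutputEquiv_symm_inl (E : Fin n ≃ (Fin m × Fin L) ⊕ Fin r)
    (z : Fin m → (Fin L → Y₁) × (Fin L → Y₂)) (v : Fin r → Y₁ × Y₂) (i : Fin m) (j : Fin L) :
    (splitOutputEquiv E).symm (z, v) (E.symm (Sum.inl (i, j))) = ((z i).1 j, (z i).2 j) := by
  simp [splitOutputEquiv, splitEquiv, Equiv.arrowProdEquivProdArrow]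

lemma splitOutputEquiv_symm_inr (E : Fin n ≃ (Fin m × Fin L) ⊕ Fin r)
    (z : Fin m → (Fin L → Y₁) × (Fin L → Y₂)) (v : Fin r → Y₁ × Y₂) (k : Fin r) :
    (splitOutputEquiv E).symm (z, v) (E.symm (Sum.inr k)) = v k := by
  simp [splitOutputEquiv, splitEquiv]

lemma prod_split (E : Fin n ≃ (Fin m × Fin L) ⊕ Fin r) (g : Fin n → ℝ) :
    ∏ i, g i = (∏ i, ∏ j, g (E.symm (Sum.inl (i, j)))) * ∏ k, g (E.symm (Sum.inr k)) := by
  rw [← E.symm.prod_comp g, Fintype.prod_sum_type, Fintype.prod_prod_type]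

lemma errorProb_eq (pS : S₁ × S₂ → ℝ) (W : X₁ → X₂ → Y₁ × Y₂ → ℝ)
    (e₁ : (Fin n → S₁) → Fin n → X₁) (e₂ : (Fin n → S₂) → Fin n → X₂)
    (d₁ : (Fin n → Y₁) → Fin n → S₁) (d₂ : (Fin n → Y₂) → Fin n → S₂) :
    errorProb pS W n e₁ e₂ d₁ d₂ = ∑ s₁ : Fin n → S₁, ∑ s₂ : Fin n → S₂, ∑ y : Fin n → Y₁ × Y₂,
      (∏ i, pS (s₁ i, s₂ i)) * (∏ i, W (e₁ s₁ i) (e₂ s₂ i) (y i)) *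
        ind (d₁ (fun k => (y k).1) ≠ s₁ ∨ d₂ (fun k => (y k).2) ≠ s₂) := by
  have h : errorProb pS W n e₁ e₂ d₁ d₂ = ∑ s : Fin n → S₁ × S₂, ∑ y : Fin n → Y₁ × Y₂,
      (∏ i, pS (s i)) * (∏ i, W (e₁ (fun k => (s k).1) i) (e₂ (fun k => (s k).2) i) (y i)) *
        ind (d₁ (fun k => (y k).1) ≠ (fun k => (s k).1) ∨
          d₂ (fun k => (y k).2) ≠ fun k => (s k).2) := by
    unfold errorProb prob
    rw [Fintype.sum_prod_type]
    refine Finset.sum_congr rfl fun s _ => Finset.sum_congr rfl fun y _ => ?_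
    by_cases hc : d₁ (fun k => (y k).1) ≠ (fun k => (s k).1) ∨
        d₂ (fun k => (y k).2) ≠ fun k => (s k).2
    · rw [Set.indicator_of_mem (by exact hc), ind_of hc, mul_one]
      rfl
    · rw [Set.indicator_of_notMem (by exact hc), ind_not hc, mul_zero]
  rw [h]
  symm
  rw [← Fintype.sum_prod_type']
  exact Fintype.sum_equiv (Equiv.arrowProdEquivProdArrow _ _ _).symm _ _ fun s => rfl

/-- A code over super-letters that also carries the remaining `r` source letters yields a code for
the original block length. -/
lemma exists_code_of_block_code [Nonempty X₁] [Nonempty X₂]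
    (E : Fin n ≃ (Fin m × Fin L) ⊕ Fin r) (pS : S₁ × S₂ → ℝ)
    {W : X₁ → X₂ → Y₁ × Y₂ → ℝ} (hW : ∀ x₁ x₂, W x₁ x₂ ∈ stdSimplex ℝ (Y₁ × Y₂))
    (e₁ : (Fin m → Fin L → S₁) × (Fin r → S₁) → Fin m → Fin L → X₁)
    (e₂ : (Fin m → Fin L → S₂) × (Fin r → S₂) → Fin m → Fin L → X₂)
    (d₁ : (Fin m → Fin L → Y₁) → (Fin m → Fin L → S₁) × (Fin r → S₁))
    (d₂ : (Fin m → Fin L → Y₂) → (Fin m → Fin L → S₂) × (Fin r → S₂)) :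
    ∃ (e₁' : (Fin n → S₁) → Fin n → X₁) (e₂' : (Fin n → S₂) → Fin n → X₂)
      (d₁' : (Fin n → Y₁) → Fin n → S₁) (d₂' : (Fin n → Y₂) → Fin n → S₂),
      errorProb pS W n e₁' e₂' d₁' d₂' =
        ∑ w₁, ∑ w₂, ∑ z : Fin m → (Fin L → Y₁) × (Fin L → Y₂),
          (∏ i, blockSource pS (w₁.1 i) (w₂.1 i)) * blockSource pS w₁.2 w₂.2 *
            (∏ i, blockChannel W (e₁ w₁ i) (e₂ w₂ i) (z i)) *
          ind (d₁ (fun i => (z i).1) ≠ w₁ ∨ d₂ (fun i => (z i).2) ≠ w₂) := by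
  -- Filler inputs for the last `r` channel uses, whose outputs the decoders ignore; the leftover
  -- source letters travel with the super-letters.
  set x₁ := Classical.arbitrary X₁
  set x₂ := Classical.arbitrary X₂
  refine ⟨fun s => (splitEquiv E X₁).symm (e₁ (splitEquiv E S₁ s), fun _ => x₁),
    fun s => (splitEquiv E X₂).symm (e₂ (splitEquiv E S₂ s), fun _ => x₂),
    fun y => (splitEquiv E S₁).symm (d₁ (splitEquiv E Y₁ y).1),
    fun y => (splitEquiv E S₂).symm (d₂ (splitEquiv E Y₂ y).1), ?_⟩
  rw [errorProb_eq, ← (splitEquiv E S₁).symm.sum_comp]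
  refine Finset.sum_congr rfl fun w₁ _ => ?_
  rw [← (splitEquiv E S₂).symm.sum_comp]
  refine Finset.sum_congr rfl fun w₂ _ => ?_
  rw [← (splitOutputEquiv E).symm.sum_comp, Fintype.sum_prod_type]
  refine Finset.sum_congr rfl fun z _ => ?_
  have hterm : ∀ v : Fin r → Y₁ × Y₂,
      (∏ i, pS ((splitEquiv E S₁).symm w₁ i, (splitEquiv E S₂).symm w₂ i)) *
      (∏ i, W ((splitEquiv E X₁).symm
          (e₁ (splitEquiv E S₁ ((splitEquiv E S₁).symm w₁)), fun _ => x₁) i)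
        ((splitEquiv E X₂).symm
          (e₂ (splitEquiv E S₂ ((splitEquiv E S₂).symm w₂)), fun _ => x₂) i)
        ((splitOutputEquiv E).symm (z, v) i)) *
      ind ((splitEquiv E S₁).symm (d₁ (splitEquiv E Y₁ fun k =>
          ((splitOutputEquiv E).symm (z, v) k).1).1) ≠ (splitEquiv E S₁).symm w₁ ∨
        (splitEquiv E S₂).symm (d₂ (splitEquiv E Y₂ fun k =>
          ((splitOutputEquiv E).symm (z, v) k).2).1) ≠ (splitEquiv E S₂).symm w₂)
      = (∏ i, blockSource pS (w₁.1 i) (w₂.1 i)) * blockSource pS w₁.2 w₂.2 *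
            (∏ i, blockChannel W (e₁ w₁ i) (e₂ w₂ i) (z i)) *
          ind (d₁ (fun i => (z i).1) ≠ w₁ ∨ d₂ (fun i => (z i).2) ≠ w₂) *
          ∏ k, W x₁ x₂ (v k) := by
    intro v
    have hy₁ : (splitEquiv E Y₁ fun k => ((splitOutputEquiv E).symm (z, v) k).1).1
        = fun i => (z i).1 := by
      funext i j
      exact congrArg Prod.fst (splitOutputEquiv_symm_inl E z v i j)
    have hy₂ : (splitEquiv E Y₂ fun k => ((splitOutputEquiv E).symm (z, v) k).2).1
        = fun i => (z i).2 := by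
      funext i j
      exact congrArg Prod.snd (splitOutputEquiv_symm_inl E z v i j)
    rw [hy₁, hy₂, prod_split E, prod_split E]
    simp only [splitEquiv_symm_inl, splitEquiv_symm_inr, splitOutputEquiv_symm_inl,
      splitOutputEquiv_symm_inr, Equiv.apply_symm_apply, ne_eq, EmbeddingLike.apply_eq_iff_eq]
    simp only [blockSource, blockChannel]
    ring
  -- The ignored outputs appear only through their probabilities, which sum to one.
  refine (Finset.sum_congr rfl fun v _ => hterm v).trans ?_
  rw [← Finset.mul_sum, sum_fun_prod_eq_one (fun _ => W x₁ x₂) fun _ => (hW _ _).2, mul_one]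

lemma nonempty_of_mem_stdSimplex {p : α → ℝ} [Fintype α] (hp : p ∈ stdSimplex ℝ α) :
    Nonempty α := by
  by_contra h
  rw [not_nonempty_iff] at h
  have := hp.2
  simp at this

/-- Reliable codes over super-letters, for every number of extra letters, make the sources
transmissible. -/
theorem transmissible_of_block_codes [Nonempty X₁] [Nonempty X₂] (pS : S₁ × S₂ → ℝ)
    {W : X₁ → X₂ → Y₁ × Y₂ → ℝ} (hW : ∀ x₁ x₂, W x₁ x₂ ∈ stdSimplex ℝ (Y₁ × Y₂)) (hL : 0 < L)
    (h : ∀ (r : ℕ) (ε : ℝ), 0 < ε → ∃ m₀ : ℕ, ∀ m ≥ m₀,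
      ∃ (e₁ : (Fin m → Fin L → S₁) × (Fin r → S₁) → Fin m → Fin L → X₁)
        (e₂ : (Fin m → Fin L → S₂) × (Fin r → S₂) → Fin m → Fin L → X₂)
        (d₁ : (Fin m → Fin L → Y₁) → (Fin m → Fin L → S₁) × (Fin r → S₁))
        (d₂ : (Fin m → Fin L → Y₂) → (Fin m → Fin L → S₂) × (Fin r → S₂)),
        ∑ w₁, ∑ w₂, ∑ z : Fin m → (Fin L → Y₁) × (Fin L → Y₂),
          (∏ i, blockSource pS (w₁.1 i) (w₂.1 i)) * blockSource pS w₁.2 w₂.2 *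
            (∏ i, blockChannel W (e₁ w₁ i) (e₂ w₂ i) (z i)) *
          ind (d₁ (fun i => (z i).1) ≠ w₁ ∨ d₂ (fun i => (z i).2) ≠ w₂) ≤ ε) :
    Transmissible pS W := by
  intro ε hε
  choose m₀ hm₀ using fun r => h r ε hε
  -- Only the remainders below `L` occur, so finitely many thresholds `m₀ r` have to be exceeded.
  refine ⟨L * (Finset.range L).sup m₀, fun n hn => ?_⟩
  have hrL : n % L < L := Nat.mod_lt n hL
  have hm : m₀ (n % L) ≤ n / L := by
    refine (Finset.le_sup (f := m₀) (Finset.mem_range.mpr hrL)).trans ?_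
    rw [Nat.le_div_iff_mul_le hL, mul_comm]
    exact hn
  obtain ⟨e₁, e₂, d₁, d₂, he⟩ := hm₀ (n % L) (n / L) hm
  have E : Fin n ≃ (Fin (n / L) × Fin L) ⊕ Fin (n % L) :=
    (finCongr (by rw [mul_comm]; exact (Nat.div_add_mod n L).symm :
      n = n / L * L + n % L)).trans (finSumFinEquiv.symm.trans
        (Equiv.sumCongr finProdFinEquiv.symm (Equiv.refl _)))
  obtain ⟨e₁', e₂', d₁', d₂', heq⟩ := exists_code_of_block_code E pS hW e₁ e₂ d₁ d₂
  exact ⟨e₁', e₂', d₁', d₂', heq.trans_le he⟩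

end Assembly

end SourceIC

end

open SourceIC
theorem theorem2 {S₁ S₂ X₁ X₂ Y₁ Y₂ K U V₁ V₂ : Type*}
    [Fintype S₁] [Fintype S₂] [Fintype X₁] [Fintype X₂] [Fintype Y₁] [Fintype Y₂]
    [Fintype K] [Fintype U] [Fintype V₁] [Fintype V₂]
    (pS : S₁ × S₂ → ℝ) (hpS : pS ∈ stdSimplex ℝ (S₁ × S₂))
    (W : X₁ → X₂ → Y₁ × Y₂ → ℝ) (hW : ∀ x₁ x₂, W x₁ x₂ ∈ stdSimplex ℝ (Y₁ × Y₂))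
    (f₁ : S₁ → K) (f₂ : S₂ → K)
    (l : ℕ) (hl : 1 ≤ l) (δ : ℝ) (hδ : 0 < δ)
    (pU : U → ℝ) (hpU : pU ∈ stdSimplex ℝ U) (hpU_type : IsTypeOfLength pU l)
    (pV₁ : V₁ → ℝ) (hpV₁ : pV₁ ∈ stdSimplex ℝ V₁)
    (pV₂ : V₂ → ℝ) (hpV₂ : pV₂ ∈ stdSimplex ℝ V₂)
    (pX₁ : U → V₁ → X₁ → ℝ) (hpX₁ : ∀ u v, pX₁ u v ∈ stdSimplex ℝ X₁)
    (pX₂ : U → V₂ → X₂ → ℝ) (hpX₂ : ∀ u v, pX₂ u v ∈ stdSimplex ℝ X₂)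
    (A B ρ : ℝ) (hA : 0 ≤ A) (hB : 0 ≤ B) (hρ : ρ ∈ Set.Ioo 0 A)
    (q : U × (V₁ × V₂) × (X₁ × X₂) × (Y₁ × Y₂) → ℝ)
    (hq : q = jointPmf pU pV₁ pV₂ pX₁ pX₂ W)
    (φ : ℝ)
    (hφ_def : φ = innerCodeError q A ρ l + blockDisagreement pS f₁ f₂ l
      + atypicalityBound (law pS fun s => f₁ s.1) l δ)
    (hφ : φ ∈ Set.Ico 0 (1 / 2))
    (hAB : (1 + δ) * entropy pS (fun s => f₁ s.1) ≤ A + B)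
    (h₁ : B + condEntropy pS (fun s => s.1) (fun s => f₁ s.1)
        + sourceLoss l φ (Fintype.card S₁)
      < mutualInfo q (fun ω => ω.2.1.1) (fun ω => ω.2.2.2.1)
        - channelLoss (Fintype.card Y₁) φ (Fintype.card U))
    (h₂ : B + condEntropy pS (fun s => s.2) (fun s => f₁ s.1)
        + sourceLoss l φ (Fintype.card S₂)
      < mutualInfo q (fun ω => ω.2.1.2) (fun ω => ω.2.2.2.2)
        - channelLoss (Fintype.card Y₂) φ (Fintype.card U)) :
    Transmissible pS W := by
  -- The input kernels being pmfs provides the filler letters for the unused channel slots.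
  have hX₁ : Nonempty X₁ := nonempty_of_mem_stdSimplex (hpX₁
    (nonempty_of_mem_stdSimplex hpU).some (nonempty_of_mem_stdSimplex hpV₁).some)
  have hX₂ : Nonempty X₂ := nonempty_of_mem_stdSimplex (hpX₂
    (nonempty_of_mem_stdSimplex hpU).some (nonempty_of_mem_stdSimplex hpV₂).some)
  obtain ⟨L, hL, h⟩ := exists_block_code pS hpS W hW f₁ f₂ l hl δ hδ pU hpU hpU_type pV₁ hpV₁ pV₂
    hpV₂ pX₁ hpX₁ pX₂ hpX₂ A B ρ hA hB hρ.1 q hq φ hφ_def hφ.2 hAB h₁ h₂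
  exact transmissible_of_block_codes pS hW hL h
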